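/- Let $M$ be a smooth Riemannian manifold without boundary, $V\subseteq M$ open, and $S\subset M$ a smooth embedded hypersurface such that $V\setminus S$ is the disjoint union of two open sets $V_1,V_2$. Let $U$ be a real function (the potential) on $V$ whose restriction to $V_i$ extends to a smooth function $U_i$ on $\overline{V}_i\cap V$ ($i=1,2$). Let $e\in\mathbb R$ (the total energy) satisfy $U<e$ on $V$ and $U_i<e$ on $\overline V_i\cap V$; put $\eta=\sqrt{2(e-U)}$, $\eta_i=\sqrt{2(e-U_i)}$. The optical length of an absolutely continuous path $\sigma:[-a,a]\to V$ is $L(\sigma)=\int_{-a}^{a}\eta(\sigma)\,\|\sigma'\|\,dt$. We call a path $\gamma:[-a,a]\to V$ with $L(\gamma)<\infty$ * *length minimizing* if $L(\gamma)\le L(\sigma)$ for all absolutely continuous $\sigma:[-a,a]\to V$ with the same endpoints as $\gamma$; * *length minimizing within its itinerary* if $L(\gamma)\le L(\sigma)$ for all those $\sigma$ that in addition satisfy, for each $t$ and $i=1,2$, $\sigma(t)\in V_i$ if and only if $\gamma(t)\in V_i$. Every length minimizing path is length minimizing within its itinerary. Let $m>0$, $a>0$, and let the absolutely continuous path $\gamma:[-a,a]\to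 V$ be length minimizing within its itinerary and parametrized by the mechanical time, i.e. $\|\gamma'(t)\|=\eta(\gamma(t))/\sqrt m$ for almost every $t$. Then: **Newton's equation.** On every interval $(\alpha,\beta)\subseteq(-a,a)$ with $\gamma((\alpha,\beta))\subset V_i$, the path $\gamma$ is $C^2$ and $$m\,\frac{D\gamma'}{dt}=-\operatorname{grad}U_i .$$ **Contact.** Let $t_0\in(-a,a)$ be a contact instant, i.e. $\gamma([t_0-\delta,t_0+\delta])\cap S=\{\gamma(t_0)\}$ for some $\delta>0$, that is reached from $V_1$, i.e. $\gamma(t)\in V_1$ for all $t<t_0$ close to $t_0$. Let $x=\gamma(t_0)$, let $\mathbf n$ be a unit normal vector of $S$ at $x$ pointing into $V_2$, and let $C_i=U_i(x)$. For $v\in T_xM$ write $v_n=\langle v,\mathbf n\rangle$ and $v_\tau=v-v_n\mathbf n$. Then the limits $v^-=\lim_{t\uparrow t_0}\gamma'(t)$ and $v^+=\lim_{t\downarrow t_0}\gamma'(t)$ exist, and: 1. *(Reflection.)* If $(v_n^-)^2-\frac2m(C_2-C_1)<0$, then $\gamma(t)\in V_1$ for all $t>t_0$ close to $t_0$ (and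 $\gamma(a)\in V_1$ if $\gamma$ does not meet $S$ during $(t_0,a]$), $v_n^+=-v_n^-$ and $v_\tau^+=v_\tau^-$. 2. *(Refraction.)* If $\gamma$ is length minimizing, $(v_n^-)^2-\frac2m(C_2-C_1)>0$ and $v_n^-\neq0$, then $\gamma(t)\in V_2$ for all $t>t_0$ close to $t_0$ (and $\gamma(a)\in V_2$ if $\gamma$ does not meet $S$ during $(t_0,a]$), $$v_n^+=\Big[(v_n^-)^2-\frac{2(C_2-C_1)}{m}\Big]^{1/2},\qquad v_\tau^+=v_\tau^- .$$ 3. *(Critical incoming angle.)* If $\gamma$ is length minimizing and $(v_n^-)^2-\frac2m(C_2-C_1)=0$, then $v^+=v^--\langle v^-,\mathbf n\rangle\mathbf n$, which is tangent to $S$ at $x$; $\gamma(a)$ lies in $V_1$, in $V_2$ or on $S$; and the angle $\theta_{\rm crit}$ between $v^-$ and $\mathbf n$ satisfies $$\sin\theta_{\rm crit}=\frac{\eta_2(x)}{\eta_1(x)}=\sqrt{\frac{e-C_2}{e-C_1}} .$$ -/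

import Mathlib

open Set Filter MeasureTheory Bundle
open scoped Manifold ContDiff Topology ENNReal

noncomputable section

namespace OpticalPath

section Plain

variable {F : Type*} [NormedAddCommGroup F] [NormedSpace ℝ F]
  {H : Type*} [TopologicalSpace H] (I : ModelWithCorners ℝ F H)
  {M : Type*} [TopologicalSpace M] [ChartedSpace H M]

/-- The velocity vector `γ'(t)`, a tangent vector at `γ t`. -/
def velocity (γ : ℝ → M) (t : ℝ) : TangentSpace I (γ t) :=
  mfderiv 𝓘(ℝ, ℝ) I γ t (1 : ℝ)

/-- `S` is a smooth embedded hypersurface of `M`: near each of its points it is the zero set of a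
smooth function whose differential does not vanish at that point. -/
def IsSmoothHypersurface (S : Set M) : Prop :=
  ∀ p ∈ S, ∃ (W : Set M) (f : M → ℝ), IsOpen W ∧ p ∈ W ∧ ContMDiffOn I 𝓘(ℝ, ℝ) ∞ f W ∧
    mfderiv I 𝓘(ℝ, ℝ) f p ≠ 0 ∧ S ∩ W = {q ∈ W | f q = 0}

/-- The curve `c` starts at `c 0 = x` with velocity `w`. -/
def HasInitialVelocity (c : ℝ → M) (x : M) (w : TangentSpace I x) : Prop :=
  c 0 = x ∧ HasMFDerivAt 𝓘(ℝ, ℝ) I c 0 (ContinuousLinearMap.toSpanSingleton ℝ (w : F))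

/-- The tangent space `T_x S`: all velocities at `x` of curves running in `S`. -/
def tangentTo (S : Set M) (x : M) : Set (TangentSpace I x) :=
  {w | ∃ c : ℝ → M, HasInitialVelocity I c x w ∧ ∀ᶠ s in 𝓝 (0 : ℝ), c s ∈ S}

/-- The tangent vector `w` at `x` points into `A`: some curve issuing from `x` with velocity `w`
runs in `A` for all small positive times. -/
def PointsInto (A : Set M) (x : M) (w : TangentSpace I x) : Prop :=
  ∃ c : ℝ → M, HasInitialVelocity I c x w ∧ ∀ᶠ s in 𝓝[>] (0 : ℝ), c s ∈ A

/-- `γ` is absolutely continuous on `[a, b]`: it is continuous there, and locally absolutely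
continuous when read in charts. -/
def IsACPath (γ : ℝ → M) (a b : ℝ) : Prop :=
  ContinuousOn γ (Icc a b) ∧
    ∀ t ∈ Icc a b, ∃ δ > 0,
      (∀ s ∈ Icc (max a (t - δ)) (min b (t + δ)), γ s ∈ (chartAt H (γ t)).source) ∧
      AbsolutelyContinuousOnInterval (fun s ↦ extChartAt I (γ t) (γ s))
        (max a (t - δ)) (min b (t + δ))

/-- `t` is a contact instant of `γ` with `S`: for some `δ > 0`, the arc `γ([t - δ, t + δ])` meets
`S` exactly in the point `γ t`. -/
def IsContactInstant (γ : ℝ → M) (S : Set M) (t : ℝ) : Prop :=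
  ∃ δ > 0, γ '' Icc (t - δ) (t + δ) ∩ S = {γ t}

/-- The refractive index `η = √(2 (e - U))` of the potential `U` at total energy `e`. -/
def refractiveIndex (U : M → ℝ) (e : ℝ) (x : M) : ℝ := √(2 * (e - U x))

/-- `v` is the velocity of `γ` immediately before the instant `t`: the limit of `γ'(s)` in the
tangent bundle as `s` increases to `t`. -/
def IsVelocityBefore [IsManifold I 1 M] (γ : ℝ → M) (t : ℝ) (v : TangentSpace I (γ t)) : Prop :=
  Tendsto (fun s ↦ (⟨γ s, velocity I γ s⟩ : TangentBundle I M)) (𝓝[<] t)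
    (𝓝 (⟨γ t, v⟩ : TangentBundle I M))

/-- `v` is the velocity of `γ` immediately after the instant `t`: the limit of `γ'(s)` in the
tangent bundle as `s` decreases to `t`. -/
def IsVelocityAfter [IsManifold I 1 M] (γ : ℝ → M) (t : ℝ) (v : TangentSpace I (γ t)) : Prop :=
  Tendsto (fun s ↦ (⟨γ s, velocity I γ s⟩ : TangentBundle I M)) (𝓝[>] t)
    (𝓝 (⟨γ t, v⟩ : TangentBundle I M))

/-- For a curve `c` in a vector space with a position dependent inner product `g`, the linear form
`w ↦ g(c'', w) + (∂_{c'} g)(c', w) - ½ (∂_w g)(c', c')`. It is `w ↦ g(D c'/dt, w)`, where `D` is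
the Levi-Civita connection of `g` (Christoffel symbols of the first kind). -/
def accelerationForm (g : F → F →L[ℝ] F →L[ℝ] ℝ) (c : ℝ → F) (t : ℝ) : F →L[ℝ] ℝ :=
  g (c t) (deriv (deriv c) t) + fderiv ℝ g (c t) (deriv c t) (deriv c t) -
    (1 / 2 : ℝ) • ((fderiv ℝ g (c t)).flip (deriv c t)).flip (deriv c t)

end Plain

section Riemannian

variable {F : Type*} [NormedAddCommGroup F] [NormedSpace ℝ F]
  {H : Type*} [TopologicalSpace H] (I : ModelWithCorners ℝ F H)
  {M : Type*} [TopologicalSpace M] [ChartedSpace H M]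
  [RiemannianBundle (fun x : M ↦ TangentSpace I x)]

/-- The tangent vector dual to a linear form on the tangent space, with respect to the Riemannian
metric: `⟨riesz ℓ, w⟩ = ℓ w`. -/
def riesz [FiniteDimensional ℝ F] {x : M} (ℓ : TangentSpace I x →L[ℝ] ℝ) : TangentSpace I x :=
  haveI : FiniteDimensional ℝ (TangentSpace I x) := inferInstanceAs (FiniteDimensional ℝ F)
  haveI : CompleteSpace (TangentSpace I x) := FiniteDimensional.complete ℝ _
  (InnerProductSpace.toDual ℝ (TangentSpace I x)).symm ℓ

/-- The Riemannian gradient. -/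
def grad [FiniteDimensional ℝ F] (U : M → ℝ) (x : M) : TangentSpace I x :=
  riesz I (mfderiv I 𝓘(ℝ, ℝ) U x)

/-- The Riemannian metric read in the preferred chart `φ` at `p`: at `y`, the bilinear form
`(u, w) ↦ ⟨Dφ⁻¹(y) u, Dφ⁻¹(y) w⟩`. -/
def chartMetric (p : M) (y : F) : F →L[ℝ] F →L[ℝ] ℝ :=
  let D : F →L[ℝ] TangentSpace I ((extChartAt I p).symm y) :=
    mfderiv 𝓘(ℝ, F) I (extChartAt I p).symm y
  (innerSL ℝ (E := TangentSpace I ((extChartAt I p).symm y))).bilinearComp D D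

/-- The covariant derivative `D γ'/dt` of the velocity along `γ`, for the Levi-Civita connection.
It is computed in the preferred chart `φ` at `γ t`, in which `T_{γ t} M` is the model vector space:
with `c = φ ∘ γ` and `g` the metric in the chart, it is the vector dual to the form
`accelerationForm g c t`, that is, `(D γ'/dt)^k = (c^k)'' + Γ^k_{ij} (c^i)' (c^j)'` with the
Christoffel symbols of `g`. -/
def covariantAcceleration [FiniteDimensional ℝ F] (γ : ℝ → M) (t : ℝ) : TangentSpace I (γ t) :=
  let ℓ : F →L[ℝ] ℝ :=
    accelerationForm (F := F) (chartMetric I (γ t)) (fun s ↦ extChartAt I (γ t) (γ s)) t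
  riesz I (x := γ t) ℓ

/-- On `(α, β)`, `γ` is a classical (`C²`) solution of Newton's equation
`m D γ'/dt = - grad U`. -/
def SolvesNewton [FiniteDimensional ℝ F] (m : ℝ) (U : M → ℝ) (γ : ℝ → M) (α β : ℝ) : Prop :=
  ContMDiffOn 𝓘(ℝ, ℝ) I 2 γ (Ioo α β) ∧
    ∀ t ∈ Ioo α β, m • covariantAcceleration I γ t = -grad I U (γ t)

/-- The length of `γ` on `[a, b]` for the optical metric `η² ⟨·,·⟩`, `η = √(2 (e - U))`. -/
def opticalLength (U : M → ℝ) (e : ℝ) (γ : ℝ → M) (a b : ℝ) : ℝ≥0∞ :=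
  ∫⁻ t in Icc a b, ENNReal.ofReal (refractiveIndex U e (γ t) * ‖velocity I γ t‖)

/-- `γ`, on `[a, b]`, is a path in `V` of minimal optical length among all absolutely continuous
paths in `V` with the same endpoints. -/
def IsLengthMinimizing (V : Set M) (U : M → ℝ) (e : ℝ) (γ : ℝ → M) (a b : ℝ) : Prop :=
  IsACPath I γ a b ∧ MapsTo γ (Icc a b) V ∧ opticalLength I U e γ a b ≠ ⊤ ∧
    ∀ σ : ℝ → M, IsACPath I σ a b → MapsTo σ (Icc a b) V → σ a = γ a → σ b = γ b →
      opticalLength I U e γ a b ≤ opticalLength I U e σ a b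

/-- `γ`, on `[a, b]`, is a path in `V` of minimal optical length among the absolutely continuous
paths in `V` with the same endpoints and the same itinerary, i.e. which at each instant are in
`V₁`, resp. in `V₂`, exactly when `γ` is. -/
def IsLengthMinimizingInItinerary (V V₁ V₂ : Set M) (U : M → ℝ) (e : ℝ) (γ : ℝ → M) (a b : ℝ) :
    Prop :=
  IsACPath I γ a b ∧ MapsTo γ (Icc a b) V ∧ opticalLength I U e γ a b ≠ ⊤ ∧
    ∀ σ : ℝ → M, IsACPath I σ a b → MapsTo σ (Icc a b) V → σ a = γ a → σ b = γ b →
      (∀ t ∈ Icc a b, (σ t ∈ V₁ ↔ γ t ∈ V₁) ∧ (σ t ∈ V₂ ↔ γ t ∈ V₂)) →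
      opticalLength I U e γ a b ≤ opticalLength I U e σ a b

/-- A length-minimizing path is in particular minimizing within its itinerary. -/
theorem IsLengthMinimizing.inItinerary {V : Set M} (V₁ V₂ : Set M) {U : M → ℝ} {e : ℝ}
    {γ : ℝ → M} {a b : ℝ} (h : IsLengthMinimizing I V U e γ a b) :
    IsLengthMinimizingInItinerary I V V₁ V₂ U e γ a b :=
  ⟨h.1, h.2.1, h.2.2.1, fun σ h₁ h₂ h₃ h₄ _ ↦ h.2.2.2 σ h₁ h₂ h₃ h₄⟩

/-- `γ` is parametrized on `[a, b]` by the mechanical time of a particle of mass `m` and total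
energy `e`: its speed is `η / √m`, that is, `m = (η / ‖γ'‖)²`. -/
def IsTimeParametrized (m : ℝ) (U : M → ℝ) (e : ℝ) (γ : ℝ → M) (a b : ℝ) : Prop :=
  ∀ᵐ t ∂(volume.restrict (Icc a b)), ‖velocity I γ t‖ = refractiveIndex U e (γ t) / √m

/-- `n` is the unit normal vector of `S` at `x` that points into `A`. -/
def IsUnitNormalInto (S A : Set M) (x : M) (n : TangentSpace I x) : Prop :=
  ‖n‖ = 1 ∧ (∀ w ∈ tangentTo I S x, inner ℝ w n = 0) ∧ PointsInto I A x n

variable {I}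

/-- The normal component `v_n = ⟨v, n⟩`. -/
def normalPart {x : M} (n v : TangentSpace I x) : ℝ := inner ℝ v n

/-- The tangential component `v_τ = v - v_n n`: the orthogonal projection of `v` to the hyperplane
perpendicular to the unit vector `n`. -/
def tangentialPart {x : M} (n v : TangentSpace I x) : TangentSpace I x := v - normalPart n v • n

end Riemannian

end OpticalPath

end

/-!
The theorem is reduced to the calculus of variations for the mechanical action by Maupertuis'
principle. With `η = √(2 (e - U))`, the inequality of arithmetic and geometric means gives
`η ‖v‖ ≤ (m/2 ‖v‖² + e - U) / √m`, with equality exactly at the speed `η / √m` of the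
mechanical time (`OpticalPath.refractiveIndex_mul_le`). So a time-parametrized path which minimizes
the optical length in some class of competitors also minimizes the action `∫ m/2 ‖γ'‖² + (e - U)` in
that class (`OpticalPath.IsTimedMinimizer.integral_lagrangian_le`). The action is differentiable
along variations, and its first variation is nonnegative in every direction in which the path may be
varied (`OpticalPath.IsTimedMinimizer.firstVariation_nonneg`). The path is only absolutely
continuous, but conservation of energy, which is built into the parametrization, bounds its
velocity. All of this is done in a chart, for one arc of the path at a time.

Away from the hypersurface `S` every small variation keeps the itinerary, so the first variation
vanishes. By the du Bois-Reymond lemma (`OpticalPath.ae_eq_of_forall_testField`) the momentum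
`m g(c', ·)` is then a primitive of the force; inverting the metric shows that the path is of class
`C²` and satisfies the Euler-Lagrange equation (`OpticalPath.IsTame.eulerLagrange`), which is
Newton's equation (`OpticalPath.IsTimedMinimizer.solvesNewton`).

At a contact, a chart is used in which `S` is a hyperplane through the origin and `V₁`, `V₂` are the
half-spaces on its two sides (`OpticalPath.IsSmoothHypersurface.exists_isFlatChart`). There are four
points.

* A path that leaves the contact point and comes back to it without meeting `S` in between can be
  shortened within its itinerary by contracting the loop towards the origin, which maps a half-ball
  into itself; near the origin the density of the resulting first variation is negative
  (`OpticalPath.IsTimedMinimizer.false_of_loop`). So the path is on one side immediately after the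
  contact (`OpticalPath.IsTimedMinimizer.exists_side_right`).
* On either side of the contact instant the force is bounded, so the momentum is Lipschitz and the
  velocity has a one-sided limit, which satisfies the conservation of energy
  (`OpticalPath.IsTimedMinimizer.exists_tendsto_deriv`).
* Displacing the contact point along `S` keeps the itinerary. By the Euler-Lagrange equation the
  first variation of such a displacement is minus the jump of the momentum, which therefore
  vanishes on vectors tangent to `S` (`OpticalPath.IsTimedMinimizer.metric_le_of_displacement`).
* If the path is minimizing among all paths, a reflected path may also be displaced from the contact
  point back into `V₁`. This cuts the corner and shows `v_n ≤ w_n` for the normal velocities `v_n`,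
  `w_n` before and after the contact. Since `w_n ≤ 0 ≤ v_n` for a reflected path, both vanish
  (`OpticalPath.IsTimedMinimizer.exists_velocities`).

The velocities before and after the contact have equal tangential components, and their norms are
known from the conservation of energy. Pythagoras' theorem gives `w_n² = v_n²` for a path that
continues in `V₁` and `w_n² = v_n² - 2 (C₂ - C₁) / m` for one that continues in `V₂`, and the signs
of the normal components decide between the roots. In the case of reflection the second equation has
no solution; for refraction and at the critical angle the first alternative is restricted by the
corner inequality.
-/

/-! ### Absolutely continuous curves in a normed space -/

section AbsolutelyContinuous

variable {F : Type*} [NormedAddCommGroup F] [NormedSpace ℝ F]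

theorem AbsolutelyContinuousOnInterval.congr_eqOn {X : Type*} [PseudoMetricSpace X] {f g : ℝ → X}
    {a b : ℝ} (hf : AbsolutelyContinuousOnInterval f a b) (h : EqOn f g (uIcc a b)) :
    AbsolutelyContinuousOnInterval g a b := by
  rw [absolutelyContinuousOnInterval_iff] at hf ⊢
  intro ε hε
  obtain ⟨δ, hδ, H⟩ := hf ε hε
  refine ⟨δ, hδ, fun E hE hlt ↦ ?_⟩
  rw [Finset.sum_congr rfl fun i hi ↦ by rw [← h (hE.1 i hi).1, ← h (hE.1 i hi).2]]
  exact H E hE hlt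

theorem LipschitzOnWith.comp_absolutelyContinuousOnInterval {X Y : Type*} [PseudoMetricSpace X]
    [PseudoMetricSpace Y] {f : X → Y} {K : NNReal} {s : Set X} (hf : LipschitzOnWith K f s)
    {c : ℝ → X} {a b : ℝ} (hc : AbsolutelyContinuousOnInterval c a b)
    (hs : MapsTo c (uIcc a b) s) : AbsolutelyContinuousOnInterval (fun t ↦ f (c t)) a b := by
  rw [absolutelyContinuousOnInterval_iff] at hc ⊢
  intro ε hε
  obtain ⟨δ, hδ, H⟩ := hc (ε / (K + 1)) (by positivity)
  refine ⟨δ, hδ, fun E hE hlt ↦ ?_⟩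
  calc ∑ i ∈ Finset.range E.1, dist (f (c (E.2 i).1)) (f (c (E.2 i).2))
      ≤ ∑ i ∈ Finset.range E.1, (K + 1) * dist (c (E.2 i).1) (c (E.2 i).2) := by
        refine Finset.sum_le_sum fun i hi ↦ ?_
        refine (hf.dist_le_mul _ (hs (hE.1 i hi).1) _ (hs (hE.1 i hi).2)).trans ?_
        gcongr
        simp
    _ = (K + 1) * ∑ i ∈ Finset.range E.1, dist (c (E.2 i).1) (c (E.2 i).2) := by
        rw [Finset.mul_sum]
    _ < (K + 1) * (ε / (K + 1)) := by
        gcongr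
        exact H E hE hlt
    _ = ε := by field_simp

theorem AbsolutelyContinuousOnInterval.clm_comp {G : Type*} [NormedAddCommGroup G]
    [NormedSpace ℝ G] (ℓ : F →L[ℝ] G) {c : ℝ → F} {a b : ℝ}
    (hc : AbsolutelyContinuousOnInterval c a b) :
    AbsolutelyContinuousOnInterval (fun t ↦ ℓ (c t)) a b :=
  LipschitzOnWith.comp_absolutelyContinuousOnInterval (ℓ.lipschitz.lipschitzOnWith (s := univ)) hc
    (mapsTo_univ _ _)

theorem AbsolutelyContinuousOnInterval.ae_differentiableAt_of_finiteDimensional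
    [FiniteDimensional ℝ F] {c : ℝ → F} {a b : ℝ} (hc : AbsolutelyContinuousOnInterval c a b) :
    ∀ᵐ t, t ∈ uIcc a b → DifferentiableAt ℝ c t := by
  let B := Module.finBasis ℝ F
  have h : ∀ᵐ t, ∀ i, t ∈ uIcc a b →
      DifferentiableAt ℝ (fun s ↦ (B.coord i).toContinuousLinearMap (c s)) t :=
    ae_all_iff.2 fun i ↦
      (AbsolutelyContinuousOnInterval.clm_comp (B.coord i).toContinuousLinearMap
        hc).ae_differentiableAt
  filter_upwards [h] with t ht hmem
  have h2 : DifferentiableAt ℝ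
      (fun s ↦ ∑ i, (B.coord i).toContinuousLinearMap (c s) • B i) t :=
    DifferentiableAt.fun_sum fun i _ ↦ (ht i hmem).smul_const _
  refine h2.congr_of_eventuallyEq (Eventually.of_forall fun s ↦ ?_)
  exact (B.sum_repr (c s)).symm

/-- Extension of an absolutely continuous curve by constants on both sides. -/
theorem AbsolutelyContinuousOnInterval.comp_clamp {X : Type*} [PseudoMetricSpace X] {f : ℝ → X}
    {a b : ℝ} (hab : a ≤ b) (hf : AbsolutelyContinuousOnInterval f a b) (c d : ℝ) :
    AbsolutelyContinuousOnInterval (fun t ↦ f (max a (min b t))) c d := by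
  rw [absolutelyContinuousOnInterval_iff] at hf ⊢
  intro ε hε
  obtain ⟨δ, hδ, H⟩ := hf ε hε
  refine ⟨δ, hδ, fun E hE hlt ↦ ?_⟩
  have hsub : ∀ x y : ℝ, uIoc (max a (min b x)) (max a (min b y)) ⊆ uIoc x y := by
    intro x y z hz
    simp only [uIoc, mem_Ioc, inf_lt_iff, le_sup_iff, max_lt_iff, le_min_iff] at hz ⊢
    grind
  refine H (E.1, fun i ↦ (max a (min b (E.2 i).1), max a (min b (E.2 i).2)))
    ⟨fun i _ ↦ ?_, fun i hi j hj hij ↦ ?_⟩ ?_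
  · simp [hab]
  · exact (hE.2 hi hj hij).mono (hsub _ _) (hsub _ _)
  · refine lt_of_le_of_lt (Finset.sum_le_sum fun i _ ↦ ?_) hlt
    simp only [Real.dist_eq]
    rw [max_comm a, max_comm a]
    refine (abs_max_sub_max_le_abs _ _ _).trans ((abs_min_sub_min_le_max _ _ _ _).trans ?_)
    simp

/-- The fundamental theorem of calculus for an absolutely continuous curve whose derivative agrees
almost everywhere with a continuous function. -/
theorem AbsolutelyContinuousOnInterval.hasDerivAt_of_ae_deriv_eq [FiniteDimensional ℝ F]
    {c w : ℝ → F} {a b : ℝ} (hab : a ≤ b) (hc : AbsolutelyContinuousOnInterval c a b)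
    (hw : ContinuousOn w (Icc a b)) (h : ∀ᵐ t, t ∈ Ioo a b → deriv c t = w t) :
    ∀ t ∈ Ioo a b, HasDerivAt c (w t) t := by
  have hint : ∀ t ∈ Icc a b, IntervalIntegrable w volume a t := fun t ht ↦
    (hw.mono (Icc_subset_Icc_right ht.2)).intervalIntegrable_of_Icc ht.1
  have key : ∀ t ∈ Icc a b, c t = c a + ∫ s in a..t, w s := by
    intro t ht
    have hsub : uIcc a t ⊆ uIcc a b := by
      rw [uIcc_of_le hab, uIcc_of_le ht.1]
      exact Icc_subset_Icc_right ht.2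
    have hct := hc.mono hsub
    refine (SeparatingDual.eq_iff_forall_dual_eq (R := ℝ)).2 fun ℓ ↦ ?_
    have h1 := (AbsolutelyContinuousOnInterval.clm_comp ℓ hct).integral_deriv_eq_sub
    rw [map_add, ← ContinuousLinearMap.intervalIntegral_comp_comm ℓ (hint t ht)]
    rw [← sub_eq_iff_eq_add', ← h1]
    refine intervalIntegral.integral_congr_ae ?_
    have hb : ∀ᵐ s : ℝ, s ≠ b := by simp [ae_iff, measure_singleton]
    filter_upwards [h, hct.ae_differentiableAt_of_finiteDimensional, hb] with s hs hd hsb hmem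
    rw [uIoc_of_le ht.1] at hmem
    have hd' := hd (by rw [uIcc_of_le ht.1]; exact Ioc_subset_Icc_self hmem)
    rw [← hs ⟨hmem.1, lt_of_le_of_ne (hmem.2.trans ht.2) hsb⟩]
    exact (ℓ.hasFDerivAt.comp_hasDerivAt s hd'.hasDerivAt).deriv
  intro t ht
  have hnh : Icc a b ∈ 𝓝 t := Icc_mem_nhds ht.1 ht.2
  have h1 : HasDerivAt (fun u ↦ ∫ s in a..u, w s) (w t) t :=
    intervalIntegral.integral_hasDerivAt_right (hint t (Ioo_subset_Icc_self ht))
      ((hw.mono Ioo_subset_Icc_self).stronglyMeasurableAtFilter isOpen_Ioo t ht)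
      (hw.continuousAt hnh)
  refine (h1.const_add (c a)).congr_of_eventuallyEq ?_
  filter_upwards [hnh] with s hs using key s hs

end AbsolutelyContinuous

noncomputable section

namespace OpticalPath

/-! ### The mechanical action in a chart and its first variation -/

section BilinearForms

variable {F : Type*} [NormedAddCommGroup F] [NormedSpace ℝ F]

-- Shortcut instances: the general search through the tower of operator spaces is very slow.
set_option synthInstance.maxHeartbeats 400000

instance bilinSeminormedAddCommGroup : SeminormedAddCommGroup (F →L[ℝ] F →L[ℝ] ℝ) :=
  ContinuousLinearMap.toSeminormedAddCommGroup

instance bilinNormedAddCommGroup : NormedAddCommGroup (F →L[ℝ] F →L[ℝ] ℝ) :=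
  ContinuousLinearMap.toNormedAddCommGroup

instance bilinNormedSpace : NormedSpace ℝ (F →L[ℝ] F →L[ℝ] ℝ) :=
  ContinuousLinearMap.toNormedSpace

end BilinearForms

section Action

variable {F : Type*} [NormedAddCommGroup F] [NormedSpace ℝ F]

/-- The density `m/2 g(v, v) + (e - u)` of the mechanical action, in the vector space `F` with
the position dependent inner product `g` and the potential `u`. The constant `e` makes it
nonnegative where the motion of energy `e` is possible. -/
def lagrangian (m e : ℝ) (g : F → F →L[ℝ] F →L[ℝ] ℝ) (u : F → ℝ) (x v : F) : ℝ :=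
  m / 2 * g x v v + (e - u x)

/-- The derivative of `lagrangian` at `(x, v)` in the direction `(z, ζ)`. -/
def firstVariation (m : ℝ) (g : F → F →L[ℝ] F →L[ℝ] ℝ) (u : F → ℝ) (x v z ζ : F) : ℝ :=
  m * g x v ζ + m / 2 * fderiv ℝ g x z v v - fderiv ℝ u x z

/-- The derivative of `lagrangian` with respect to the position. -/
def force (m : ℝ) (g : F → F →L[ℝ] F →L[ℝ] ℝ) (u : F → ℝ) (x v : F) : F →L[ℝ] ℝ :=
  (m / 2) • ((fderiv ℝ g x).flip v).flip v - fderiv ℝ u x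

/-- The metric `g` and the potential `u` are of class `C¹` on the open set `D`, with bounds
given by `K`; the metric is symmetric and uniformly positive. -/
structure IsTame (g : F → F →L[ℝ] F →L[ℝ] ℝ) (u : F → ℝ) (D : Set F) (K : ℝ) : Prop where
  isOpen : IsOpen D
  contDiffAt_metric : ∀ x ∈ D, ContDiffAt ℝ 1 g x
  contDiffAt_potential : ∀ x ∈ D, ContDiffAt ℝ 1 u x
  symm : ∀ x ∈ D, ∀ v w, g x v w = g x w v
  norm_metric_le : ∀ x ∈ D, ‖g x‖ ≤ K
  norm_fderiv_metric_le : ∀ x ∈ D, ‖fderiv ℝ g x‖ ≤ K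
  norm_fderiv_potential_le : ∀ x ∈ D, ‖fderiv ℝ u x‖ ≤ K
  abs_potential_le : ∀ x ∈ D, |u x| ≤ K
  sq_norm_le : ∀ x ∈ D, ∀ v, ‖v‖ ^ 2 ≤ K * g x v v

variable {m e : ℝ} {g : F → F →L[ℝ] F →L[ℝ] ℝ} {u : F → ℝ} {D : Set F} {K : ℝ}

theorem firstVariation_eq_add_force (x v z ζ : F) :
    firstVariation m g u x v z ζ = m * g x v ζ + force m g u x v z := by
  simp [firstVariation, force]
  ring

namespace IsTame

theorem mono (h : IsTame g u D K) {D' : Set F} (hD' : IsOpen D') (hsub : D' ⊆ D) :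
    IsTame g u D' K where
  isOpen := hD'
  contDiffAt_metric x hx := h.contDiffAt_metric x (hsub hx)
  contDiffAt_potential x hx := h.contDiffAt_potential x (hsub hx)
  symm x hx := h.symm x (hsub hx)
  norm_metric_le x hx := h.norm_metric_le x (hsub hx)
  norm_fderiv_metric_le x hx := h.norm_fderiv_metric_le x (hsub hx)
  norm_fderiv_potential_le x hx := h.norm_fderiv_potential_le x (hsub hx)
  abs_potential_le x hx := h.abs_potential_le x (hsub hx)
  sq_norm_le x hx := h.sq_norm_le x (hsub hx)

theorem hasDerivAt_lagrangian (h : IsTame g u D K) (x v z ζ : F) (s : ℝ) (hs : x + s • z ∈ D) :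
    HasDerivAt (fun s : ℝ ↦ lagrangian m e g u (x + s • z) (v + s • ζ))
      (firstVariation m g u (x + s • z) (v + s • ζ) z ζ) s := by
  have hx : HasDerivAt (fun s : ℝ ↦ x + s • z) z s := by
    simpa using ((hasDerivAt_id s).smul_const z).const_add x
  have hv : HasDerivAt (fun s : ℝ ↦ v + s • ζ) ζ s := by
    simpa using ((hasDerivAt_id s).smul_const ζ).const_add v
  have hg : HasDerivAt (fun s : ℝ ↦ g (x + s • z)) (fderiv ℝ g (x + s • z) z) s :=
    (((h.contDiffAt_metric _ hs).differentiableAt (by simp)).hasFDerivAt).comp_hasDerivAt s hx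
  have hu : HasDerivAt (fun s : ℝ ↦ u (x + s • z)) (fderiv ℝ u (x + s • z) z) s :=
    (((h.contDiffAt_potential _ hs).differentiableAt (by simp)).hasFDerivAt).comp_hasDerivAt s hx
  have := (((hg.clm_apply hv).clm_apply hv).const_mul (m / 2)).add ((hu.const_sub e))
  convert! this using 1
  simp only [firstVariation, add_apply]
  rw [h.symm _ hs ζ (v + s • ζ)]
  ring

theorem abs_firstVariation_le (h : IsTame g u D K) (hm : 0 ≤ m) {x v z ζ : F} {A C : ℝ}
    (hx : x ∈ D) (hv : ‖v‖ ≤ A) (hz : ‖z‖ ≤ C) (hζ : ‖ζ‖ ≤ C) :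
    |firstVariation m g u x v z ζ| ≤ m * (K * A * C) + m / 2 * (K * C * A * A) + K * C := by
  have hK : 0 ≤ K := (norm_nonneg _).trans (h.norm_metric_le x hx)
  have hA : 0 ≤ A := (norm_nonneg _).trans hv
  have hC : 0 ≤ C := (norm_nonneg _).trans hz
  have h1 : |g x v ζ| ≤ K * A * C := by
    calc |g x v ζ| ≤ ‖g x‖ * ‖v‖ * ‖ζ‖ := (g x).le_opNorm₂ v ζ
      _ ≤ K * A * C := by gcongr; exact h.norm_metric_le x hx
  have h2 : |fderiv ℝ g x z v v| ≤ K * C * A * A := by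
    calc |fderiv ℝ g x z v v| ≤ ‖fderiv ℝ g x z‖ * ‖v‖ * ‖v‖ := (fderiv ℝ g x z).le_opNorm₂ v v
      _ ≤ (‖fderiv ℝ g x‖ * ‖z‖) * ‖v‖ * ‖v‖ := by gcongr; exact (fderiv ℝ g x).le_opNorm z
      _ ≤ K * C * A * A := by gcongr; exact h.norm_fderiv_metric_le x hx
  have h3 : |fderiv ℝ u x z| ≤ K * C := by
    calc |fderiv ℝ u x z| ≤ ‖fderiv ℝ u x‖ * ‖z‖ := (fderiv ℝ u x).le_opNorm z
      _ ≤ K * C := by gcongr; exact h.norm_fderiv_potential_le x hx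
  rw [firstVariation]
  rw [abs_le] at h1 h2 h3 ⊢
  constructor <;> nlinarith

theorem abs_lagrangian_le (h : IsTame g u D K) (hm : 0 ≤ m) {x v : F} {A : ℝ}
    (hx : x ∈ D) (hv : ‖v‖ ≤ A) :
    |lagrangian m e g u x v| ≤ m / 2 * (K * A * A) + (|e| + K) := by
  have hK : 0 ≤ K := (norm_nonneg _).trans (h.norm_metric_le x hx)
  have hA : 0 ≤ A := (norm_nonneg _).trans hv
  have h1 : |g x v v| ≤ K * A * A := by
    calc |g x v v| ≤ ‖g x‖ * ‖v‖ * ‖v‖ := (g x).le_opNorm₂ v v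
      _ ≤ K * A * A := by gcongr; exact h.norm_metric_le x hx
  have h2 := h.abs_potential_le x hx
  have h3 := abs_le.1 (le_refl |e|)
  rw [lagrangian]
  rw [abs_le] at h1 h2 ⊢
  constructor <;> nlinarith

theorem aestronglyMeasurable_lagrangian (h : IsTame g u D K) {x v : ℝ → F} {J : Set ℝ}
    (hJ : MeasurableSet J)
    (hx : ContinuousOn x J) (hxD : MapsTo x J D) (hv : AEStronglyMeasurable v (volume.restrict J)) :
    AEStronglyMeasurable (fun t ↦ lagrangian m e g u (x t) (v t)) (volume.restrict J) := by
  have hg : AEStronglyMeasurable (fun t ↦ g (x t)) (volume.restrict J) :=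
    ContinuousOn.aestronglyMeasurable (fun t ht ↦
      ((h.contDiffAt_metric _ (hxD ht)).continuousAt.comp_continuousWithinAt (hx t ht))) hJ
  have hu : AEStronglyMeasurable (fun t ↦ u (x t)) (volume.restrict J) :=
    ContinuousOn.aestronglyMeasurable (fun t ht ↦
      ((h.contDiffAt_potential _ (hxD ht)).continuousAt.comp_continuousWithinAt (hx t ht))) hJ
  have h1 : AEStronglyMeasurable (fun t ↦ g (x t) (v t)) (volume.restrict J) :=
    isBoundedBilinearMap_apply.continuous.comp_aestronglyMeasurable (hg.prodMk hv)
  have h2 : AEStronglyMeasurable (fun t ↦ g (x t) (v t) (v t)) (volume.restrict J) :=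
    isBoundedBilinearMap_apply.continuous.comp_aestronglyMeasurable (h1.prodMk hv)
  exact (h2.const_mul (m / 2)).add (aestronglyMeasurable_const.sub hu)

theorem integrableOn_lagrangian (h : IsTame g u D K) (hm : 0 ≤ m) {x v : ℝ → F} {t₁ t₂ A : ℝ}
    (hx : ContinuousOn x (Ioo t₁ t₂)) (hxD : MapsTo x (Ioo t₁ t₂) D)
    (hv : AEStronglyMeasurable v (volume.restrict (Ioo t₁ t₂)))
    (hvA : ∀ᵐ t ∂volume.restrict (Ioo t₁ t₂), ‖v t‖ ≤ A) :
    IntegrableOn (fun t ↦ lagrangian m e g u (x t) (v t)) (Ioo t₁ t₂) := by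
  refine IntegrableOn.of_bound (by simp)
    (h.aestronglyMeasurable_lagrangian measurableSet_Ioo hx hxD hv)
    (m / 2 * (K * A * A) + (|e| + K)) ?_
  filter_upwards [hvA, ae_restrict_mem measurableSet_Ioo] with t ht hmem
  exact h.abs_lagrangian_le hm (hxD hmem) ht

/-- Differentiation of the action along the family of curves `c + s φ`, `s ↓ 0`. Only the
velocities `v` and `ζ` enter, so that no regularity in time beyond measurability is needed. -/
theorem tendsto_action_quotient (h : IsTame g u D K) (hm : 0 ≤ m) {c v φ ζ : ℝ → F}
    {t₁ t₂ A C s₀ : ℝ}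
    (hc : ContinuousOn c (Ioo t₁ t₂)) (hφ : ContinuousOn φ (Ioo t₁ t₂))
    (hv : AEStronglyMeasurable v (volume.restrict (Ioo t₁ t₂)))
    (hζ : AEStronglyMeasurable ζ (volume.restrict (Ioo t₁ t₂)))
    (hvA : ∀ᵐ t ∂volume.restrict (Ioo t₁ t₂), ‖v t‖ ≤ A)
    (hφC : ∀ t ∈ Ioo t₁ t₂, ‖φ t‖ ≤ C)
    (hζC : ∀ᵐ t ∂volume.restrict (Ioo t₁ t₂), ‖ζ t‖ ≤ C)
    (hs₀ : 0 < s₀) (hD : ∀ s ∈ Icc 0 s₀, ∀ t ∈ Ioo t₁ t₂, c t + s • φ t ∈ D) :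
    Tendsto (fun s : ℝ ↦ s⁻¹ * ((∫ t in Ioo t₁ t₂, lagrangian m e g u (c t + s • φ t)
        (v t + s • ζ t)) - ∫ t in Ioo t₁ t₂, lagrangian m e g u (c t) (v t)))
      (𝓝[>] 0) (𝓝 (∫ t in Ioo t₁ t₂, firstVariation m g u (c t) (v t) (φ t) (ζ t))) := by
  have hsmall : ∀ᶠ s : ℝ in 𝓝[>] 0, s ∈ Ioc 0 (min s₀ 1) :=
    Ioc_mem_nhdsGT (lt_min hs₀ one_pos)
  have hint : ∀ s ∈ Icc 0 (min s₀ 1), IntegrableOn (fun t ↦ lagrangian m e g u (c t + s • φ t)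
      (v t + s • ζ t)) (Ioo t₁ t₂) := by
    intro s hs
    refine h.integrableOn_lagrangian hm (A := A + C) (hc.add (hφ.const_smul s))
      (fun t ht ↦ hD s ⟨hs.1, hs.2.trans (min_le_left _ _)⟩ t ht) (hv.add (hζ.const_smul s)) ?_
    filter_upwards [hvA, hζC] with t h1 h2
    calc ‖v t + s • ζ t‖ ≤ ‖v t‖ + ‖s • ζ t‖ := norm_add_le _ _
      _ ≤ A + C := by
        rw [norm_smul, Real.norm_of_nonneg hs.1]
        have : s * ‖ζ t‖ ≤ 1 * ‖ζ t‖ := by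
          gcongr
          exact hs.2.trans (min_le_right _ _)
        linarith
  have hint0 : IntegrableOn (fun t ↦ lagrangian m e g u (c t) (v t)) (Ioo t₁ t₂) := by
    simpa using hint 0 ⟨le_rfl, (lt_min hs₀ one_pos).le⟩
  set B := m * (K * (A + C) * C) + m / 2 * (K * C * (A + C) * (A + C)) + K * C with hB
  have key : Tendsto (fun s : ℝ ↦ ∫ t in Ioo t₁ t₂,
      s⁻¹ * (lagrangian m e g u (c t + s • φ t) (v t + s • ζ t) - lagrangian m e g u (c t) (v t)))
      (𝓝[>] 0) (𝓝 (∫ t in Ioo t₁ t₂, firstVariation m g u (c t) (v t) (φ t) (ζ t))) := by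
    refine tendsto_integral_filter_of_dominated_convergence (fun _ ↦ B) ?_ ?_
      (integrable_const B) ?_
    · filter_upwards [hsmall] with s hs
      exact ((hint s (Ioc_subset_Icc_self hs)).aestronglyMeasurable.sub
        hint0.aestronglyMeasurable).const_mul _
    · filter_upwards [hsmall] with s hs
      filter_upwards [hvA, hζC, ae_restrict_mem measurableSet_Ioo] with t h1 h2 hmem
      have hmv := (convex_Icc 0 s).norm_image_sub_le_of_norm_hasDerivWithin_le (C := B)
        (f := fun s : ℝ ↦ lagrangian m e g u (c t + s • φ t) (v t + s • ζ t))
        (f' := fun s ↦ firstVariation m g u (c t + s • φ t) (v t + s • ζ t) (φ t) (ζ t))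
        (x := 0) (y := s) ?_ ?_ (left_mem_Icc.2 hs.1.le) (right_mem_Icc.2 hs.1.le)
      · simp only [zero_smul, add_zero, sub_zero] at hmv
        rw [norm_mul, norm_inv, Real.norm_of_nonneg hs.1.le] at *
        rw [inv_mul_le_iff₀ hs.1, mul_comm s]
        exact hmv
      · intro r hr
        exact (h.hasDerivAt_lagrangian _ _ _ _ _ (hD r
          ⟨hr.1, hr.2.trans (hs.2.trans (min_le_left _ _))⟩ t hmem)).hasDerivWithinAt
      · intro r hr
        refine h.abs_firstVariation_le hm (hD r
          ⟨hr.1, hr.2.trans (hs.2.trans (min_le_left _ _))⟩ t hmem) ?_ (hφC t hmem) h2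
        calc ‖v t + r • ζ t‖ ≤ ‖v t‖ + ‖r • ζ t‖ := norm_add_le _ _
          _ ≤ A + C := by
            rw [norm_smul, Real.norm_of_nonneg hr.1]
            have : r * ‖ζ t‖ ≤ 1 * ‖ζ t‖ := by
              gcongr
              exact hr.2.trans (hs.2.trans (min_le_right _ _))
            linarith
    · filter_upwards [ae_restrict_mem measurableSet_Ioo] with t hmem
      have h0 : c t + (0 : ℝ) • φ t ∈ D := hD 0 ⟨le_rfl, hs₀.le⟩ t hmem
      have := (h.hasDerivAt_lagrangian (m := m) (e := e) (c t) (v t) (φ t) (ζ t) 0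
        h0).tendsto_slope_zero_right
      simpa using this
  refine key.congr' ?_
  filter_upwards [hsmall] with s hs
  rw [integral_const_mul, integral_sub (hint s (Ioc_subset_Icc_self hs)) hint0]

end IsTame

end Action

/-! ### The Euler-Lagrange equation for absolutely continuous curves -/

section EulerLagrange

variable {F : Type*} [NormedAddCommGroup F] [NormedSpace ℝ F]

/-- The admissible variations of a curve on `[a, b]` with fixed endpoints: absolutely continuous
fields vanishing at the endpoints, with an essentially bounded derivative. -/
structure IsTestField (φ : ℝ → F) (a b : ℝ) : Prop where
  ac : AbsolutelyContinuousOnInterval φ a b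
  left : φ a = 0
  right : φ b = 0
  bounded : ∃ C, ∀ᵐ t ∂volume.restrict (Ioo a b), ‖deriv φ t‖ ≤ C

theorem intervalIntegrable_of_bound_Ioo {E : Type*} [NormedAddCommGroup E] {f : ℝ → E} {a b C : ℝ}
    (hab : a ≤ b)
    (hf : AEStronglyMeasurable f (volume.restrict (Ioo a b)))
    (hC : ∀ᵐ t ∂volume.restrict (Ioo a b), ‖f t‖ ≤ C) : IntervalIntegrable f volume a b := by
  rw [intervalIntegrable_iff_integrableOn_Ioo_of_le hab]
  exact IntegrableOn.of_bound (by simp) hf C hC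

variable {m e : ℝ} {g : F → F →L[ℝ] F →L[ℝ] ℝ} {u : F → ℝ} {D : Set F} {K : ℝ}

namespace IsTame

theorem norm_force_le (h : IsTame g u D K) (hm : 0 ≤ m) {x v : F} {A : ℝ}
    (hx : x ∈ D) (hv : ‖v‖ ≤ A) : ‖force m g u x v‖ ≤ m / 2 * (K * A * A) + K := by
  have hK : 0 ≤ K := (norm_nonneg _).trans (h.norm_metric_le x hx)
  have hA : 0 ≤ A := (norm_nonneg _).trans hv
  refine ContinuousLinearMap.opNorm_le_bound _ (by positivity) fun z ↦ ?_
  have h2 : |force m g u x v z| ≤ m / 2 * (K * ‖z‖ * A * A) + K * ‖z‖ := by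
    have hK1 : ‖fderiv ℝ g x z v v‖ ≤ K * ‖z‖ * A * A := by
      calc ‖fderiv ℝ g x z v v‖ ≤ ‖fderiv ℝ g x z‖ * ‖v‖ * ‖v‖ := (fderiv ℝ g x z).le_opNorm₂ v v
        _ ≤ (‖fderiv ℝ g x‖ * ‖z‖) * ‖v‖ * ‖v‖ := by gcongr; exact (fderiv ℝ g x).le_opNorm z
        _ ≤ K * ‖z‖ * A * A := by gcongr; exact h.norm_fderiv_metric_le x hx
    have hK2 : ‖fderiv ℝ u x z‖ ≤ K * ‖z‖ := by
      refine ((fderiv ℝ u x).le_opNorm z).trans ?_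
      gcongr
      exact h.norm_fderiv_potential_le x hx
    have : force m g u x v z = m / 2 * fderiv ℝ g x z v v - fderiv ℝ u x z := by simp [force]
    rw [this]
    refine (abs_sub _ _).trans ?_
    rw [abs_mul, abs_of_nonneg (by positivity : 0 ≤ m / 2)]
    gcongr
    · exact hK1
    · exact hK2
  calc ‖force m g u x v z‖ ≤ _ := h2
    _ = _ := by ring

theorem continuousOn_force (h : IsTame g u D K) {c w : ℝ → F} {J : Set ℝ} (hc : ContinuousOn c J)
    (hcD : MapsTo c J D) (hw : ContinuousOn w J) :
    ContinuousOn (fun t ↦ force m g u (c t) (w t)) J := by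
  have h1 : ContinuousOn (fun t ↦ fderiv ℝ g (c t)) J := fun t ht ↦
    (((h.contDiffAt_metric _ (hcD ht)).continuousAt_fderiv (by simp)).comp_continuousWithinAt
      (hc t ht))
  have h2 : ContinuousOn (fun t ↦ fderiv ℝ u (c t)) J := fun t ht ↦
    (((h.contDiffAt_potential _ (hcD ht)).continuousAt_fderiv (by simp)).comp_continuousWithinAt
      (hc t ht))
  have h3 : ContinuousOn (fun t ↦ (fderiv ℝ g (c t)).flip) J :=
    (ContinuousLinearMap.flipₗᵢ ℝ F F (F →L[ℝ] ℝ)).continuous.comp_continuousOn h1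
  have h4 : ContinuousOn (fun t ↦ ((fderiv ℝ g (c t)).flip (w t)).flip) J :=
    (ContinuousLinearMap.flipₗᵢ ℝ F F ℝ).continuous.comp_continuousOn (h3.clm_apply hw)
  exact ((h4.clm_apply hw).const_smul (m / 2)).sub h2

/-- The Euler-Lagrange equation in terms of the covariant acceleration. -/
theorem smul_accelerationForm_eq (h : IsTame g u D K) {c : ℝ → F} {a b t : ℝ}
    (hc : ContDiffOn ℝ 2 c (Ioo a b)) (ht : t ∈ Ioo a b) (hcD : c t ∈ D)
    (hp : HasDerivAt (fun s ↦ m • g (c s) (deriv c s)) (force m g u (c t) (deriv c t)) t) :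
    m • accelerationForm g c t = -fderiv ℝ u (c t) := by
  have hct : ContDiffAt ℝ 2 c t := hc.contDiffAt (isOpen_Ioo.mem_nhds ht)
  have hc1 : HasDerivAt c (deriv c t) t := (hct.differentiableAt (by simp)).hasDerivAt
  have hc2 : HasDerivAt (deriv c) (deriv (deriv c) t) t := by
    have : ContDiffOn ℝ (1 + 1) c (Ioo a b) := by simpa [one_add_one_eq_two] using hc
    rw [contDiffOn_succ_iff_deriv_of_isOpen isOpen_Ioo] at this
    exact ((this.2.2.contDiffAt (isOpen_Ioo.mem_nhds ht)).differentiableAt (by simp)).hasDerivAt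
  have hg : HasDerivAt (fun s ↦ g (c s)) (fderiv ℝ g (c t) (deriv c t)) t :=
    ((h.contDiffAt_metric _ hcD).differentiableAt (by simp)).hasFDerivAt.comp_hasDerivAt t hc1
  have h1 := (hg.clm_apply hc2).const_smul m
  have h2 := hp.unique h1
  have h3 : fderiv ℝ u (c t) = (m / 2) • ((fderiv ℝ g (c t)).flip (deriv c t)).flip (deriv c t)
      - m • (fderiv ℝ g (c t) (deriv c t) (deriv c t) + g (c t) (deriv (deriv c) t)) := by
    rw [← h2, force]
    abel
  rw [h3, accelerationForm]
  ext z
  simp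
  ring

end IsTame

variable [FiniteDimensional ℝ F]

/-- The du Bois-Reymond lemma: the variation `φ = (∫ h) β`, where `h` is the `β`-component of
`P - ∫ Q` minus its mean, shows that `h` vanishes almost everywhere. -/
theorem ae_eq_of_forall_testField {P Q : ℝ → F →L[ℝ] ℝ} {a b A B : ℝ} (hab : a < b)
    (hP : AEStronglyMeasurable P (volume.restrict (Ioo a b)))
    (hQ : AEStronglyMeasurable Q (volume.restrict (Ioo a b)))
    (hPA : ∀ᵐ t ∂volume.restrict (Ioo a b), ‖P t‖ ≤ A)
    (hQB : ∀ᵐ t ∂volume.restrict (Ioo a b), ‖Q t‖ ≤ B)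
    (h : ∀ φ : ℝ → F, IsTestField φ a b → ∫ t in Ioo a b, (P t (deriv φ t) + Q t (φ t)) = 0) :
    ∃ κ : F →L[ℝ] ℝ, ∀ᵐ t ∂volume.restrict (Ioo a b), P t = κ + ∫ s in a..t, Q s := by
  have hPi := intervalIntegrable_of_bound_Ioo hab.le hP hPA
  have hQi := intervalIntegrable_of_bound_Ioo hab.le hQ hQB
  set R : ℝ → F →L[ℝ] ℝ := fun t ↦ ∫ s in a..t, Q s with hR
  have hRc : ContinuousOn R (Icc a b) := by
    have := intervalIntegral.continuousOn_primitive_interval (μ := volume) (a := a) (b := b)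
      (f := Q) (by
        rw [uIcc_of_le hab.le]
        rwa [intervalIntegrable_iff_integrableOn_Icc_of_le hab.le] at hQi)
    rwa [uIcc_of_le hab.le] at this
  have hRi : IntervalIntegrable R volume a b := hRc.intervalIntegrable_of_Icc hab.le
  set κ : F →L[ℝ] ℝ := (b - a)⁻¹ • ∫ t in a..b, (P t - R t) with hκ
  refine ⟨κ, ?_⟩
  have hPRi : IntervalIntegrable (fun t ↦ P t - R t) volume a b := hPi.sub hRi
  let B' := Module.finBasis ℝ F
  obtain ⟨CR, hCR⟩ := isCompact_Icc.exists_bound_of_continuousOn hRc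
  have main : ∀ β : F, ∀ᵐ t ∂volume.restrict (Ioo a b), (P t - R t - κ) β = 0 := by
    intro β
    set η : ℝ → ℝ := fun t ↦ (P t - R t - κ) β with hη
    have hηm : AEStronglyMeasurable η (volume.restrict (Ioo a b)) := by
      refine AEStronglyMeasurable.apply_continuousLinearMap ?_ β
      exact (hP.sub ((hRc.mono Ioo_subset_Icc_self).aestronglyMeasurable measurableSet_Ioo)).sub
        aestronglyMeasurable_const
    have hηC : ∀ᵐ t ∂volume.restrict (Ioo a b), ‖η t‖ ≤ (A + CR + ‖κ‖) * ‖β‖ := by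
      filter_upwards [hPA, ae_restrict_mem measurableSet_Ioo] with t h1 h2
      refine ((P t - R t - κ).le_opNorm β).trans ?_
      gcongr
      refine (norm_sub_le _ _).trans ?_
      gcongr
      refine (norm_sub_le _ _).trans ?_
      gcongr
      exact hCR t (Ioo_subset_Icc_self h2)
    have hηi := intervalIntegrable_of_bound_Ioo hab.le hηm hηC
    have hη0 : ∫ t in a..b, η t = 0 := by
      have h1 : ∫ t in a..b, η t = (∫ t in a..b, (P t - R t - κ)) β :=
        (ContinuousLinearMap.intervalIntegral_apply (hPRi.sub intervalIntegrable_const) β).symm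
      rw [h1, intervalIntegral.integral_sub hPRi intervalIntegrable_const,
        intervalIntegral.integral_const, hκ, smul_smul, mul_inv_cancel₀ (sub_ne_zero.2 hab.ne'),
        one_smul, sub_self, zero_apply]
    set ψ : ℝ → ℝ := fun t ↦ ∫ s in a..t, η s with hψ
    have hψac : AbsolutelyContinuousOnInterval ψ a b :=
      hηi.absolutelyContinuousOnInterval_intervalIntegral left_mem_uIcc
    have hψd : ∀ᵐ t : ℝ, t ∈ Ioo a b → HasDerivAt ψ (η t) t := by
      filter_upwards [hηi.ae_hasDerivAt_integral] with t ht hmem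
      exact ht (by rw [uIcc_of_le hab.le]; exact Ioo_subset_Icc_self hmem) a left_mem_uIcc
    have hψb : ψ b = 0 := hη0
    have hψa : ψ a = 0 := by simp [hψ]
    have hφd : ∀ᵐ t : ℝ, t ∈ Ioo a b → deriv (fun t ↦ ψ t • β) t = η t • β := by
      filter_upwards [hψd] with t ht hmem
      exact ((ht hmem).smul_const β).deriv
    have htest : IsTestField (fun t ↦ ψ t • β) a b := by
      refine ⟨?_, by simp [hψa], by simp [hψb], (A + CR + ‖κ‖) * ‖β‖ * ‖β‖, ?_⟩
      · exact AbsolutelyContinuousOnInterval.clm_comp (ContinuousLinearMap.toSpanSingleton ℝ β) hψac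
      · filter_upwards [hηC, ae_restrict_of_ae hφd, ae_restrict_mem measurableSet_Ioo]
          with t h1 h2 h3
        rw [h2 h3, norm_smul]
        gcongr
    have hstat := h _ htest
    -- Integration by parts for the primitive of `Q`.
    have hr : IntervalIntegrable (fun t ↦ Q t β) volume a b := by
      refine intervalIntegrable_of_bound_Ioo (C := B * ‖β‖) hab.le
        (hQ.apply_continuousLinearMap β) ?_
      filter_upwards [hQB] with t ht
      exact ((Q t).le_opNorm β).trans (by gcongr)
    have hrac : AbsolutelyContinuousOnInterval (fun t ↦ ∫ s in a..t, Q s β) a b :=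
      hr.absolutelyContinuousOnInterval_intervalIntegral left_mem_uIcc
    have hibp := hrac.integral_deriv_mul_eq_sub hψac
    rw [hψa, hψb, mul_zero, mul_zero, sub_zero] at hibp
    have hrR : ∀ t ∈ Icc a b, ∫ s in a..t, Q s β = R t β := by
      intro t ht
      refine (ContinuousLinearMap.intervalIntegral_apply (hQi.mono_set ?_) β).symm
      rw [uIcc_of_le hab.le, uIcc_of_le ht.1]
      exact Icc_subset_Icc_right ht.2
    rw [intervalIntegral.integral_of_le hab.le, integral_Ioc_eq_integral_Ioo] at hibp
    have hψc : ContinuousOn ψ (Icc a b) := by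
      have := hψac.continuousOn
      rwa [uIcc_of_le hab.le] at this
    obtain ⟨Cψ, hCψ⟩ := isCompact_Icc.exists_bound_of_continuousOn hψc
    have e1 : ∫ t in Ioo a b, (Q t β * ψ t + R t β * η t) = 0 := by
      rw [← hibp]
      refine integral_congr_ae ?_
      filter_upwards [ae_restrict_of_ae hψd, ae_restrict_of_ae hr.ae_hasDerivAt_integral,
        ae_restrict_mem measurableSet_Ioo] with t h1 h2 h3
      rw [(h1 h3).deriv, (h2 (by rw [uIcc_of_le hab.le]; exact Ioo_subset_Icc_self h3) a
        left_mem_uIcc).deriv, hrR t (Ioo_subset_Icc_self h3)]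
    have e2 : ∫ t in Ioo a b, (P t β * η t + Q t β * ψ t) = 0 := by
      rw [← hstat]
      refine integral_congr_ae ?_
      filter_upwards [ae_restrict_of_ae hφd, ae_restrict_mem measurableSet_Ioo] with t h1 h2
      rw [h1 h2]
      simp [mul_comm]
    have hηi' : IntegrableOn η (Ioo a b) :=
      (intervalIntegrable_iff_integrableOn_Ioo_of_le hab.le).1 hηi
    have i1 : IntegrableOn (fun t ↦ Q t β * ψ t) (Ioo a b) := by
      refine IntegrableOn.of_bound (by simp) ((hQ.apply_continuousLinearMap β).mul
        ((hψc.mono Ioo_subset_Icc_self).aestronglyMeasurable measurableSet_Ioo))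
        (B * ‖β‖ * Cψ) ?_
      filter_upwards [hQB, ae_restrict_mem measurableSet_Ioo] with t h1 h2
      rw [norm_mul]
      have := hCψ t (Ioo_subset_Icc_self h2)
      have h3 := (Q t).le_opNorm β
      have hB : 0 ≤ B := (norm_nonneg _).trans h1
      gcongr
      exact h3.trans (by gcongr)
    have i2 : IntegrableOn (fun t ↦ R t β * η t) (Ioo a b) := by
      refine Integrable.bdd_mul (c := CR * ‖β‖) hηi' ?_ ?_
      · exact AEStronglyMeasurable.apply_continuousLinearMap
          ((hRc.mono Ioo_subset_Icc_self).aestronglyMeasurable measurableSet_Ioo) β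
      · filter_upwards [ae_restrict_mem measurableSet_Ioo] with t h1
        exact ((R t).le_opNorm β).trans (by gcongr; exact hCR t (Ioo_subset_Icc_self h1))
    have i3 : IntegrableOn (fun t ↦ P t β * η t) (Ioo a b) := by
      refine Integrable.bdd_mul (c := A * ‖β‖) hηi' (hP.apply_continuousLinearMap β) ?_
      filter_upwards [hPA] with t h1
      exact ((P t).le_opNorm β).trans (by gcongr)
    have i4 : IntegrableOn (fun t ↦ κ β * η t) (Ioo a b) := hηi'.const_mul _
    have e3 : ∫ t in Ioo a b, η t * η t = 0 := by
      have hη0' : ∫ t in Ioo a b, η t = 0 := by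
        rw [← integral_Ioc_eq_integral_Ioo, ← intervalIntegral.integral_of_le hab.le, hη0]
      have : ∀ t, η t * η t = (P t β * η t + Q t β * ψ t) - (Q t β * ψ t + R t β * η t)
          - κ β * η t := by
        intro t
        simp only [hη, sub_apply]
        ring
      simp_rw [this]
      have j1 : IntegrableOn (fun t ↦ P t β * η t + Q t β * ψ t) (Ioo a b) := i3.add i1
      have j2 : IntegrableOn (fun t ↦ Q t β * ψ t + R t β * η t) (Ioo a b) := i1.add i2
      have j3 : IntegrableOn (fun t ↦ P t β * η t + Q t β * ψ t - (Q t β * ψ t + R t β * η t))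
        (Ioo a b) := j1.sub j2
      rw [integral_sub j3 i4, integral_sub j1 j2, e1, e2, integral_const_mul, hη0']
      simp
    have i5 : IntegrableOn (fun t ↦ η t * η t) (Ioo a b) :=
      Integrable.bdd_mul (c := (A + CR + ‖κ‖) * ‖β‖) hηi' hηm hηC
    have := (setIntegral_eq_zero_iff_of_nonneg_ae
      (Eventually.of_forall fun t ↦ mul_self_nonneg (η t)) i5).1 e3
    filter_upwards [this] with t ht
    exact mul_self_eq_zero.1 ht
  have hall : ∀ᵐ t ∂volume.restrict (Ioo a b), ∀ i, (P t - R t - κ) (B' i) = 0 :=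
    ae_all_iff.2 fun i ↦ main (B' i)
  filter_upwards [hall] with t ht
  have h0 : P t - R t - κ = 0 := by
    apply ContinuousLinearMap.coe_injective
    exact B'.ext fun i ↦ by simpa using ht i
  rw [sub_sub, sub_eq_zero] at h0
  rw [h0, add_comm]

namespace IsTame

/-- The metric as an isomorphism from vectors to covectors, recovering velocities from momenta. -/
theorem exists_equiv_metric (h : IsTame g u D K) {x : F} (hx : x ∈ D) :
    ∃ G : F ≃L[ℝ] (F →L[ℝ] ℝ), (G : F →L[ℝ] F →L[ℝ] ℝ) = g x := by
  have hinj : Function.Injective (g x : F →ₗ[ℝ] F →L[ℝ] ℝ) := by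
    rw [← LinearMap.ker_eq_bot, LinearMap.ker_eq_bot']
    intro v hv
    have h1 := h.sq_norm_le x hx v
    have h2 : g x v = 0 := hv
    rw [h2] at h1
    simpa using h1
  have hdim : Module.finrank ℝ F = Module.finrank ℝ (F →L[ℝ] ℝ) := by
    rw [← Subspace.dual_finrank_eq (K := ℝ) (V := F)]
    exact (LinearMap.toContinuousLinearMap (𝕜 := ℝ) (E := F) (F' := ℝ)).finrank_eq
  refine ⟨(LinearMap.linearEquivOfInjective _ hinj hdim).toContinuousLinearEquiv, ?_⟩
  ext v w
  rfl

/-- A stationary curve of the action is of class `C²`, and its momentum `m g(c', ·)` satisfies the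
Euler-Lagrange equation. The momentum agrees almost everywhere with a continuous function by the
du Bois-Reymond lemma, and the velocity is recovered from it by inverting the metric. -/
theorem eulerLagrange (h : IsTame g u D K) (hm : 0 < m) {c : ℝ → F} {a b A : ℝ} (hab : a < b)
    (hc : AbsolutelyContinuousOnInterval c a b) (hcD : MapsTo c (Icc a b) D)
    (hcA : ∀ᵐ t ∂volume.restrict (Ioo a b), ‖deriv c t‖ ≤ A)
    (hstat : ∀ φ : ℝ → F, IsTestField φ a b →
      ∫ t in Ioo a b, firstVariation m g u (c t) (deriv c t) (φ t) (deriv φ t) = 0) :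
    ContDiffOn ℝ 2 c (Ioo a b) ∧ ∀ t ∈ Ioo a b,
      HasDerivAt (fun s ↦ m • g (c s) (deriv c s)) (force m g u (c t) (deriv c t)) t := by
  have hcc : ContinuousOn c (Icc a b) := by
    have := hc.continuousOn
    rwa [uIcc_of_le hab.le] at this
  have hcD' : MapsTo c (Ioo a b) D := hcD.mono_left Ioo_subset_Icc_self
  have hgc : ContinuousOn (fun t ↦ g (c t)) (Icc a b) := fun t ht ↦
    (h.contDiffAt_metric _ (hcD ht)).continuousAt.comp_continuousWithinAt (hcc t ht)
  have hvm : AEStronglyMeasurable (deriv c) (volume.restrict (Ioo a b)) :=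
    aestronglyMeasurable_deriv _ _
  set P : ℝ → F →L[ℝ] ℝ := fun t ↦ m • g (c t) (deriv c t) with hP
  set Q : ℝ → F →L[ℝ] ℝ := fun t ↦ force m g u (c t) (deriv c t) with hQ
  have hPm : AEStronglyMeasurable P (volume.restrict (Ioo a b)) := by
    refine AEStronglyMeasurable.const_smul ?_ m
    exact isBoundedBilinearMap_apply.continuous.comp_aestronglyMeasurable
      (((hgc.mono Ioo_subset_Icc_self).aestronglyMeasurable measurableSet_Ioo).prodMk hvm)
  have hQm : AEStronglyMeasurable Q (volume.restrict (Ioo a b)) := by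
    have h1 : ContinuousOn (fun t ↦ fderiv ℝ g (c t)) (Ioo a b) := fun t ht ↦
      (((h.contDiffAt_metric _ (hcD' ht)).continuousAt_fderiv (by simp)).comp_continuousWithinAt
        (hcc.mono Ioo_subset_Icc_self t ht))
    have h2 : ContinuousOn (fun t ↦ fderiv ℝ u (c t)) (Ioo a b) := fun t ht ↦
      (((h.contDiffAt_potential _ (hcD' ht)).continuousAt_fderiv
        (by simp)).comp_continuousWithinAt (hcc.mono Ioo_subset_Icc_self t ht))
    have h3 : ContinuousOn (fun t ↦ (fderiv ℝ g (c t)).flip) (Ioo a b) :=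
      (ContinuousLinearMap.flipₗᵢ ℝ F F (F →L[ℝ] ℝ)).continuous.comp_continuousOn h1
    have h4 : AEStronglyMeasurable (fun t ↦ (fderiv ℝ g (c t)).flip (deriv c t))
        (volume.restrict (Ioo a b)) :=
      isBoundedBilinearMap_apply.continuous.comp_aestronglyMeasurable
        ((h3.aestronglyMeasurable measurableSet_Ioo).prodMk hvm)
    have h5 : AEStronglyMeasurable (fun t ↦ ((fderiv ℝ g (c t)).flip (deriv c t)).flip)
        (volume.restrict (Ioo a b)) :=
      (ContinuousLinearMap.flipₗᵢ ℝ F F ℝ).continuous.comp_aestronglyMeasurable h4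
    exact ((isBoundedBilinearMap_apply.continuous.comp_aestronglyMeasurable
      (h5.prodMk hvm)).const_smul (m / 2)).sub (h2.aestronglyMeasurable measurableSet_Ioo)
  have hPb : ∀ᵐ t ∂volume.restrict (Ioo a b), ‖P t‖ ≤ m * (K * A) := by
    filter_upwards [hcA, ae_restrict_mem measurableSet_Ioo] with t h1 h2
    rw [hP, norm_smul, Real.norm_of_nonneg hm.le]
    have hK : 0 ≤ K := (norm_nonneg _).trans (h.norm_metric_le _ (hcD' h2))
    gcongr
    refine ((g (c t)).le_opNorm _).trans ?_
    gcongr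
    exact h.norm_metric_le _ (hcD' h2)
  have hQb : ∀ᵐ t ∂volume.restrict (Ioo a b), ‖Q t‖ ≤ m / 2 * (K * A * A) + K := by
    filter_upwards [hcA, ae_restrict_mem measurableSet_Ioo] with t h1 h2
    exact h.norm_force_le hm.le (hcD' h2) h1
  obtain ⟨κ, hκ⟩ := ae_eq_of_forall_testField hab hPm hQm hPb hQb fun φ hφ ↦ by
    rw [← hstat φ hφ]
    refine integral_congr_ae (Eventually.of_forall fun t ↦ ?_)
    simp [hP, hQ, firstVariation_eq_add_force]
  have hQi := intervalIntegrable_of_bound_Ioo hab.le hQm hQb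
  set p : ℝ → F →L[ℝ] ℝ := fun t ↦ κ + ∫ s in a..t, Q s with hp
  have hpc : ContinuousOn p (Icc a b) := by
    have := intervalIntegral.continuousOn_primitive_interval (μ := volume) (a := a) (b := b)
      (f := Q) (by
        rw [uIcc_of_le hab.le]
        rwa [intervalIntegrable_iff_integrableOn_Icc_of_le hab.le] at hQi)
    rw [uIcc_of_le hab.le] at this
    exact continuousOn_const.add this
  set w : ℝ → F := fun t ↦ (g (c t)).inverse (m⁻¹ • p t) with hw
  have hinv : ∀ t ∈ Icc a b, ContDiffAt ℝ 1 ContinuousLinearMap.inverse (g (c t)) := by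
    intro t ht
    obtain ⟨G, hG⟩ := h.exists_equiv_metric (hcD ht)
    rw [← hG]
    exact contDiffAt_map_inverse G
  have hwc : ContinuousOn w (Icc a b) := by
    refine ContinuousOn.clm_apply (fun t ht ↦ ?_) (hpc.const_smul m⁻¹)
    exact (hinv t ht).continuousAt.comp_continuousWithinAt (f := fun t ↦ g (c t)) (hgc t ht)
  have hgw : ∀ t ∈ Icc a b, m • g (c t) (w t) = p t := by
    intro t ht
    obtain ⟨G, hG⟩ := h.exists_equiv_metric (hcD ht)
    simp only [hw, ← hG, ContinuousLinearMap.inverse_equiv]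
    simp [smul_smul, hm.ne']
  have hwinj : ∀ t ∈ Icc a b, ∀ v, m • g (c t) v = p t → v = w t := by
    intro t ht v hv
    obtain ⟨G, hG⟩ := h.exists_equiv_metric (hcD ht)
    simp only [hw, ← hv, ← hG, ContinuousLinearMap.inverse_equiv]
    simp [smul_smul, hm.ne']
  have hcw : ∀ t ∈ Ioo a b, HasDerivAt c (w t) t := by
    refine hc.hasDerivAt_of_ae_deriv_eq hab.le hwc ?_
    rw [ae_restrict_iff' measurableSet_Ioo] at hκ
    filter_upwards [hκ] with t ht hmem
    exact hwinj t (Ioo_subset_Icc_self hmem) _ (ht hmem)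
  have hdw : ∀ t ∈ Ioo a b, deriv c t = w t := fun t ht ↦ (hcw t ht).deriv
  have hQc : ContinuousOn Q (Ioo a b) :=
    h.continuousOn_force (hcc.mono Ioo_subset_Icc_self) hcD'
      ((hwc.mono Ioo_subset_Icc_self).congr hdw)
  have hpd : ∀ t ∈ Ioo a b, HasDerivAt p (Q t) t := by
    intro t ht
    refine HasDerivAt.const_add κ (intervalIntegral.integral_hasDerivAt_right (hQi.mono_set ?_)
      (hQc.stronglyMeasurableAtFilter isOpen_Ioo t ht)
      (hQc.continuousAt (isOpen_Ioo.mem_nhds ht)))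
    rw [uIcc_of_le hab.le, uIcc_of_le ht.1.le]
    exact Icc_subset_Icc_right ht.2.le
  have hp1 : ContDiffOn ℝ 1 p (Ioo a b) := by
    have : ContDiffOn ℝ (0 + 1) p (Ioo a b) := by
      rw [contDiffOn_succ_iff_deriv_of_isOpen isOpen_Ioo]
      refine ⟨fun t ht ↦ (hpd t ht).differentiableAt.differentiableWithinAt, by simp, ?_⟩
      rw [contDiffOn_zero]
      exact hQc.congr fun t ht ↦ (hpd t ht).deriv
    simpa using this
  have hc1 : ContDiffOn ℝ 1 c (Ioo a b) := by
    have : ContDiffOn ℝ (0 + 1) c (Ioo a b) := by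
      rw [contDiffOn_succ_iff_deriv_of_isOpen isOpen_Ioo]
      refine ⟨fun t ht ↦ (hcw t ht).differentiableAt.differentiableWithinAt, by simp, ?_⟩
      rw [contDiffOn_zero]
      exact (hwc.mono Ioo_subset_Icc_self).congr hdw
    simpa using this
  have hw1 : ContDiffOn ℝ 1 w (Ioo a b) := by
    refine ContDiffOn.clm_apply (fun t ht ↦ ?_) (hp1.const_smul m⁻¹)
    exact (hinv t (Ioo_subset_Icc_self ht)).comp_contDiffWithinAt t
      ((h.contDiffAt_metric _ (hcD' ht)).comp_contDiffWithinAt t (hc1 t ht))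
  refine ⟨?_, fun t ht ↦ ?_⟩
  · have : ContDiffOn ℝ (1 + 1) c (Ioo a b) := by
      rw [contDiffOn_succ_iff_deriv_of_isOpen isOpen_Ioo]
      refine ⟨fun t ht ↦ (hcw t ht).differentiableAt.differentiableWithinAt, by simp, ?_⟩
      exact hw1.congr hdw
    simpa [one_add_one_eq_two] using this
  · refine (hpd t ht).congr_of_eventuallyEq ?_
    filter_upwards [isOpen_Ioo.mem_nhds ht] with s hs
    change m • g (c s) (deriv c s) = p s
    rw [hdw s hs, hgw s (Ioo_subset_Icc_self hs)]

end IsTame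

end EulerLagrange

/-! ### Charts, and the metric in a chart -/

section Charts

variable {F : Type*} [NormedAddCommGroup F] [NormedSpace ℝ F]
  {H : Type*} [TopologicalSpace H] (I : ModelWithCorners ℝ F H)
  {M : Type*} [TopologicalSpace M] [ChartedSpace H M]

/-- `Ψ` is a chart of class `C²`, with values in the model vector space. -/
structure IsSmoothChart (Ψ : OpenPartialHomeomorph M F) : Prop where
  contMDiffOn : ContMDiffOn I 𝓘(ℝ, F) 2 Ψ Ψ.source
  contMDiffOn_symm : ContMDiffOn 𝓘(ℝ, F) I 2 Ψ.symm Ψ.target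

/-- The differential at `y` of a parametrization `Φ`, as a map to the tangent space at
`x = Φ y`. -/
def pushforward (Φ : F → M) (y : F) {x : M} (h : Φ y = x) : F →L[ℝ] TangentSpace I x :=
  h ▸ (mfderiv 𝓘(ℝ, F) I Φ y : F →L[ℝ] TangentSpace I (Φ y))

/-- The pullback of the Riemannian metric by a parametrization `Φ`. -/
def pullMetric [RiemannianBundle (fun x : M ↦ TangentSpace I x)] (Φ : F → M) (y : F) :
    F →L[ℝ] F →L[ℝ] ℝ :=
  let D : F →L[ℝ] TangentSpace I (Φ y) := mfderiv 𝓘(ℝ, F) I Φ y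
  (innerSL ℝ (E := TangentSpace I (Φ y))).bilinearComp D D

variable {I}

theorem pullMetric_apply [RiemannianBundle (fun x : M ↦ TangentSpace I x)] (Φ : F → M) (y : F)
    {x : M} (hx : Φ y = x) (v w : F) :
    pullMetric I Φ y v w = inner ℝ (pushforward I Φ y hx v) (pushforward I Φ y hx w) := by
  subst hx
  rfl

theorem pullMetric_symm [RiemannianBundle (fun x : M ↦ TangentSpace I x)] (Φ : F → M) (y v w : F) :
    pullMetric I Φ y v w = pullMetric I Φ y w v := by
  rw [pullMetric_apply Φ y rfl, pullMetric_apply Φ y rfl, real_inner_comm]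

theorem pullMetric_self [RiemannianBundle (fun x : M ↦ TangentSpace I x)] (Φ : F → M) (y : F)
    {x : M} (hx : Φ y = x) (v : F) :
    pullMetric I Φ y v v = ‖pushforward I Φ y hx v‖ ^ 2 := by
  rw [pullMetric_apply Φ y hx, real_inner_self_eq_norm_sq]

theorem mk_pushforward (Φ : F → M) (y : F) {x : M} (hx : Φ y = x) (v : F) :
    (⟨x, pushforward I Φ y hx v⟩ : TangentBundle I M) =
      tangentMap 𝓘(ℝ, F) I Φ (⟨y, v⟩ : TangentBundle 𝓘(ℝ, F) F) := by
  subst hx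
  rfl

namespace IsSmoothChart

variable {Ψ : OpenPartialHomeomorph M F}

theorem mdifferentiableAt (hΨ : IsSmoothChart I Ψ) {x : M} (hx : x ∈ Ψ.source) :
    MDifferentiableAt I 𝓘(ℝ, F) Ψ x :=
  (hΨ.contMDiffOn.contMDiffAt (Ψ.open_source.mem_nhds hx)).mdifferentiableAt (by simp)

theorem mdifferentiableAt_symm (hΨ : IsSmoothChart I Ψ) {y : F} (hy : y ∈ Ψ.target) :
    MDifferentiableAt 𝓘(ℝ, F) I Ψ.symm y :=
  (hΨ.contMDiffOn_symm.contMDiffAt (Ψ.open_target.mem_nhds hy)).mdifferentiableAt (by simp)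

theorem contMDiffOn_tangentMap_symm [IsManifold I 1 M] (hΨ : IsSmoothChart I Ψ) :
    ContMDiffOn 𝓘(ℝ, F).tangent I.tangent 1 (tangentMap 𝓘(ℝ, F) I Ψ.symm)
      (Bundle.TotalSpace.proj ⁻¹' Ψ.target) := by
  have h := hΨ.contMDiffOn_symm.contMDiffOn_tangentMapWithin (m := 1)
    (by norm_num [one_add_one_eq_two]) Ψ.open_target.uniqueMDiffOn
  refine h.congr fun p hp ↦ ?_
  rw [tangentMapWithin_eq_tangentMap (Ψ.open_target.uniqueMDiffOn _ hp)
    (hΨ.mdifferentiableAt_symm hp)]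

theorem tendsto_mk_pushforward [IsManifold I 1 M] (hΨ : IsSmoothChart I Ψ) {y : F}
    (hy : y ∈ Ψ.target) {x : M} (hx : Ψ.symm y = x) (v : F) {c w : ℝ → F} {l : Filter ℝ}
    (hc : Tendsto c l (𝓝 y)) (hw : Tendsto w l (𝓝 v)) :
    Tendsto (fun t ↦ (⟨Ψ.symm (c t), pushforward I Ψ.symm (c t) rfl (w t)⟩ : TangentBundle I M)) l
      (𝓝 (⟨x, pushforward I Ψ.symm y hx v⟩ : TangentBundle I M)) := by
  simp only [mk_pushforward]
  have hopen : IsOpen ((Bundle.TotalSpace.proj : TangentBundle 𝓘(ℝ, F) F → F) ⁻¹' Ψ.target) :=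
    Ψ.open_target.preimage (FiberBundle.continuous_proj F (TangentSpace 𝓘(ℝ, F)))
  have hcont : ContinuousAt (tangentMap 𝓘(ℝ, F) I Ψ.symm)
      (⟨y, v⟩ : TangentBundle 𝓘(ℝ, F) F) :=
    hΨ.contMDiffOn_tangentMap_symm.continuousOn.continuousAt (hopen.mem_nhds hy)
  refine hcont.tendsto.comp ?_
  have h2 := ((tangentBundleModelSpaceHomeomorph 𝓘(ℝ, F)).symm.continuous.tendsto (y, v)).comp
    (hc.prodMk_nhds hw)
  exact h2

theorem contDiffOn_pullMetric [FiniteDimensional ℝ F] [IsManifold I 1 M]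
    [RiemannianBundle (fun x : M ↦ TangentSpace I x)]
    [IsContMDiffRiemannianBundle I 1 F (fun x : M ↦ TangentSpace I x)] (hΨ : IsSmoothChart I Ψ) :
    ContDiffOn ℝ 1 (pullMetric I Ψ.symm) Ψ.target := by
  rw [contDiffOn_clm_apply]
  intro v
  rw [contDiffOn_clm_apply]
  intro w
  have hsec : ∀ z : F, ContMDiffOn 𝓘(ℝ, F) I.tangent 1
      (fun y ↦ (⟨Ψ.symm y, pushforward I Ψ.symm y rfl z⟩ : TangentBundle I M)) Ψ.target := by
    intro z
    have h1 : ContMDiff 𝓘(ℝ, F) 𝓘(ℝ, F).tangent 1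
        (fun y ↦ (⟨y, z⟩ : TangentBundle 𝓘(ℝ, F) F)) :=
      contMDiff_vectorSpace_iff_contDiff.2 contDiff_const
    refine (hΨ.contMDiffOn_tangentMap_symm.comp h1.contMDiffOn (fun y hy ↦ hy)).congr
      fun y _ ↦ ?_
    rw [mk_pushforward]
    rfl
  have := ContMDiffOn.inner_bundle (E := fun x : M ↦ TangentSpace I x) (hsec v) (hsec w)
  rw [contMDiffOn_iff_contDiffOn] at this
  exact this.congr fun y _ ↦ pullMetric_apply _ _ rfl _ _

theorem pushforward_eq_mfderiv {Φ : F → M} {y : F} {x : M} (hx : Φ y = x) (v : F) :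
    (pushforward I Φ y hx v : F) = (mfderiv 𝓘(ℝ, F) I Φ y v : F) := by
  subst hx
  rfl

theorem mfderiv_pushforward (hΨ : IsSmoothChart I Ψ) {y : F} (hy : y ∈ Ψ.target) {x : M}
    (hx : Ψ.symm y = x) (v : F) :
    (mfderiv I 𝓘(ℝ, F) Ψ x (pushforward I Ψ.symm y hx v) : F) = v := by
  subst hx
  have h1 := (hΨ.mdifferentiableAt (Ψ.map_target hy)).hasMFDerivAt
  have h2 := (hΨ.mdifferentiableAt_symm hy).hasMFDerivAt
  have h3 := HasMFDerivAt.comp y h1 h2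
  have h4 : HasMFDerivAt 𝓘(ℝ, F) 𝓘(ℝ, F) (Ψ ∘ Ψ.symm) y
      (ContinuousLinearMap.id ℝ (TangentSpace 𝓘(ℝ, F) y)) := by
    refine (hasMFDerivAt_id y).congr_of_eventuallyEq ?_
    filter_upwards [Ψ.open_target.mem_nhds hy] with z hz using Ψ.right_inv hz
  exact congrArg (fun L ↦ L v) (hasMFDerivAt_unique h3 h4)

theorem pushforward_injective (hΨ : IsSmoothChart I Ψ) {y : F} (hy : y ∈ Ψ.target) {x : M}
    (hx : Ψ.symm y = x) : Function.Injective (pushforward I Ψ.symm y hx) :=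
  Function.LeftInverse.injective (g := mfderiv I 𝓘(ℝ, F) Ψ x) (hΨ.mfderiv_pushforward hy hx)

theorem pushforward_surjective [FiniteDimensional ℝ F] (hΨ : IsSmoothChart I Ψ) {y : F}
    (hy : y ∈ Ψ.target) {x : M} (hx : Ψ.symm y = x) :
    Function.Surjective (pushforward I Ψ.symm y hx) := by
  have h := hΨ.pushforward_injective hy hx
  let L : F →ₗ[ℝ] F := (pushforward I Ψ.symm y hx : F →ₗ[ℝ] TangentSpace I x)
  exact (LinearMap.injective_iff_surjective (f := L)).1 h

/-- The velocity of a curve is the image of the velocity of the curve read in the chart. At an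
instant where the curve is not differentiable, both velocities vanish by convention. -/
theorem velocity_eq_pushforward (hΨ : IsSmoothChart I Ψ) {γ : ℝ → M} {t : ℝ}
    (hγ : ∀ᶠ s in 𝓝 t, γ s ∈ Ψ.source) :
    velocity I γ t =
      pushforward I Ψ.symm (Ψ (γ t)) (Ψ.left_inv hγ.self_of_nhds) (deriv (fun s ↦ Ψ (γ s)) t) := by
  have hsrc : γ t ∈ Ψ.source := hγ.self_of_nhds
  have hev : γ =ᶠ[𝓝 t] Ψ.symm ∘ (fun s ↦ Ψ (γ s)) := by
    filter_upwards [hγ] with s hs using (Ψ.left_inv hs).symm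
  by_cases hd : DifferentiableAt ℝ (fun s ↦ Ψ (γ s)) t
  · have h1 : HasMFDerivAt 𝓘(ℝ, ℝ) 𝓘(ℝ, F) (fun s ↦ Ψ (γ s)) t
        (ContinuousLinearMap.toSpanSingleton ℝ (deriv (fun s ↦ Ψ (γ s)) t)) :=
      hd.hasDerivAt.hasFDerivAt.hasMFDerivAt
    have h2 := (hΨ.mdifferentiableAt_symm (Ψ.map_source hsrc)).hasMFDerivAt
    have h3 := (HasMFDerivAt.comp t h2 h1).congr_of_eventuallyEq hev
    have h4 : (velocity I γ t : F) = (mfderiv 𝓘(ℝ, F) I Ψ.symm (Ψ (γ t))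
        (ContinuousLinearMap.toSpanSingleton ℝ (deriv (fun s ↦ Ψ (γ s)) t) (1 : ℝ)) : F) :=
      congrArg (fun L : ℝ →L[ℝ] F ↦ L 1) h3.mfderiv
    refine h4.trans ?_
    rw [pushforward_eq_mfderiv]
    exact congrArg (fun z : F ↦ (mfderiv 𝓘(ℝ, F) I Ψ.symm (Ψ (γ t)) z : F)) (one_smul ℝ _)
  · have h1 : ¬ MDifferentiableAt 𝓘(ℝ, ℝ) I γ t := by
      intro h
      refine hd ?_
      have := (hΨ.mdifferentiableAt hsrc).comp t h
      exact this.differentiableAt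
    rw [velocity, mfderiv_zero_of_not_mdifferentiableAt h1, deriv_zero_of_not_differentiableAt hd,
      map_zero]
    rfl

theorem norm_velocity_sq [RiemannianBundle (fun x : M ↦ TangentSpace I x)]
    (hΨ : IsSmoothChart I Ψ) {γ : ℝ → M} {t : ℝ} (hγ : ∀ᶠ s in 𝓝 t, γ s ∈ Ψ.source) :
    ‖velocity I γ t‖ ^ 2 = pullMetric I Ψ.symm (Ψ (γ t)) (deriv (fun s ↦ Ψ (γ s)) t)
      (deriv (fun s ↦ Ψ (γ s)) t) := by
  rw [pullMetric_self _ _ (Ψ.left_inv hγ.self_of_nhds), hΨ.velocity_eq_pushforward hγ]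

theorem hasDerivAt_of_hasInitialVelocity (hΨ : IsSmoothChart I Ψ) {c : ℝ → M} {x : M} {y v : F}
    (hy : y ∈ Ψ.target) (hx : Ψ.symm y = x)
    (hc : HasInitialVelocity I c x (pushforward I Ψ.symm y hx v)) :
    HasDerivAt (fun s ↦ Ψ (c s)) v 0 := by
  obtain ⟨hc0, hc⟩ := hc
  subst hc0
  have hsrc : c 0 ∈ Ψ.source := by
    rw [← hx]
    exact Ψ.map_target hy
  have h1 := HasMFDerivAt.comp 0 (hΨ.mdifferentiableAt hsrc).hasMFDerivAt hc
  let w : F := pushforward I Ψ.symm y hx v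
  let L : F →L[ℝ] F := mfderiv I 𝓘(ℝ, F) Ψ (c 0)
  have h2 : HasFDerivAt (fun s ↦ Ψ (c s)) (L ∘L ContinuousLinearMap.toSpanSingleton ℝ w) 0 :=
    h1.hasFDerivAt
  have h3 : (L ∘L ContinuousLinearMap.toSpanSingleton ℝ w) 1 = v := by
    change L ((1 : ℝ) • w) = v
    rw [one_smul]
    exact hΨ.mfderiv_pushforward hy hx v
  rw [← h3]
  exact h2.hasDerivAt

theorem hasInitialVelocity_symm (hΨ : IsSmoothChart I Ψ) {x : M} {y v : F}
    (hy : y ∈ Ψ.target) (hx : Ψ.symm y = x) {c : ℝ → F} (hc0 : c 0 = y) (hc : HasDerivAt c v 0) :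
    HasInitialVelocity I (fun s ↦ Ψ.symm (c s)) x (pushforward I Ψ.symm y hx v) := by
  subst hc0
  refine ⟨hx, ?_⟩
  have h1 : HasMFDerivAt 𝓘(ℝ, ℝ) 𝓘(ℝ, F) c 0 (ContinuousLinearMap.toSpanSingleton ℝ v) :=
    hc.hasFDerivAt.hasMFDerivAt
  let L : F →L[ℝ] F := mfderiv 𝓘(ℝ, F) I Ψ.symm (c 0)
  have h2 : HasMFDerivAt 𝓘(ℝ, ℝ) I (fun s ↦ Ψ.symm (c s)) 0
      (L ∘L ContinuousLinearMap.toSpanSingleton ℝ v) :=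
    HasMFDerivAt.comp 0 (hΨ.mdifferentiableAt_symm hy).hasMFDerivAt h1
  have e : L ∘L ContinuousLinearMap.toSpanSingleton ℝ v =
      ContinuousLinearMap.toSpanSingleton ℝ (pushforward I Ψ.symm (c 0) hx v : F) := by
    refine ContinuousLinearMap.ext_ring ?_
    change L ((1 : ℝ) • v) = (1 : ℝ) • (pushforward I Ψ.symm (c 0) hx v : F)
    rw [one_smul, one_smul]
    exact (pushforward_eq_mfderiv hx v).symm
  exact h2.congr_mfderiv e

/-- Near a point of the chart, the metric and its derivative are bounded, and the metric is
uniformly positive. -/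
theorem exists_ball_metric_bounds [FiniteDimensional ℝ F] [IsManifold I 1 M]
    [RiemannianBundle (fun x : M ↦ TangentSpace I x)]
    [IsContMDiffRiemannianBundle I 1 F (fun x : M ↦ TangentSpace I x)] (hΨ : IsSmoothChart I Ψ)
    {y₀ : F} (hy₀ : y₀ ∈ Ψ.target) :
    ∃ ρ > 0, ∃ K : ℝ, Metric.ball y₀ ρ ⊆ Ψ.target ∧ ∀ y ∈ Metric.ball y₀ ρ,
      ‖pullMetric I Ψ.symm y‖ ≤ K ∧ ‖fderiv ℝ (pullMetric I Ψ.symm) y‖ ≤ K ∧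
      ∀ v, ‖v‖ ^ 2 ≤ K * pullMetric I Ψ.symm y v v := by
  set g := pullMetric I Ψ.symm with hg
  have hgc : ContDiffAt ℝ 1 g y₀ :=
    hΨ.contDiffOn_pullMetric.contDiffAt (Ψ.open_target.mem_nhds hy₀)
  obtain ⟨L, hL0, hL⟩ := LinearMap.exists_antilipschitzWith
    (pushforward I Ψ.symm y₀ rfl : F →ₗ[ℝ] TangentSpace I (Ψ.symm y₀))
    (LinearMap.ker_eq_bot.2 (hΨ.pushforward_injective hy₀ rfl))
  have hpos : ∀ v, ‖v‖ ^ 2 ≤ (L : ℝ) ^ 2 * g y₀ v v := by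
    intro v
    have h1 := hL.le_mul_dist v 0
    rw [map_zero, dist_zero_right, dist_zero_right] at h1
    rw [hg, pullMetric_self _ _ rfl, ← mul_pow]
    exact pow_le_pow_left₀ (norm_nonneg _) h1 2
  have hL0' : (0 : ℝ) < L := hL0
  have e1 : ∀ᶠ y in 𝓝 y₀, ‖g y - g y₀‖ < 1 / (2 * (L : ℝ) ^ 2) := by
    have : Tendsto (fun y ↦ ‖g y - g y₀‖) (𝓝 y₀) (𝓝 0) := by
      have h := (hgc.continuousAt.sub (continuousAt_const (y := g y₀))).norm
      simpa [ContinuousAt] using h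
    exact this.eventually (gt_mem_nhds (by positivity))
  have e2 : ∀ᶠ y in 𝓝 y₀, ‖g y‖ < ‖g y₀‖ + 1 :=
    hgc.continuousAt.norm.eventually (gt_mem_nhds (by simp))
  have e3 : ∀ᶠ y in 𝓝 y₀, ‖fderiv ℝ g y‖ < ‖fderiv ℝ g y₀‖ + 1 :=
    (hgc.continuousAt_fderiv (by simp)).norm.eventually (gt_mem_nhds (by simp))
  obtain ⟨ρ, hρ, hball⟩ := Metric.eventually_nhds_iff_ball.1
    (e1.and (e2.and (e3.and (Ψ.open_target.eventually_mem hy₀))))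
  refine ⟨ρ, hρ, max (2 * (L : ℝ) ^ 2) (max (‖g y₀‖ + 1) (‖fderiv ℝ g y₀‖ + 1)),
    fun y hy ↦ (hball y hy).2.2.2, fun y hy ↦ ⟨?_, ?_, fun v ↦ ?_⟩⟩
  · exact (hball y hy).2.1.le.trans ((le_max_left _ _).trans (le_max_right _ _))
  · exact (hball y hy).2.2.1.le.trans ((le_max_right _ _).trans (le_max_right _ _))
  · have h1 := (hball y hy).1
    have h2 : |g y v v - g y₀ v v| ≤ 1 / (2 * (L : ℝ) ^ 2) * ‖v‖ * ‖v‖ := by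
      calc |g y v v - g y₀ v v| = ‖(g y - g y₀) v v‖ := by simp
        _ ≤ ‖g y - g y₀‖ * ‖v‖ * ‖v‖ := (g y - g y₀).le_opNorm₂ v v
        _ ≤ _ := by gcongr
    have h3 := hpos v
    have h4 : ‖v‖ ^ 2 ≤ 2 * (L : ℝ) ^ 2 * g y v v := by
      have h5 := (abs_le.1 h2).1
      have h6 : (L : ℝ) ^ 2 * (1 / (2 * (L : ℝ) ^ 2) * ‖v‖ * ‖v‖) = ‖v‖ ^ 2 / 2 := by
        field_simp
      nlinarith [sq_nonneg (L : ℝ), mul_le_mul_of_nonneg_left h5 (sq_nonneg (L : ℝ))]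
    have h7 : 0 ≤ g y v v := by
      rw [hg, pullMetric_self _ _ rfl]
      positivity
    exact h4.trans (by gcongr; exact le_max_left _ _)

end IsSmoothChart

end Charts

/-! ### Arcs in a chart, and competitors obtained by modifying an arc -/

section Extension

variable {F : Type*} [NormedAddCommGroup F] [NormedSpace ℝ F]

/-- Extension of a test field by zero. -/
theorem IsTestField.exists_extension {φ : ℝ → F} {a b : ℝ} (hab : a ≤ b) (hφ : IsTestField φ a b)
    (c d : ℝ) : ∃ φ' : ℝ → F, AbsolutelyContinuousOnInterval φ' c d ∧ EqOn φ' φ (Icc a b) ∧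
      ∀ t ∉ Ioo a b, φ' t = 0 := by
  refine ⟨_, hφ.ac.comp_clamp hab c d, fun t ht ↦ ?_, fun t ht ↦ ?_⟩
  · simp [ht.1, ht.2]
  · rw [mem_Ioo, not_and_or, not_lt, not_lt] at ht
    rcases ht with ht | ht
    · simp [ht, ht.trans hab, hφ.left]
    · simp [ht, hab, hφ.right]

end Extension

section Arcs

variable {F : Type*} [NormedAddCommGroup F] [NormedSpace ℝ F]
  {H : Type*} [TopologicalSpace H] (I : ModelWithCorners ℝ F H)
  {M : Type*} [TopologicalSpace M] [ChartedSpace H M]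

/-- The arc `γ([r₁, r₂])` lies in the domain of the chart `Ψ`, where it is an absolutely continuous
curve. -/
structure IsChartArc (Ψ : OpenPartialHomeomorph M F) (γ : ℝ → M) (r₁ r₂ : ℝ) : Prop where
  chart : IsSmoothChart I Ψ
  lt : r₁ < r₂
  mem : ∀ t ∈ Icc r₁ r₂, γ t ∈ Ψ.source
  ac : AbsolutelyContinuousOnInterval (fun t ↦ Ψ (γ t)) r₁ r₂

variable {I}

/-- Locally, a map of class `C¹` preserves absolute continuity of curves, since it is Lipschitz. -/
theorem exists_ac_comp_of_contDiffAt {x : ℝ → F} {p q t : ℝ}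
    (hx : AbsolutelyContinuousOnInterval x p q) (ht : t ∈ Icc p q) {f : F → F}
    (hf : ContDiffAt ℝ 1 f (x t)) {N : Set F} (hN : N ∈ 𝓝 (x t)) :
    ∃ δ > 0, (∀ s ∈ Icc (max p (t - δ)) (min q (t + δ)), x s ∈ N) ∧
      AbsolutelyContinuousOnInterval (fun s ↦ f (x s)) (max p (t - δ)) (min q (t + δ)) := by
  obtain ⟨K, T, hT, hK⟩ := hf.exists_lipschitzOnWith
  have hpq : p ≤ q := ht.1.trans ht.2
  have hcont : ContinuousOn x (Icc p q) := by simpa [uIcc_of_le hpq] using hx.continuousOn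
  obtain ⟨δ, hδ, hball⟩ := Metric.mem_nhdsWithin_iff.1
    ((hcont t ht).preimage_mem_nhdsWithin (inter_mem hT hN))
  have hle : max p (t - δ / 2) ≤ min q (t + δ / 2) := by
    rw [max_le_iff, le_min_iff, le_min_iff]
    exact ⟨⟨hpq, by linarith [ht.1]⟩, by linarith [ht.2], by linarith⟩
  have hmem : ∀ s ∈ Icc (max p (t - δ / 2)) (min q (t + δ / 2)), x s ∈ T ∩ N := by
    intro s hs
    rw [mem_Icc, max_le_iff, le_min_iff] at hs
    refine hball ⟨?_, hs.1.1, hs.2.1⟩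
    rw [Metric.mem_ball, Real.dist_eq, abs_lt]
    constructor <;> linarith [hs.1.2, hs.2.2]
  refine ⟨δ / 2, by positivity, fun s hs ↦ (hmem s hs).2,
    LipschitzOnWith.comp_absolutelyContinuousOnInterval hK (hx.mono ?_) fun s hs ↦ ?_⟩
  · rw [uIcc_of_le hle, uIcc_of_le hpq]
    exact Icc_subset_Icc (le_max_left _ _) (min_le_left _ _)
  · rw [uIcc_of_le hle] at hs
    exact (hmem s hs).1

theorem contDiffAt_chart_comp_symm [I.Boundaryless] [IsManifold I 2 M]
    {Ψ : OpenPartialHomeomorph M F} (hΨ : IsSmoothChart I Ψ) {p x : M}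
    (hp : x ∈ (chartAt H p).source) (hx : x ∈ Ψ.source) :
    ContDiffAt ℝ 1 (fun y ↦ Ψ ((extChartAt I p).symm y)) (extChartAt I p x) := by
  have hx' : x ∈ (extChartAt I p).source := by rwa [extChartAt_source]
  have h1 : ContMDiffAt 𝓘(ℝ, F) I 2 (extChartAt I p).symm (extChartAt I p x) :=
    (contMDiffOn_extChartAt_symm p).contMDiffAt
      (extChartAt_target_mem_nhds' ((extChartAt I p).map_source hx'))
  have h2 : ContMDiffAt I 𝓘(ℝ, F) 2 Ψ ((extChartAt I p).symm (extChartAt I p x)) := by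
    rw [(extChartAt I p).left_inv hx']
    exact hΨ.contMDiffOn.contMDiffAt (Ψ.open_source.mem_nhds hx)
  exact (h2.comp _ h1).contDiffAt.of_le (by norm_num)

theorem contDiffAt_extChartAt_comp_symm [IsManifold I 2 M]
    {Ψ : OpenPartialHomeomorph M F} (hΨ : IsSmoothChart I Ψ) {p : M} {y : F} (hy : y ∈ Ψ.target)
    (hp : Ψ.symm y ∈ (chartAt H p).source) :
    ContDiffAt ℝ 1 (fun y ↦ extChartAt I p (Ψ.symm y)) y := by
  have h1 : ContMDiffAt 𝓘(ℝ, F) I 2 Ψ.symm y :=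
    hΨ.contMDiffOn_symm.contMDiffAt (Ψ.open_target.mem_nhds hy)
  have h2 : ContMDiffAt I 𝓘(ℝ, F) 2 (extChartAt I p) (Ψ.symm y) :=
    contMDiffOn_extChartAt.contMDiffAt ((chartAt H p).open_source.mem_nhds hp)
  exact (h2.comp _ h1).contDiffAt.of_le (by norm_num)

/-- Absolute continuity, which is defined by the preferred charts, holds in any smooth chart. -/
theorem IsACPath.exists_isChartArc [I.Boundaryless] [IsManifold I 2 M] {γ : ℝ → M} {a b t : ℝ}
    (hγ : IsACPath I γ a b) (ht : t ∈ Ioo a b) {Ψ : OpenPartialHomeomorph M F}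
    (hΨ : IsSmoothChart I Ψ) (hmem : γ t ∈ Ψ.source) {N : Set ℝ} (hN : N ∈ 𝓝 t) :
    ∃ δ > 0, Icc (t - δ) (t + δ) ⊆ N ∩ Ioo a b ∧ IsChartArc I Ψ γ (t - δ) (t + δ) := by
  obtain ⟨δ₀, hδ₀, hsrc, hac⟩ := hγ.2 t (Ioo_subset_Icc_self ht)
  have hmax : max a (t - δ₀) ≤ t := max_le ht.1.le (by linarith)
  have hmin : t ≤ min b (t + δ₀) := le_min ht.2.le (by linarith)
  obtain ⟨δ₁, hδ₁, -, hac₁⟩ := exists_ac_comp_of_contDiffAt hac ⟨hmax, hmin⟩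
    (contDiffAt_chart_comp_symm (p := γ t) hΨ (mem_chart_source H _) hmem) univ_mem
  have hcont : ContinuousAt γ t :=
    hγ.1.continuousAt (Icc_mem_nhds ht.1 ht.2)
  have hnh : (γ ⁻¹' Ψ.source ∩ N ∩ Ioo a b) ∩ Ioo (t - min δ₀ δ₁) (t + min δ₀ δ₁) ∈ 𝓝 t :=
    inter_mem (inter_mem (inter_mem (hcont (Ψ.open_source.mem_nhds hmem)) hN)
      (isOpen_Ioo.mem_nhds ht)) (Ioo_mem_nhds (by linarith [lt_min hδ₀ hδ₁])
        (by linarith [lt_min hδ₀ hδ₁]))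
  obtain ⟨δ₂, hδ₂, hball⟩ := Metric.nhds_basis_closedBall.mem_iff.1 hnh
  rw [Real.closedBall_eq_Icc] at hball
  have hle : t - δ₂ ≤ t + δ₂ := by linarith
  have hl := (hball (left_mem_Icc.2 hle))
  have hr := (hball (right_mem_Icc.2 hle))
  have h1 : max (max a (t - δ₀)) (t - δ₁) ≤ t - δ₂ := by
    refine max_le (max_le hl.1.2.1.le ?_) ?_
    · linarith [hl.2.1, min_le_left δ₀ δ₁]
    · linarith [hl.2.1, min_le_right δ₀ δ₁]
  have h2 : t + δ₂ ≤ min (min b (t + δ₀)) (t + δ₁) := by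
    refine le_min (le_min hr.1.2.2.le ?_) ?_
    · linarith [hr.2.2, min_le_left δ₀ δ₁]
    · linarith [hr.2.2, min_le_right δ₀ δ₁]
  have hsub : uIcc (t - δ₂) (t + δ₂) ⊆
      uIcc (max (max a (t - δ₀)) (t - δ₁)) (min (min b (t + δ₀)) (t + δ₁)) := by
    rw [uIcc_of_le hle, uIcc_of_le (h1.trans (hle.trans h2))]
    exact Icc_subset_Icc h1 h2
  refine ⟨δ₂, hδ₂, fun s hs ↦ ⟨(hball hs).1.1.2, (hball hs).1.2⟩, hΨ, by linarith,
    fun s hs ↦ (hball hs).1.1.1, (hac₁.mono hsub).congr_eqOn fun s hs ↦ ?_⟩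
  rw [uIcc_of_le hle] at hs
  have : γ s ∈ (extChartAt I (γ t)).source := by
    rw [extChartAt_source]
    refine hsrc s ⟨?_, ?_⟩
    · exact ((le_max_left _ _).trans h1).trans hs.1
    · exact hs.2.trans (h2.trans (min_le_left _ _))
  simp only [(extChartAt I (γ t)).left_inv this]

namespace IsChartArc

variable {Ψ : OpenPartialHomeomorph M F} {γ : ℝ → M} {r₁ r₂ : ℝ}

theorem continuousOn (h : IsChartArc I Ψ γ r₁ r₂) :
    ContinuousOn (fun t ↦ Ψ (γ t)) (Icc r₁ r₂) := by
  simpa [uIcc_of_le h.lt.le] using h.ac.continuousOn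

theorem mem_target (h : IsChartArc I Ψ γ r₁ r₂) {t : ℝ} (ht : t ∈ Icc r₁ r₂) :
    Ψ (γ t) ∈ Ψ.target :=
  Ψ.map_source (h.mem t ht)

theorem symm_apply (h : IsChartArc I Ψ γ r₁ r₂) {t : ℝ} (ht : t ∈ Icc r₁ r₂) :
    Ψ.symm (Ψ (γ t)) = γ t :=
  Ψ.left_inv (h.mem t ht)

theorem eventually_mem (h : IsChartArc I Ψ γ r₁ r₂) {t : ℝ} (ht : t ∈ Ioo r₁ r₂) :
    ∀ᶠ s in 𝓝 t, γ s ∈ Ψ.source := by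
  filter_upwards [isOpen_Ioo.mem_nhds ht] with s hs using h.mem s (Ioo_subset_Icc_self hs)

/-- Replacing a piece of an arc, in a chart, by another absolutely continuous curve with the same
endpoints gives an absolutely continuous path. -/
theorem isACPath_of_eqOn [IsManifold I 2 M] (h : IsChartArc I Ψ γ r₁ r₂) {a b t₁ t₂ : ℝ}
    (hγ : IsACPath I γ a b) (har : a < r₁) (hrb : r₂ < b) (ht₁ : r₁ < t₁) (ht₂ : t₂ < r₂)
    {c : ℝ → F} (hc : AbsolutelyContinuousOnInterval c r₁ r₂)
    (hcΨ : ∀ t ∈ Icc r₁ r₂, c t ∈ Ψ.target)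
    (hcγ : ∀ t ∈ Icc r₁ r₂, t ∉ Ioo t₁ t₂ → c t = Ψ (γ t)) {σ : ℝ → M}
    (hσ : ∀ t ∈ Ioo t₁ t₂, σ t = Ψ.symm (c t)) (hσγ : ∀ t ∉ Ioo t₁ t₂, σ t = γ t) :
    IsACPath I σ a b := by
  have hσc : ∀ t ∈ Icc r₁ r₂, σ t = Ψ.symm (c t) := by
    intro t ht
    by_cases hmem : t ∈ Ioo t₁ t₂
    · exact hσ t hmem
    · rw [hσγ t hmem, hcγ t ht hmem, h.symm_apply ht]
  have hcc : ContinuousOn c (Icc r₁ r₂) := by simpa [uIcc_of_le h.lt.le] using hc.continuousOn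
  refine ⟨fun t ht ↦ ?_, fun t ht ↦ ?_⟩
  · by_cases hr : t ∈ Ioo r₁ r₂
    · have h1 : ContinuousAt c t := hcc.continuousAt (Icc_mem_nhds hr.1 hr.2)
      have h2 : ContinuousAt (fun t ↦ Ψ.symm (c t)) t :=
        ContinuousAt.comp (f := c) (g := Ψ.symm)
          (Ψ.symm.continuousAt (hcΨ t (Ioo_subset_Icc_self hr))) h1
      refine (h2.congr ?_).continuousWithinAt
      filter_upwards [Icc_mem_nhds hr.1 hr.2] with s hs using (hσc s hs).symm
    · have hnot : t ∉ Icc t₁ t₂ := fun hmem ↦ hr ⟨ht₁.trans_le hmem.1, hmem.2.trans_lt ht₂⟩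
      refine (hγ.1 t ht).congr_of_eventuallyEq ?_ (hσγ t fun hmem ↦
        hnot (Ioo_subset_Icc_self hmem))
      filter_upwards [mem_nhdsWithin_of_mem_nhds (isClosed_Icc.isOpen_compl.mem_nhds hnot)]
        with s hs using hσγ s fun hmem ↦ hs (Ioo_subset_Icc_self hmem)
  · by_cases hr : t ∈ Ioo r₁ r₂
    · have hrI := Ioo_subset_Icc_self hr
      have hsrc : Ψ.symm (c t) ∈ (chartAt H (σ t)).source := by
        rw [← hσc t hrI]
        exact mem_chart_source H _
      have hN : Ψ.symm ⁻¹' (chartAt H (σ t)).source ∈ 𝓝 (c t) :=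
        (Ψ.symm.continuousAt (hcΨ t hrI)).preimage_mem_nhds
          ((chartAt H (σ t)).open_source.mem_nhds hsrc)
      obtain ⟨δ, hδ, hmem, hac⟩ := exists_ac_comp_of_contDiffAt hc hrI
        (contDiffAt_extChartAt_comp_symm h.chart (p := σ t) (hcΨ t hrI) hsrc) hN
      set δ' := min δ (min (t - r₁) (r₂ - t)) with hδ'
      have hδ'0 : 0 < δ' := lt_min hδ (lt_min (by linarith [hr.1]) (by linarith [hr.2]))
      have hd1 : δ' ≤ δ := min_le_left _ _
      have hd2 : δ' ≤ t - r₁ := (min_le_right _ _).trans (min_le_left _ _)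
      have hd3 : δ' ≤ r₂ - t := (min_le_right _ _).trans (min_le_right _ _)
      have hsub : Icc (max a (t - δ')) (min b (t + δ')) ⊆
          Icc (max r₁ (t - δ)) (min r₂ (t + δ)) := by
        rw [max_eq_right (by linarith), min_eq_right (by linarith)]
        refine Icc_subset_Icc (max_le ?_ ?_) (le_min ?_ ?_) <;> linarith
      have hsubr : Icc (max r₁ (t - δ)) (min r₂ (t + δ)) ⊆ Icc r₁ r₂ :=
        Icc_subset_Icc (le_max_left _ _) (min_le_left _ _)
      have hle : max a (t - δ') ≤ min b (t + δ') := by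
        rw [max_eq_right (by linarith), min_eq_right (by linarith)]
        linarith
      have hle' : max r₁ (t - δ) ≤ min r₂ (t + δ) := by
        rw [max_le_iff, le_min_iff, le_min_iff]
        refine ⟨⟨?_, ?_⟩, ?_, ?_⟩ <;> linarith [hr.1, hr.2]
      refine ⟨δ', hδ'0, fun s hs ↦ ?_, (hac.mono ?_).congr_eqOn fun s hs ↦ ?_⟩
      · rw [hσc s (hsubr (hsub hs))]
        exact hmem s (hsub hs)
      · rwa [uIcc_of_le hle, uIcc_of_le hle']
      · rw [uIcc_of_le hle] at hs
        simp only [hσc s (hsubr (hsub hs))]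
    · have hnot : t ∉ Icc t₁ t₂ := fun hmem ↦ hr ⟨ht₁.trans_le hmem.1, hmem.2.trans_lt ht₂⟩
      obtain ⟨δ, hδ, hmem, hac⟩ := hγ.2 t ht
      obtain ⟨ε, hε, hball⟩ := Metric.nhds_basis_closedBall.mem_iff.1
        (isClosed_Icc.isOpen_compl.mem_nhds hnot)
      rw [Real.closedBall_eq_Icc] at hball
      have hsub : Icc (max a (t - min δ ε)) (min b (t + min δ ε)) ⊆
          Icc (max a (t - δ)) (min b (t + δ)) :=
        Icc_subset_Icc (max_le_max le_rfl (by linarith [min_le_left δ ε]))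
          (min_le_min le_rfl (by linarith [min_le_left δ ε]))
      have hm0 : 0 < min δ ε := lt_min hδ hε
      have hle : max a (t - min δ ε) ≤ min b (t + min δ ε) := by
        rw [max_le_iff, le_min_iff, le_min_iff]
        refine ⟨⟨?_, ?_⟩, ?_, ?_⟩ <;> linarith [ht.1, ht.2]
      have hle' : max a (t - δ) ≤ min b (t + δ) := by
        rw [max_le_iff, le_min_iff, le_min_iff]
        refine ⟨⟨?_, ?_⟩, ?_, ?_⟩ <;> linarith [ht.1, ht.2]
      have heq : ∀ s ∈ Icc (max a (t - min δ ε)) (min b (t + min δ ε)), σ s = γ s := by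
        intro s hs
        refine hσγ s fun hs' ↦ hball ⟨?_, ?_⟩ (Ioo_subset_Icc_self hs')
        · linarith [(le_max_right _ _).trans hs.1, min_le_right δ ε]
        · linarith [hs.2.trans (min_le_right _ _), min_le_right δ ε]
      have hσt : σ t = γ t := hσγ t fun hs' ↦ hnot (Ioo_subset_Icc_self hs')
      refine ⟨min δ ε, lt_min hδ hε, fun s hs ↦ ?_, (hac.mono ?_).congr_eqOn fun s hs ↦ ?_⟩
      · rw [heq s hs, hσt]
        exact hmem s (hsub hs)
      · rwa [uIcc_of_le hle, uIcc_of_le hle']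
      · rw [uIcc_of_le hle] at hs
        simp only [heq s hs, hσt]

end IsChartArc

end Arcs

/-! ### First variation of a time-parametrized minimizer -/

section Minimizer

variable {F : Type*} [NormedAddCommGroup F] [NormedSpace ℝ F]
  {H : Type*} [TopologicalSpace H] (I : ModelWithCorners ℝ F H)
  {M : Type*} [TopologicalSpace M] [ChartedSpace H M]
  [RiemannianBundle (fun x : M ↦ TangentSpace I x)]

/-- `γ` is parametrized by the mechanical time, and minimizes the optical length among the paths
in `V` with the same endpoints that satisfy the constraint `adm`. -/
structure IsTimedMinimizer (adm : (ℝ → M) → Prop) (V : Set M) (U : M → ℝ) (e m : ℝ) (γ : ℝ → M)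
    (a b : ℝ) : Prop where
  ac : IsACPath I γ a b
  mapsTo : MapsTo γ (Icc a b) V
  finite : opticalLength I U e γ a b ≠ ⊤
  le : ∀ σ : ℝ → M, IsACPath I σ a b → MapsTo σ (Icc a b) V → σ a = γ a → σ b = γ b →
    adm σ → opticalLength I U e γ a b ≤ opticalLength I U e σ a b
  energy : ∀ y ∈ V, U y < e
  time : IsTimeParametrized I m U e γ a b

variable {I}

/-- The optical length density is at most the density of the mechanical action divided by `√m`.
Equality holds at the speed `η / √m`: this is Maupertuis' principle. -/
theorem refractiveIndex_mul_le {X : Type*} {U : X → ℝ} {e m r : ℝ} {x : X} (hm : 0 < m)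
    (hU : U x ≤ e) :
    refractiveIndex U e x * r ≤ (m / 2 * r ^ 2 + (e - U x)) / √m := by
  have h1 : refractiveIndex U e x ^ 2 = 2 * (e - U x) := Real.sq_sqrt (by linarith)
  have h2 : √m ^ 2 = m := Real.sq_sqrt hm.le
  rw [le_div_iff₀ (Real.sqrt_pos.2 hm)]
  nlinarith [sq_nonneg (refractiveIndex U e x - √m * r)]

theorem refractiveIndex_mul_eq {X : Type*} {U : X → ℝ} {e m r : ℝ} {x : X} (hm : 0 < m)
    (hU : U x ≤ e) (hr : r = refractiveIndex U e x / √m) :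
    refractiveIndex U e x * r = (m / 2 * r ^ 2 + (e - U x)) / √m := by
  have h1 : refractiveIndex U e x ^ 2 = 2 * (e - U x) := Real.sq_sqrt (by linarith)
  have h2 : √m ^ 2 = m := Real.sq_sqrt hm.le
  have h3 : r * √m = refractiveIndex U e x := by
    rw [hr, div_mul_cancel₀ _ (Real.sqrt_pos.2 hm).ne']
  rw [eq_div_iff (Real.sqrt_pos.2 hm).ne']
  nlinarith

theorem sq_speed_eq {X : Type*} {U : X → ℝ} {e m r : ℝ} {x : X} (hm : 0 < m) (hU : U x ≤ e)
    (hr : r = refractiveIndex U e x / √m) : m * r ^ 2 = 2 * (e - U x) := by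
  have h1 : refractiveIndex U e x ^ 2 = 2 * (e - U x) := Real.sq_sqrt (by linarith)
  rw [hr, div_pow, Real.sq_sqrt hm.le, h1]
  field_simp

namespace IsTimedMinimizer

variable {adm : (ℝ → M) → Prop} {V : Set M} {U : M → ℝ} {e m : ℝ} {γ : ℝ → M} {a b : ℝ}
  {Ψ : OpenPartialHomeomorph M F} {r₁ r₂ t₁ t₂ : ℝ}

/-- Conservation of energy along the path, which is another form of the condition on the
parametrization. -/
theorem ae_energy (h : IsTimedMinimizer I adm V U e m γ a b) (hm : 0 < m)
    (arc : IsChartArc I Ψ γ r₁ r₂) (har : a < r₁) (hrb : r₂ < b) :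
    ∀ᵐ t, t ∈ Ioo r₁ r₂ → m * pullMetric I Ψ.symm (Ψ (γ t)) (deriv (fun s ↦ Ψ (γ s)) t)
      (deriv (fun s ↦ Ψ (γ s)) t) = 2 * (e - U (γ t)) := by
  have := h.time
  rw [IsTimeParametrized, ae_restrict_iff' measurableSet_Icc] at this
  filter_upwards [this] with t ht hmem
  have hIcc : t ∈ Icc a b := ⟨by linarith [hmem.1], by linarith [hmem.2]⟩
  rw [← arc.chart.norm_velocity_sq (arc.eventually_mem hmem)]
  exact sq_speed_eq hm (h.energy _ (h.mapsTo hIcc)).le (ht hIcc)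

/-- A minimizer of the optical length minimizes the optical length of each of its arcs. -/
theorem lintegral_le [IsManifold I 2 M] (h : IsTimedMinimizer I adm V U e m γ a b)
    (arc : IsChartArc I Ψ γ r₁ r₂) (har : a < r₁) (hrb : r₂ < b) (ht₁ : r₁ < t₁)
    (ht₂ : t₂ < r₂) {c : ℝ → F} (hc : AbsolutelyContinuousOnInterval c r₁ r₂)
    (hcΨ : ∀ t ∈ Icc r₁ r₂, c t ∈ Ψ.target) (hcV : ∀ t ∈ Ioo t₁ t₂, Ψ.symm (c t) ∈ V)
    (hcγ : ∀ t ∈ Icc r₁ r₂, t ∉ Ioo t₁ t₂ → c t = Ψ (γ t)) {σ : ℝ → M}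
    (hσ : ∀ t ∈ Ioo t₁ t₂, σ t = Ψ.symm (c t)) (hσγ : ∀ t ∉ Ioo t₁ t₂, σ t = γ t)
    (hadm : adm σ) :
    ∫⁻ t in Ioo t₁ t₂, ENNReal.ofReal (refractiveIndex U e (γ t) * ‖velocity I γ t‖) ≤
      ∫⁻ t in Ioo t₁ t₂, ENNReal.ofReal (refractiveIndex U e (σ t) * ‖velocity I σ t‖) := by
  have hσac := arc.isACPath_of_eqOn h.ac har hrb ht₁ ht₂ hc hcΨ hcγ hσ hσγ
  have hσV : MapsTo σ (Icc a b) V := by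
    intro t htab
    by_cases hmem : t ∈ Ioo t₁ t₂
    · rw [hσ t hmem]
      exact hcV t hmem
    · rw [hσγ t hmem]
      exact h.mapsTo htab
  have hle := h.le σ hσac hσV (hσγ a fun hmem ↦ by linarith [hmem.1])
    (hσγ b fun hmem ↦ by linarith [hmem.2]) hadm
  have hsub : Ioo t₁ t₂ ⊆ Icc a b := fun t hmem ↦
    ⟨by linarith [hmem.1], by linarith [hmem.2]⟩
  have hsplit : ∀ f : ℝ → ℝ≥0∞, ∫⁻ t in Icc a b, f t =
      (∫⁻ t in Icc a b \ Ioo t₁ t₂, f t) + ∫⁻ t in Ioo t₁ t₂, f t := by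
    intro f
    rw [← lintegral_union measurableSet_Ioo disjoint_sdiff_left, sdiff_union_of_subset hsub]
  have hfin := h.finite
  simp only [opticalLength] at hfin hle
  rw [hsplit] at hfin
  rw [hsplit, hsplit] at hle
  have hout : ∫⁻ t in Icc a b \ Ioo t₁ t₂,
        ENNReal.ofReal (refractiveIndex U e (γ t) * ‖velocity I γ t‖) =
      ∫⁻ t in Icc a b \ Ioo t₁ t₂,
        ENNReal.ofReal (refractiveIndex U e (σ t) * ‖velocity I σ t‖) := by
    refine lintegral_congr_ae ?_
    have h1 : ∀ᵐ t : ℝ, t ≠ t₁ := by simp [ae_iff, measure_singleton]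
    have h2 : ∀ᵐ t : ℝ, t ≠ t₂ := by simp [ae_iff, measure_singleton]
    filter_upwards [ae_restrict_of_ae h1, ae_restrict_of_ae h2,
      ae_restrict_mem (measurableSet_Icc.diff measurableSet_Ioo)] with t ht1 ht2 hmem
    have hnot : t ∉ Icc t₁ t₂ := fun hI ↦
      hmem.2 ⟨lt_of_le_of_ne hI.1 ht1.symm, lt_of_le_of_ne hI.2 ht2⟩
    have hev : σ =ᶠ[𝓝 t] γ := by
      filter_upwards [isClosed_Icc.isOpen_compl.mem_nhds hnot] with s hs
      exact hσγ s fun hs' ↦ hs (Ioo_subset_Icc_self hs')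
    have hnorm : ∀ (x y : M) (v : TangentSpace I x) (w : TangentSpace I y), x = y →
        (v : F) = (w : F) → ‖v‖ = ‖w‖ := by
      rintro x _ v w rfl hvw
      exact congrArg (fun z : TangentSpace I x ↦ ‖z‖) hvw
    have hvel : (velocity I σ t : F) = (velocity I γ t : F) :=
      congrArg (fun L : ℝ →L[ℝ] F ↦ L 1) hev.mfderiv_eq
    rw [hnorm _ _ (velocity I σ t) (velocity I γ t) (hσγ t hmem.2) hvel, hσγ t hmem.2]
  rw [hout] at hle hfin
  exact (ENNReal.add_le_add_iff_left (ENNReal.add_ne_top.1 hfin).1).1 hle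

/-- The path minimizes the mechanical action of each of its arcs. -/
theorem integral_lagrangian_le [IsManifold I 2 M] (h : IsTimedMinimizer I adm V U e m γ a b)
    (hm : 0 < m) (arc : IsChartArc I Ψ γ r₁ r₂) (har : a < r₁) (hrb : r₂ < b) (ht₁ : r₁ < t₁)
    (ht₂ : t₂ < r₂) {c : ℝ → F} (hc : AbsolutelyContinuousOnInterval c r₁ r₂)
    (hcΨ : ∀ t ∈ Icc r₁ r₂, c t ∈ Ψ.target) (hcV : ∀ t ∈ Ioo t₁ t₂, Ψ.symm (c t) ∈ V)
    (hcγ : ∀ t ∈ Icc r₁ r₂, t ∉ Ioo t₁ t₂ → c t = Ψ (γ t))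
    (hadm : ∀ σ : ℝ → M, (∀ t ∈ Ioo t₁ t₂, σ t = Ψ.symm (c t)) → (∀ t ∉ Ioo t₁ t₂, σ t = γ t) →
      adm σ)
    (hint₀ : IntegrableOn (fun t ↦ lagrangian m e (pullMetric I Ψ.symm) (fun y ↦ U (Ψ.symm y))
      (Ψ (γ t)) (deriv (fun s ↦ Ψ (γ s)) t)) (Ioo t₁ t₂))
    (hint : IntegrableOn (fun t ↦ lagrangian m e (pullMetric I Ψ.symm) (fun y ↦ U (Ψ.symm y))
      (c t) (deriv c t)) (Ioo t₁ t₂)) :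
    ∫ t in Ioo t₁ t₂, lagrangian m e (pullMetric I Ψ.symm) (fun y ↦ U (Ψ.symm y))
      (Ψ (γ t)) (deriv (fun s ↦ Ψ (γ s)) t) ≤
    ∫ t in Ioo t₁ t₂, lagrangian m e (pullMetric I Ψ.symm) (fun y ↦ U (Ψ.symm y))
      (c t) (deriv c t) := by
  classical
  set σ : ℝ → M := fun t ↦ if t ∈ Ioo t₁ t₂ then Ψ.symm (c t) else γ t with hσdef
  have hσ : ∀ t ∈ Ioo t₁ t₂, σ t = Ψ.symm (c t) := fun t hmem ↦ if_pos hmem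
  have hσγ : ∀ t ∉ Ioo t₁ t₂, σ t = γ t := fun t hmem ↦ if_neg hmem
  have hle := h.lintegral_le arc har hrb ht₁ ht₂ hc hcΨ hcV hcγ hσ hσγ (hadm σ hσ hσγ)
  have hsubr : Ioo t₁ t₂ ⊆ Icc r₁ r₂ := fun t hmem ↦
    ⟨by linarith [hmem.1], by linarith [hmem.2]⟩
  have hsubr' : Ioo t₁ t₂ ⊆ Ioo r₁ r₂ := fun t hmem ↦
    ⟨by linarith [hmem.1], by linarith [hmem.2]⟩
  have hsuba : Ioo t₁ t₂ ⊆ Icc a b := fun t hmem ↦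
    ⟨by linarith [hmem.1], by linarith [hmem.2]⟩
  have hsm : 0 < √m := Real.sqrt_pos.2 hm
  have hnn : ∀ (y v : F), Ψ.symm y ∈ V → 0 ≤ lagrangian m e (pullMetric I Ψ.symm)
      (fun y ↦ U (Ψ.symm y)) y v := by
    intro y v hy
    have h1 := h.energy _ hy
    rw [lagrangian, pullMetric_self _ _ rfl]
    have : 0 ≤ m / 2 * ‖pushforward I Ψ.symm y rfl v‖ ^ 2 := by positivity
    linarith
  have hγV : ∀ t ∈ Ioo t₁ t₂, Ψ.symm (Ψ (γ t)) ∈ V := fun t hmem ↦ by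
    rw [arc.symm_apply (hsubr hmem)]
    exact h.mapsTo (hsuba hmem)
  have h1 : ∫⁻ t in Ioo t₁ t₂, ENNReal.ofReal (refractiveIndex U e (γ t) * ‖velocity I γ t‖) =
      ∫⁻ t in Ioo t₁ t₂, ENNReal.ofReal (lagrangian m e (pullMetric I Ψ.symm)
        (fun y ↦ U (Ψ.symm y)) (Ψ (γ t)) (deriv (fun s ↦ Ψ (γ s)) t) / √m) := by
    refine lintegral_congr_ae ?_
    have htime := h.time
    rw [IsTimeParametrized, ae_restrict_iff' measurableSet_Icc] at htime
    filter_upwards [ae_restrict_of_ae htime, ae_restrict_mem measurableSet_Ioo] with t h1 hmem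
    rw [refractiveIndex_mul_eq hm (h.energy _ (h.mapsTo (hsuba hmem))).le (h1 (hsuba hmem)),
      arc.chart.norm_velocity_sq (arc.eventually_mem (hsubr' hmem)), lagrangian,
      arc.symm_apply (hsubr hmem)]
  have h2 : ∫⁻ t in Ioo t₁ t₂, ENNReal.ofReal (refractiveIndex U e (σ t) * ‖velocity I σ t‖) ≤
      ∫⁻ t in Ioo t₁ t₂, ENNReal.ofReal (lagrangian m e (pullMetric I Ψ.symm)
        (fun y ↦ U (Ψ.symm y)) (c t) (deriv c t) / √m) := by
    refine lintegral_mono_ae ?_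
    filter_upwards [ae_restrict_mem measurableSet_Ioo] with t hmem
    refine ENNReal.ofReal_le_ofReal ?_
    have hev : ∀ᶠ s in 𝓝 t, Ψ (σ s) = c s := by
      filter_upwards [isOpen_Ioo.mem_nhds hmem] with s hs
      rw [hσ s hs, Ψ.right_inv (hcΨ s (hsubr hs))]
    have hsrc : ∀ᶠ s in 𝓝 t, σ s ∈ Ψ.source := by
      filter_upwards [isOpen_Ioo.mem_nhds hmem] with s hs
      rw [hσ s hs]
      exact Ψ.map_target (hcΨ s (hsubr hs))
    have hσV : σ t ∈ V := by
      rw [hσ t hmem]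
      exact hcV t hmem
    refine (refractiveIndex_mul_le hm (h.energy _ hσV).le).trans ?_
    rw [arc.chart.norm_velocity_sq hsrc, lagrangian, hev.self_of_nhds,
      EventuallyEq.deriv_eq hev, hσ t hmem]
  have h3 := h1.symm.le.trans (hle.trans h2)
  rw [← ofReal_integral_eq_lintegral_ofReal (hint₀.div_const _) ?_,
    ← ofReal_integral_eq_lintegral_ofReal (hint.div_const _) ?_,
    ENNReal.ofReal_le_ofReal_iff, integral_div, integral_div,
    div_le_div_iff_of_pos_right hsm] at h3
  · exact h3
  · refine setIntegral_nonneg measurableSet_Ioo fun t hmem ↦ ?_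
    exact div_nonneg (hnn _ _ (hcV t hmem)) hsm.le
  · filter_upwards [ae_restrict_mem measurableSet_Ioo] with t hmem
    exact div_nonneg (hnn _ _ (hcV t hmem)) hsm.le
  · filter_upwards [ae_restrict_mem measurableSet_Ioo] with t hmem
    exact div_nonneg (hnn _ _ (hγV t hmem)) hsm.le

variable {u₁ u₂ : F → ℝ} {D₁ D₂ : Set F} {K₁ K₂ : ℝ} {t₀ s₀ : ℝ}

/-- On a piece where the potential is tame, the velocity in the chart is bounded. -/
theorem exists_norm_deriv_le (h : IsTimedMinimizer I adm V U e m γ a b) (hm : 0 < m)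
    (arc : IsChartArc I Ψ γ r₁ r₂) (har : a < r₁) (hrb : r₂ < b)
    (h₁ : IsTame (pullMetric I Ψ.symm) u₁ D₁ K₁) (hu₁ : ∀ y ∈ D₁, U (Ψ.symm y) = u₁ y)
    (hsub : Ioo t₁ t₂ ⊆ Ioo r₁ r₂) (hc : ∀ t ∈ Ioo t₁ t₂, Ψ (γ t) ∈ D₁) :
    ∃ A, ∀ᵐ t ∂volume.restrict (Ioo t₁ t₂), ‖deriv (fun s ↦ Ψ (γ s)) t‖ ≤ A := by
  refine ⟨√(K₁ * (2 * (|e| + K₁) / m)), ?_⟩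
  filter_upwards [ae_restrict_of_ae (h.ae_energy hm arc har hrb),
    ae_restrict_mem measurableSet_Ioo] with t ht hmem
  have h1 := ht (hsub hmem)
  have h2 := h₁.sq_norm_le _ (hc t hmem) (deriv (fun s ↦ Ψ (γ s)) t)
  have h3 := h₁.abs_potential_le _ (hc t hmem)
  have hK : 0 ≤ K₁ := (abs_nonneg _).trans h3
  rw [← hu₁ _ (hc t hmem), arc.symm_apply (Ioo_subset_Icc_self (hsub hmem))] at h3
  refine Real.le_sqrt_of_sq_le (h2.trans ?_)
  gcongr
  rw [le_div_iff₀ hm, mul_comm, h1]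
  linarith [neg_abs_le (U (γ t)), le_abs_self e]

/-- The first variation of the action is nonnegative in every admissible direction. The curve may
change from one side of the hypersurface to the other one at the instant `t₀`: before and after,
the potential is given by the smooth functions `u₁` and `u₂`. -/
theorem firstVariation_nonneg [FiniteDimensional ℝ F] [IsManifold I 2 M]
    (h : IsTimedMinimizer I adm V U e m γ a b)
    (hm : 0 < m) (arc : IsChartArc I Ψ γ r₁ r₂) (har : a < r₁) (hrb : r₂ < b) (ht₁ : r₁ < t₁)
    (ht₁₀ : t₁ < t₀) (ht₀₂ : t₀ < t₂) (ht₂ : t₂ < r₂)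
    (h₁ : IsTame (pullMetric I Ψ.symm) u₁ D₁ K₁) (hu₁ : ∀ y ∈ D₁, U (Ψ.symm y) = u₁ y)
    (h₂ : IsTame (pullMetric I Ψ.symm) u₂ D₂ K₂) (hu₂ : ∀ y ∈ D₂, U (Ψ.symm y) = u₂ y)
    {φ : ℝ → F} (hφ : IsTestField φ t₁ t₂) (hs₀ : 0 < s₀)
    (hV : ∀ s ∈ Icc 0 s₀, ∀ t ∈ Ioo t₁ t₂,
      Ψ (γ t) + s • φ t ∈ Ψ.target ∧ Ψ.symm (Ψ (γ t) + s • φ t) ∈ V)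
    (hD₁ : ∀ s ∈ Icc 0 s₀, ∀ t ∈ Ioo t₁ t₀, Ψ (γ t) + s • φ t ∈ D₁)
    (hD₂ : ∀ s ∈ Icc 0 s₀, ∀ t ∈ Ioo t₀ t₂, Ψ (γ t) + s • φ t ∈ D₂)
    (hadm : ∀ s ∈ Ioc 0 s₀, ∀ σ : ℝ → M,
      (∀ t ∈ Ioo t₁ t₂, σ t = Ψ.symm (Ψ (γ t) + s • φ t)) → (∀ t ∉ Ioo t₁ t₂, σ t = γ t) →
      adm σ) :
    0 ≤ (∫ t in Ioo t₁ t₀, firstVariation m (pullMetric I Ψ.symm) u₁ (Ψ (γ t))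
          (deriv (fun s ↦ Ψ (γ s)) t) (φ t) (deriv φ t)) +
        ∫ t in Ioo t₀ t₂, firstVariation m (pullMetric I Ψ.symm) u₂ (Ψ (γ t))
          (deriv (fun s ↦ Ψ (γ s)) t) (φ t) (deriv φ t) := by
  set c : ℝ → F := fun s ↦ Ψ (γ s) with hcdef
  set g := pullMetric I Ψ.symm with hg
  obtain ⟨φ', hφ'ac, hφ'eq, hφ'0⟩ := hφ.exists_extension (ht₁₀.trans ht₀₂).le r₁ r₂
  have hlt := ht₁₀.trans ht₀₂
  have hsub₁ : Ioo t₁ t₀ ⊆ Ioo t₁ t₂ := Ioo_subset_Ioo_right ht₀₂.le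
  have hsub₂ : Ioo t₀ t₂ ⊆ Ioo t₁ t₂ := Ioo_subset_Ioo_left ht₁₀.le
  have hsubr : Ioo t₁ t₂ ⊆ Ioo r₁ r₂ := Ioo_subset_Ioo ht₁.le ht₂.le
  have hrI : uIcc r₁ r₂ = Icc r₁ r₂ := uIcc_of_le arc.lt.le
  have hdφ' : ∀ t ∈ Ioo t₁ t₂, deriv φ' t = deriv φ t := by
    intro t hmem
    refine EventuallyEq.deriv_eq ?_
    filter_upwards [isOpen_Ioo.mem_nhds hmem] with s hs using hφ'eq (Ioo_subset_Icc_self hs)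
  have hae : ∀ s : ℝ, ∀ᵐ t ∂volume.restrict (Ioo t₁ t₂),
      deriv (fun t ↦ c t + s • φ' t) t = deriv c t + s • deriv φ t := by
    intro s
    filter_upwards [ae_restrict_of_ae arc.ac.ae_differentiableAt_of_finiteDimensional,
      ae_restrict_of_ae hφ'ac.ae_differentiableAt_of_finiteDimensional,
      ae_restrict_mem measurableSet_Ioo] with t h1 h2 hmem
    have hmem' : t ∈ uIcc r₁ r₂ := by
      rw [hrI]
      exact Ioo_subset_Icc_self (hsubr hmem)
    rw [← hdφ' t hmem]
    exact ((h1 hmem').hasDerivAt.add ((h2 hmem').hasDerivAt.const_smul s)).deriv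
  obtain ⟨C, hC⟩ := hφ.bounded
  obtain ⟨C', hC'⟩ := hφ.ac.exists_bound
  rw [uIcc_of_le hlt.le] at hC'
  have hφc : ContinuousOn φ (Ioo t₁ t₂) := by
    have := hφ.ac.continuousOn
    rw [uIcc_of_le hlt.le] at this
    exact this.mono Ioo_subset_Icc_self
  have hcc : ContinuousOn c (Ioo t₁ t₂) :=
    arc.continuousOn.mono (hsubr.trans Ioo_subset_Icc_self)
  -- Decomposition of the action of the varied curves.
  set L : (F → ℝ) → ℝ → ℝ → ℝ := fun u s t ↦
    lagrangian m e g u (c t + s • φ t) (deriv c t + s • deriv φ t) with hL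
  have hpiece : ∀ (u : F → ℝ) (D : Set F) (K p q : ℝ), IsTame g u D K → Ioo p q ⊆ Ioo t₁ t₂ →
      (∀ y ∈ D, U (Ψ.symm y) = u y) → (∀ s ∈ Icc 0 s₀, ∀ t ∈ Ioo p q, c t + s • φ t ∈ D) →
      (∀ s ∈ Icc 0 s₀, IntegrableOn (fun t ↦ L u s t) (Ioo p q)) ∧
      Tendsto (fun s : ℝ ↦ s⁻¹ * ((∫ t in Ioo p q, L u s t) - ∫ t in Ioo p q, L u 0 t))
        (𝓝[>] 0) (𝓝 (∫ t in Ioo p q, firstVariation m g u (c t) (deriv c t) (φ t)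
          (deriv φ t))) := by
    intro u D K p q hT hsub hu hD
    obtain ⟨A, hA⟩ := h.exists_norm_deriv_le hm arc har hrb hT hu (hsub.trans hsubr)
      fun t ht ↦ by simpa using hD 0 ⟨le_rfl, hs₀.le⟩ t ht
    have hC₁ : ∀ᵐ t ∂volume.restrict (Ioo p q), ‖deriv φ t‖ ≤ max C C' :=
      (ae_mono (Measure.restrict_mono hsub le_rfl)
        (hC.mono fun t ht ↦ ht.trans (le_max_left _ _)))
    constructor
    · intro s hs
      refine hT.integrableOn_lagrangian hm.le (A := A + |s| * max C C')
        ((hcc.mono hsub).add ((hφc.mono hsub).const_smul s)) (hD s hs)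
        ((aestronglyMeasurable_deriv _ _).add ((aestronglyMeasurable_deriv _ _).const_smul s)) ?_
      filter_upwards [hA, hC₁] with t h1 h2
      refine (norm_add_le _ _).trans ?_
      rw [norm_smul, Real.norm_eq_abs]
      gcongr
    · have := hT.tendsto_action_quotient (e := e) hm.le (hcc.mono hsub) (hφc.mono hsub)
        (aestronglyMeasurable_deriv c _) (aestronglyMeasurable_deriv φ _) hA
        (fun t ht ↦ (hC' t (Ioo_subset_Icc_self (hsub ht))).trans (le_max_right C C')) hC₁ hs₀ hD
      simpa only [hL, zero_smul, add_zero] using this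
  obtain ⟨hi₁, hlim₁⟩ := hpiece u₁ D₁ K₁ t₁ t₀ h₁ hsub₁ hu₁ hD₁
  obtain ⟨hi₂, hlim₂⟩ := hpiece u₂ D₂ K₂ t₀ t₂ h₂ hsub₂ hu₂ hD₂
  have hset : (Ioo t₁ t₂ : Set ℝ) =ᵐ[volume] (Ioo t₁ t₀ ∪ Ioo t₀ t₂ : Set ℝ) := by
    have h1 : ∀ᵐ t : ℝ, t ≠ t₀ := by simp [ae_iff, measure_singleton]
    filter_upwards [h1] with t ht
    refine propext ⟨fun hmem ↦ ?_, fun hmem ↦ hmem.elim (fun h ↦ hsub₁ h) fun h ↦ hsub₂ h⟩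
    rcases lt_or_gt_of_ne ht with h | h
    · exact Or.inl ⟨hmem.1, h⟩
    · exact Or.inr ⟨h, hmem.2⟩
  have hdisj : Disjoint (Ioo t₁ t₀) (Ioo t₀ t₂) :=
    Set.disjoint_left.2 fun t h1 h2 ↦ absurd h1.2 (not_lt.2 h2.1.le)
  set u : F → ℝ := fun y ↦ U (Ψ.symm y) with hu
  have hfull : ∀ s ∈ Icc 0 s₀, IntegrableOn (fun t ↦ L u s t) (Ioo t₁ t₂) ∧
      ∫ t in Ioo t₁ t₂, L u s t = (∫ t in Ioo t₁ t₀, L u₁ s t) + ∫ t in Ioo t₀ t₂, L u₂ s t := by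
    intro s hs
    have e1 : ∀ t ∈ Ioo t₁ t₀, L u s t = L u₁ s t := fun t ht ↦ by
      have h1 : u (c t + s • φ t) = u₁ (c t + s • φ t) := hu₁ _ (hD₁ s hs t ht)
      simp only [hL, lagrangian, h1]
    have e2 : ∀ t ∈ Ioo t₀ t₂, L u s t = L u₂ s t := fun t ht ↦ by
      have h1 : u (c t + s • φ t) = u₂ (c t + s • φ t) := hu₂ _ (hD₂ s hs t ht)
      simp only [hL, lagrangian, h1]
    have j1 : IntegrableOn (fun t ↦ L u s t) (Ioo t₁ t₀) :=
      (hi₁ s hs).congr_fun (fun t ht ↦ (e1 t ht).symm) measurableSet_Ioo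
    have j2 : IntegrableOn (fun t ↦ L u s t) (Ioo t₀ t₂) :=
      (hi₂ s hs).congr_fun (fun t ht ↦ (e2 t ht).symm) measurableSet_Ioo
    refine ⟨(j1.union j2).congr_set_ae hset, ?_⟩
    rw [setIntegral_congr_set hset, setIntegral_union hdisj measurableSet_Ioo j1 j2,
      setIntegral_congr_fun measurableSet_Ioo e1, setIntegral_congr_fun measurableSet_Ioo e2]
  have hmin : ∀ s ∈ Ioc 0 s₀, ∫ t in Ioo t₁ t₂, L u 0 t ≤ ∫ t in Ioo t₁ t₂, L u s t := by
    intro s hs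
    have hs' := Ioc_subset_Icc_self hs
    have h0 : (0 : ℝ) ∈ Icc 0 s₀ := ⟨le_rfl, hs₀.le⟩
    have hcs : AbsolutelyContinuousOnInterval (fun t ↦ c t + s • φ' t) r₁ r₂ :=
      arc.ac.fun_add (hφ'ac.const_smul s)
    have hΨ : ∀ t ∈ Icc r₁ r₂, c t + s • φ' t ∈ Ψ.target := by
      intro t ht
      by_cases hmem : t ∈ Ioo t₁ t₂
      · rw [hφ'eq (Ioo_subset_Icc_self hmem)]
        exact (hV s hs' t hmem).1
      · rw [hφ'0 t hmem, smul_zero, add_zero]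
        exact arc.mem_target ht
    have hcongr : ∀ᵐ t ∂volume.restrict (Ioo t₁ t₂), L u s t =
        lagrangian m e g u (c t + s • φ' t) (deriv (fun t ↦ c t + s • φ' t) t) := by
      filter_upwards [hae s, ae_restrict_mem measurableSet_Ioo] with t h1 hmem
      rw [h1, hφ'eq (Ioo_subset_Icc_self hmem)]
    have hL0 : ∀ t, L u 0 t = lagrangian m e g u (c t) (deriv c t) := fun t ↦ by
      simp [hL]
    rw [integral_congr_ae hcongr]
    simp only [hL0]
    refine h.integral_lagrangian_le hm arc har hrb ht₁ ht₂ hcs hΨ ?_ ?_ ?_ ?_ ?_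
    · intro t hmem
      rw [hφ'eq (Ioo_subset_Icc_self hmem)]
      exact (hV s hs' t hmem).2
    · intro t _ hmem
      rw [hφ'0 t hmem, smul_zero, add_zero]
    · intro σ hσ hσγ
      refine hadm s hs σ (fun t hmem ↦ ?_) hσγ
      rw [hσ t hmem, hφ'eq (Ioo_subset_Icc_self hmem)]
    · simpa only [hL0] using (hfull 0 h0).1
    · exact Integrable.congr (hfull s hs').1 hcongr
  have hsum := hlim₁.add hlim₂
  refine ge_of_tendsto hsum ?_
  filter_upwards [Ioc_mem_nhdsGT hs₀] with s hs
  have h1 := hmin s hs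
  rw [(hfull s (Ioc_subset_Icc_self hs)).2, (hfull 0 ⟨le_rfl, hs₀.le⟩).2] at h1
  rw [← mul_add]
  refine mul_nonneg (inv_nonneg.2 hs.1.le) ?_
  linarith

end IsTimedMinimizer

end Minimizer

/-! ### Newton's equation -/

section VectorChart

variable {F : Type*} [NormedAddCommGroup F] [NormedSpace ℝ F]
  {H : Type*} [TopologicalSpace H] {I : ModelWithCorners ℝ F H}
  {M : Type*} [TopologicalSpace M] [ChartedSpace H M]

variable (I) in
/-- The preferred chart at `p`, with values in the model vector space. -/
def vectorChart [I.Boundaryless] (p : M) : OpenPartialHomeomorph M F :=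
  (chartAt H p).trans I.toHomeomorph.toOpenPartialHomeomorph

theorem vectorChart_apply [I.Boundaryless] (p : M) : ⇑(vectorChart I p) = extChartAt I p := rfl

theorem vectorChart_symm [I.Boundaryless] (p : M) :
    ⇑(vectorChart I p).symm = (extChartAt I p).symm := rfl

theorem vectorChart_source [I.Boundaryless] (p : M) :
    (vectorChart I p).source = (extChartAt I p).source := by
  simp [vectorChart]

theorem vectorChart_target [I.Boundaryless] (p : M) :
    (vectorChart I p).target = (extChartAt I p).target := by
  rw [← (vectorChart I p).image_source_eq_target, vectorChart_source, vectorChart_apply,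
    (extChartAt I p).image_source_eq_target]

theorem isSmoothChart_vectorChart [I.Boundaryless] [IsManifold I 2 M] (p : M) :
    IsSmoothChart I (vectorChart I p) where
  contMDiffOn := by
    rw [vectorChart_source, vectorChart_apply, extChartAt_source]
    exact contMDiffOn_extChartAt
  contMDiffOn_symm := by
    rw [vectorChart_target, vectorChart_symm]
    exact contMDiffOn_extChartAt_symm p

theorem mem_vectorChart_source [I.Boundaryless] (p : M) : p ∈ (vectorChart I p).source := by
  rw [vectorChart_source]
  exact mem_extChartAt_source p

/-- The differential on the manifold is the derivative in the preferred chart, because the tangent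
space at `p` is the model space by means of this chart. -/
theorem mfderiv_eq_fderiv_comp_symm [I.Boundaryless] {f : M → ℝ} {p : M}
    (hf : MDifferentiableAt I 𝓘(ℝ, ℝ) f p) :
    (mfderiv I 𝓘(ℝ, ℝ) f p : F →L[ℝ] ℝ) =
      fderiv ℝ (fun y ↦ f ((extChartAt I p).symm y)) (extChartAt I p p) := by
  have h : (mfderiv I 𝓘(ℝ, ℝ) f p : F →L[ℝ] ℝ) =
      fderivWithin ℝ (writtenInExtChartAt I 𝓘(ℝ, ℝ) p f) (range I) (extChartAt I p p) :=
    hf.mfderiv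
  rw [h, ModelWithCorners.Boundaryless.range_eq_univ, fderivWithin_univ]
  rfl

theorem smul_riesz [FiniteDimensional ℝ F] [RiemannianBundle (fun x : M ↦ TangentSpace I x)]
    {x : M} (r : ℝ) (ℓ : TangentSpace I x →L[ℝ] ℝ) :
    r • riesz I ℓ = riesz I (r • ℓ) := by
  simp [riesz]

theorem neg_riesz [FiniteDimensional ℝ F] [RiemannianBundle (fun x : M ↦ TangentSpace I x)]
    {x : M} (ℓ : TangentSpace I x →L[ℝ] ℝ) : -riesz I ℓ = riesz I (-ℓ) := by
  simp [riesz]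

theorem IsTestField.neg {φ : ℝ → F} {a b : ℝ} (h : IsTestField φ a b) :
    IsTestField (fun t ↦ -φ t) a b := by
  obtain ⟨C, hC⟩ := h.bounded
  refine ⟨by simpa using h.ac.const_smul (-1 : ℝ), by simp [h.left], by simp [h.right], C, ?_⟩
  filter_upwards [hC] with t ht
  simpa [deriv.fun_neg] using ht

/-- A compact arc in an open set has a neighbourhood, in the sense of bounded perturbations, in the
open set. -/
theorem exists_forall_add_smul_mem {E : Type*} [NormedAddCommGroup E] [NormedSpace ℝ E]
    {c φ : ℝ → E} {t₁ t₂ : ℝ} {D : Set E} (hD : IsOpen D) (hc : ContinuousOn c (Icc t₁ t₂))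
    (hφ : ContinuousOn φ (Icc t₁ t₂)) (hcD : MapsTo c (Icc t₁ t₂) D) :
    ∃ s₀ > (0 : ℝ), ∀ s ∈ Icc 0 s₀, ∀ t ∈ Icc t₁ t₂, c t + s • φ t ∈ D := by
  obtain ⟨C, hC⟩ := isCompact_Icc.exists_bound_of_continuousOn hφ
  obtain ⟨δ, hδ, hthick⟩ := (isCompact_Icc.image_of_continuousOn hc).exists_thickening_subset_open
    hD hcD.image_subset
  refine ⟨δ / (|C| + 1), by positivity, fun s hs t ht ↦ hthick ?_⟩
  rw [Metric.mem_thickening_iff]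
  refine ⟨c t, mem_image_of_mem _ ht, ?_⟩
  rw [dist_eq_norm, add_sub_cancel_left, norm_smul, Real.norm_eq_abs]
  have h1 : |s| ≤ δ / (|C| + 1) := (abs_of_nonneg hs.1).trans_le hs.2
  calc |s| * ‖φ t‖ ≤ δ / (|C| + 1) * |C| := by
        gcongr
        exact (hC t ht).trans (le_abs_self C)
    _ < δ / (|C| + 1) * (|C| + 1) := by
        gcongr
        linarith
    _ = δ := by field_simp

end VectorChart

section Newton

variable {F : Type*} [NormedAddCommGroup F] [NormedSpace ℝ F] [FiniteDimensional ℝ F]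
  {H : Type*} [TopologicalSpace H] {I : ModelWithCorners ℝ F H}
  {M : Type*} [TopologicalSpace M] [ChartedSpace H M] [IsManifold I 2 M]
  [RiemannianBundle (fun x : M ↦ TangentSpace I x)]

/-- The metric in a chart, together with a potential of class `C¹`, is tame on small balls. -/
theorem IsSmoothChart.exists_isTame_ball
    [IsContMDiffRiemannianBundle I 1 F (fun x : M ↦ TangentSpace I x)]
    {Ψ : OpenPartialHomeomorph M F} (hΨ : IsSmoothChart I Ψ)
    {y₀ : F} (hy₀ : y₀ ∈ Ψ.target) {u : F → ℝ} (hu : ContDiffAt ℝ 1 u y₀) {N : Set F}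
    (hN : N ∈ 𝓝 y₀) :
    ∃ ρ > 0, ∃ K : ℝ, Metric.ball y₀ ρ ⊆ Ψ.target ∩ N ∧
      IsTame (pullMetric I Ψ.symm) u (Metric.ball y₀ ρ) K := by
  obtain ⟨ρ₁, hρ₁, K₁, hsub, hK₁⟩ := hΨ.exists_ball_metric_bounds hy₀
  have h1 : ∀ᶠ y in 𝓝 y₀, ‖fderiv ℝ u y‖ < ‖fderiv ℝ u y₀‖ + 1 :=
    (hu.continuousAt_fderiv (by simp)).norm.eventually_lt continuousAt_const (lt_add_one _)
  have h2 : ∀ᶠ y in 𝓝 y₀, |u y| < |u y₀| + 1 :=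
    hu.continuousAt.abs.eventually_lt continuousAt_const (lt_add_one _)
  have h3 : ∀ᶠ y in 𝓝 y₀, ContDiffAt ℝ 1 u y := hu.eventually (by simp)
  obtain ⟨ρ₂, hρ₂, hball⟩ := Metric.eventually_nhds_iff_ball.1 ((h1.and h2).and (h3.and hN))
  set K := max K₁ (max (‖fderiv ℝ u y₀‖ + 1) (|u y₀| + 1)) with hK
  have hin₁ : ∀ y ∈ Metric.ball y₀ (min ρ₁ ρ₂), y ∈ Metric.ball y₀ ρ₁ := fun y hy ↦
    Metric.ball_subset_ball (min_le_left _ _) hy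
  have hin₂ : ∀ y ∈ Metric.ball y₀ (min ρ₁ ρ₂), y ∈ Metric.ball y₀ ρ₂ := fun y hy ↦
    Metric.ball_subset_ball (min_le_right _ _) hy
  refine ⟨min ρ₁ ρ₂, lt_min hρ₁ hρ₂, K, fun y hy ↦ ⟨hsub (hin₁ y hy), (hball y (hin₂ y hy)).2.2⟩,
    Metric.isOpen_ball, fun y hy ↦ ?_, fun y hy ↦ (hball y (hin₂ y hy)).2.1,
    fun y _ v w ↦ pullMetric_symm _ _ _ _, fun y hy ↦ ?_, fun y hy ↦ ?_, fun y hy ↦ ?_,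
    fun y hy ↦ ?_, fun y hy v ↦ ?_⟩
  · exact hΨ.contDiffOn_pullMetric.contDiffAt (Ψ.open_target.mem_nhds (hsub (hin₁ y hy)))
  · exact (hK₁ y (hin₁ y hy)).1.trans (le_max_left _ _)
  · exact (hK₁ y (hin₁ y hy)).2.1.trans (le_max_left _ _)
  · exact (hball y (hin₂ y hy)).1.1.le.trans ((le_max_left _ _).trans (le_max_right _ _))
  · exact (hball y (hin₂ y hy)).1.2.le.trans ((le_max_right _ _).trans (le_max_right _ _))
  · refine ((hK₁ y (hin₁ y hy)).2.2 v).trans ?_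
    refine mul_le_mul_of_nonneg_right (le_max_left _ _) ?_
    rw [pullMetric_self _ _ rfl]
    positivity

theorem IsTame.integrableOn_firstVariation {m : ℝ} {g : F → F →L[ℝ] F →L[ℝ] ℝ} {u : F → ℝ}
    {D : Set F} {K : ℝ} (h : IsTame g u D K) (hm : 0 ≤ m) {c v φ ζ : ℝ → F} {t₁ t₂ A C C' : ℝ}
    (hc : ContinuousOn c (Ioo t₁ t₂)) (hφ : ContinuousOn φ (Ioo t₁ t₂))
    (hcD : MapsTo c (Ioo t₁ t₂) D)
    (hv : AEStronglyMeasurable v (volume.restrict (Ioo t₁ t₂)))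
    (hζ : AEStronglyMeasurable ζ (volume.restrict (Ioo t₁ t₂)))
    (hvA : ∀ᵐ t ∂volume.restrict (Ioo t₁ t₂), ‖v t‖ ≤ A)
    (hφC : ∀ t ∈ Ioo t₁ t₂, ‖φ t‖ ≤ C)
    (hζC : ∀ᵐ t ∂volume.restrict (Ioo t₁ t₂), ‖ζ t‖ ≤ C') :
    IntegrableOn (fun t ↦ firstVariation m g u (c t) (v t) (φ t) (ζ t)) (Ioo t₁ t₂) := by
  have hφm := hφ.aestronglyMeasurable (μ := volume) measurableSet_Ioo
  have h1 : AEStronglyMeasurable (fun t ↦ g (c t)) (volume.restrict (Ioo t₁ t₂)) :=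
    ContinuousOn.aestronglyMeasurable (fun t ht ↦
      (h.contDiffAt_metric _ (hcD ht)).continuousAt.comp_continuousWithinAt (hc t ht))
      measurableSet_Ioo
  have h2 : AEStronglyMeasurable (fun t ↦ fderiv ℝ g (c t)) (volume.restrict (Ioo t₁ t₂)) :=
    ContinuousOn.aestronglyMeasurable (fun t ht ↦
      ((h.contDiffAt_metric _ (hcD ht)).continuousAt_fderiv (by simp)).comp_continuousWithinAt
        (hc t ht)) measurableSet_Ioo
  have h3 : AEStronglyMeasurable (fun t ↦ fderiv ℝ u (c t)) (volume.restrict (Ioo t₁ t₂)) :=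
    ContinuousOn.aestronglyMeasurable (fun t ht ↦
      ((h.contDiffAt_potential _ (hcD ht)).continuousAt_fderiv (by simp)).comp_continuousWithinAt
        (hc t ht)) measurableSet_Ioo
  have k1 : AEStronglyMeasurable (fun t ↦ g (c t) (v t)) (volume.restrict (Ioo t₁ t₂)) :=
    isBoundedBilinearMap_apply.continuous.comp_aestronglyMeasurable (h1.prodMk hv)
  have k2 : AEStronglyMeasurable (fun t ↦ g (c t) (v t) (ζ t)) (volume.restrict (Ioo t₁ t₂)) :=
    isBoundedBilinearMap_apply.continuous.comp_aestronglyMeasurable (k1.prodMk hζ)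
  have k3 : AEStronglyMeasurable (fun t ↦ fderiv ℝ g (c t) (φ t))
      (volume.restrict (Ioo t₁ t₂)) :=
    isBoundedBilinearMap_apply.continuous.comp_aestronglyMeasurable (h2.prodMk hφm)
  have k4 : AEStronglyMeasurable (fun t ↦ fderiv ℝ g (c t) (φ t) (v t))
      (volume.restrict (Ioo t₁ t₂)) :=
    isBoundedBilinearMap_apply.continuous.comp_aestronglyMeasurable (k3.prodMk hv)
  have k5 : AEStronglyMeasurable (fun t ↦ fderiv ℝ g (c t) (φ t) (v t) (v t))
      (volume.restrict (Ioo t₁ t₂)) :=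
    isBoundedBilinearMap_apply.continuous.comp_aestronglyMeasurable (k4.prodMk hv)
  have k6 : AEStronglyMeasurable (fun t ↦ fderiv ℝ u (c t) (φ t))
      (volume.restrict (Ioo t₁ t₂)) :=
    isBoundedBilinearMap_apply.continuous.comp_aestronglyMeasurable (h3.prodMk hφm)
  refine IntegrableOn.of_bound (by simp)
    (((k2.const_mul m).add (k5.const_mul (m / 2))).sub k6) (m * (K * A * max C C') +
      m / 2 * (K * max C C' * A * A) + K * max C C') ?_
  filter_upwards [hvA, hζC, ae_restrict_mem measurableSet_Ioo] with t h1 h2 ht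
  exact h.abs_firstVariation_le hm (hcD ht) h1 ((hφC t ht).trans (le_max_left _ _))
    (h2.trans (le_max_right _ _))

variable {adm : (ℝ → M) → Prop} {V : Set M} {U : M → ℝ} {e m : ℝ} {γ : ℝ → M} {a b : ℝ}
  {Ψ : OpenPartialHomeomorph M F} {r₁ r₂ t₁ t₂ : ℝ} {u : F → ℝ} {D : Set F} {K : ℝ}

namespace IsTimedMinimizer

/-- The first variation of the action is nonnegative in every admissible direction, for variations
that stay in a region where the potential is tame. -/
theorem integral_firstVariation_nonneg (h : IsTimedMinimizer I adm V U e m γ a b) (hm : 0 < m)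
    (arc : IsChartArc I Ψ γ r₁ r₂) (har : a < r₁) (hrb : r₂ < b) (ht₁ : r₁ < t₁) (ht : t₁ < t₂)
    (ht₂ : t₂ < r₂) (hT : IsTame (pullMetric I Ψ.symm) u D K)
    (hu : ∀ y ∈ D, U (Ψ.symm y) = u y) (hD : ∀ y ∈ D, y ∈ Ψ.target ∧ Ψ.symm y ∈ V)
    (hadm : ∀ σ : ℝ → M, (∀ t ∈ Ioo t₁ t₂, σ t ∈ Ψ.symm '' D) → (∀ t ∉ Ioo t₁ t₂, σ t = γ t) →
      adm σ) {φ : ℝ → F} (hφ : IsTestField φ t₁ t₂) {s₀ : ℝ} (hs₀ : 0 < s₀)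
    (hmem : ∀ s ∈ Icc 0 s₀, ∀ t ∈ Ioo t₁ t₂, Ψ (γ t) + s • φ t ∈ D) :
    IntegrableOn (fun t ↦ firstVariation m (pullMetric I Ψ.symm) u (Ψ (γ t))
        (deriv (fun s ↦ Ψ (γ s)) t) (φ t) (deriv φ t)) (Ioo t₁ t₂) ∧
      0 ≤ ∫ t in Ioo t₁ t₂, firstVariation m (pullMetric I Ψ.symm) u (Ψ (γ t))
        (deriv (fun s ↦ Ψ (γ s)) t) (φ t) (deriv φ t) := by
  have hsub : Icc t₁ t₂ ⊆ Icc r₁ r₂ := Icc_subset_Icc ht₁.le ht₂.le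
  have hsub' : Ioo t₁ t₂ ⊆ Ioo r₁ r₂ := Ioo_subset_Ioo ht₁.le ht₂.le
  have hcD : ∀ t ∈ Ioo t₁ t₂, Ψ (γ t) ∈ D := fun t ht ↦ by
    simpa using hmem 0 ⟨le_rfl, hs₀.le⟩ t ht
  obtain ⟨A, hA⟩ := h.exists_norm_deriv_le hm arc har hrb hT hu hsub' hcD
  set t₀ := (t₁ + t₂) / 2 with ht₀
  have h₁₀ : t₁ < t₀ := by rw [ht₀]; linarith
  have h₀₂ : t₀ < t₂ := by rw [ht₀]; linarith
  have hφc : ContinuousOn φ (Icc t₁ t₂) := by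
    simpa [uIcc_of_le ht.le] using hφ.ac.continuousOn
  have h0 := h.firstVariation_nonneg hm arc har hrb ht₁ h₁₀ h₀₂ ht₂ hT hu hT hu hφ hs₀
    (fun s hs t ht ↦ hD _ (hmem s hs t ht))
    (fun s hs t ht ↦ hmem s hs t ⟨ht.1, ht.2.trans h₀₂⟩)
    (fun s hs t ht ↦ hmem s hs t ⟨h₁₀.trans ht.1, ht.2⟩)
    (fun s hs σ hσ hσγ ↦ hadm σ (fun t ht ↦
      ⟨_, hmem s (Ioc_subset_Icc_self hs) t ht, (hσ t ht).symm⟩) hσγ)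
  obtain ⟨C, hC⟩ := hφ.bounded
  obtain ⟨C', hC'⟩ := isCompact_Icc.exists_bound_of_continuousOn hφc
  have hi := hT.integrableOn_firstVariation hm.le ((arc.continuousOn.mono hsub).mono
      Ioo_subset_Icc_self) (hφc.mono Ioo_subset_Icc_self) hcD
      (aestronglyMeasurable_deriv _ _) (aestronglyMeasurable_deriv _ _) hA
      (fun t ht ↦ hC' t (Ioo_subset_Icc_self ht)) hC
  refine ⟨hi, ?_⟩
  have hint : IntervalIntegrable (fun t ↦ firstVariation m (pullMetric I Ψ.symm) u (Ψ (γ t))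
      (deriv (fun s ↦ Ψ (γ s)) t) (φ t) (deriv φ t)) volume t₁ t₂ :=
    (intervalIntegrable_iff_integrableOn_Ioo_of_le ht.le).2 hi
  have hs : uIcc t₁ t₀ ⊆ uIcc t₁ t₂ := by
    rw [uIcc_of_le h₁₀.le, uIcc_of_le ht.le]
    exact Icc_subset_Icc le_rfl h₀₂.le
  have hs' : uIcc t₀ t₂ ⊆ uIcc t₁ t₂ := by
    rw [uIcc_of_le h₀₂.le, uIcc_of_le ht.le]
    exact Icc_subset_Icc h₁₀.le le_rfl
  have := intervalIntegral.integral_add_adjacent_intervals (hint.mono_set hs)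
    (hint.mono_set hs')
  simp only [intervalIntegral.integral_of_le, h₁₀.le, h₀₂.le, ht.le,
    integral_Ioc_eq_integral_Ioo] at this
  linarith

/-- The Euler-Lagrange equation in a chart, on a piece of the path that can be varied freely. -/
theorem eulerLagrange (h : IsTimedMinimizer I adm V U e m γ a b) (hm : 0 < m)
    (arc : IsChartArc I Ψ γ r₁ r₂) (har : a < r₁) (hrb : r₂ < b) (ht₁ : r₁ < t₁) (ht : t₁ < t₂)
    (ht₂ : t₂ < r₂) (hT : IsTame (pullMetric I Ψ.symm) u D K)
    (hu : ∀ y ∈ D, U (Ψ.symm y) = u y) (hD : ∀ y ∈ D, y ∈ Ψ.target ∧ Ψ.symm y ∈ V)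
    (hcD : ∀ t ∈ Icc t₁ t₂, Ψ (γ t) ∈ D)
    (hadm : ∀ σ : ℝ → M, (∀ t ∈ Ioo t₁ t₂, σ t ∈ Ψ.symm '' D) → (∀ t ∉ Ioo t₁ t₂, σ t = γ t) →
      adm σ) :
    ContDiffOn ℝ 2 (fun s ↦ Ψ (γ s)) (Ioo t₁ t₂) ∧ ∀ t ∈ Ioo t₁ t₂,
      HasDerivAt (fun s ↦ m • pullMetric I Ψ.symm (Ψ (γ s)) (deriv (fun s ↦ Ψ (γ s)) s))
        (force m (pullMetric I Ψ.symm) u (Ψ (γ t)) (deriv (fun s ↦ Ψ (γ s)) t)) t := by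
  have hsub : Icc t₁ t₂ ⊆ Icc r₁ r₂ := Icc_subset_Icc ht₁.le ht₂.le
  obtain ⟨A, hA⟩ := h.exists_norm_deriv_le hm arc har hrb hT hu
    (Ioo_subset_Ioo ht₁.le ht₂.le) fun t h ↦ hcD t (Ioo_subset_Icc_self h)
  have hcac : AbsolutelyContinuousOnInterval (fun s ↦ Ψ (γ s)) t₁ t₂ :=
    arc.ac.mono (by rwa [uIcc_of_le ht.le, uIcc_of_le arc.lt.le])
  refine hT.eulerLagrange hm ht hcac hcD hA fun φ hφ ↦ ?_
  have key : ∀ φ : ℝ → F, IsTestField φ t₁ t₂ →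
      0 ≤ ∫ t in Ioo t₁ t₂, firstVariation m (pullMetric I Ψ.symm) u (Ψ (γ t))
        (deriv (fun s ↦ Ψ (γ s)) t) (φ t) (deriv φ t) := by
    intro φ hφ
    have hφc : ContinuousOn φ (Icc t₁ t₂) := by
      simpa [uIcc_of_le ht.le] using hφ.ac.continuousOn
    obtain ⟨s₀, hs₀, hmem⟩ := exists_forall_add_smul_mem hT.isOpen (arc.continuousOn.mono hsub)
      hφc hcD
    exact (h.integral_firstVariation_nonneg hm arc har hrb ht₁ ht ht₂ hT hu hD hadm hφ hs₀
      fun s hs t ht ↦ hmem s hs t (Ioo_subset_Icc_self ht)).2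
  refine le_antisymm ?_ (key φ hφ)
  have h1 := key _ hφ.neg
  have h2 : ∀ t, firstVariation m (pullMetric I Ψ.symm) u (Ψ (γ t))
        (deriv (fun s ↦ Ψ (γ s)) t) (-φ t) (deriv (fun t ↦ -φ t) t) =
      -firstVariation m (pullMetric I Ψ.symm) u (Ψ (γ t))
        (deriv (fun s ↦ Ψ (γ s)) t) (φ t) (deriv φ t) := fun t ↦ by
    simp only [firstVariation, deriv.fun_neg, map_neg, neg_apply]
    ring
  simp only [h2, integral_neg] at h1
  linarith

end IsTimedMinimizer

/-- Newton's equation for a path which can be varied freely as long as it runs in `W`. -/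
theorem IsTimedMinimizer.solvesNewton [I.Boundaryless]
    [IsContMDiffRiemannianBundle I 1 F (fun x : M ↦ TangentSpace I x)]
    (h : IsTimedMinimizer I adm V U e m γ a b) (hm : 0 < m) {W : Set M} (hW : IsOpen W)
    (hWV : W ⊆ V) {u : M → ℝ} (hu : ContMDiffOn I 𝓘(ℝ, ℝ) 1 u W) (huU : EqOn u U W) {α β : ℝ}
    (hαβ : Ioo α β ⊆ Ioo a b) (hγ : MapsTo γ (Ioo α β) W)
    (hadm : ∀ σ : ℝ → M, (∀ t ∈ Ioo α β, σ t ∈ W) → (∀ t ∉ Ioo α β, σ t = γ t) → adm σ) :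
    SolvesNewton I m u γ α β := by
  have key : ∀ t ∈ Ioo α β, ContMDiffAt 𝓘(ℝ, ℝ) I 2 γ t ∧
      m • covariantAcceleration I γ t = -grad I u (γ t) := by
    intro t ht
    set p := γ t with hp
    set Ψ := vectorChart I p with hΨdef
    have hΨ : IsSmoothChart I Ψ := isSmoothChart_vectorChart p
    have hsrc : p ∈ Ψ.source := mem_vectorChart_source p
    have hup : ContMDiffAt I 𝓘(ℝ, ℝ) 1 u p := hu.contMDiffAt (hW.mem_nhds (hγ ht))
    have hu' : ContDiffAt ℝ 1 (fun y ↦ u (Ψ.symm y)) (Ψ p) := by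
      have h1 : ContMDiffAt 𝓘(ℝ, F) I 2 Ψ.symm (Ψ p) :=
        hΨ.contMDiffOn_symm.contMDiffAt (Ψ.open_target.mem_nhds (Ψ.map_source hsrc))
      have h2 : ContMDiffAt I 𝓘(ℝ, ℝ) 1 u (Ψ.symm (Ψ p)) := by rwa [Ψ.left_inv hsrc]
      exact (h2.comp _ (h1.of_le (by norm_num))).contDiffAt
    have hN : Ψ.symm ⁻¹' W ∈ 𝓝 (Ψ p) :=
      (Ψ.continuousAt_symm (Ψ.map_source hsrc)).preimage_mem_nhds
        (by rw [Ψ.left_inv hsrc]; exact hW.mem_nhds (hγ ht))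
    obtain ⟨ρ, hρ, K, hball, hT⟩ := hΨ.exists_isTame_ball (Ψ.map_source hsrc) hu' hN
    have hγt : ContinuousAt γ t :=
      h.ac.1.continuousAt (Icc_mem_nhds (hαβ ht).1 (hαβ ht).2)
    have hN' : (fun s ↦ Ψ (γ s)) ⁻¹' Metric.ball (Ψ p) ρ ∩ Ioo α β ∈ 𝓝 t :=
      inter_mem (((Ψ.continuousAt hsrc).comp (f := γ) hγt).preimage_mem_nhds
        (Metric.ball_mem_nhds _ hρ)) (isOpen_Ioo.mem_nhds ht)
    obtain ⟨δ, hδ, hsub, arc⟩ := h.ac.exists_isChartArc (hαβ ht) hΨ hsrc hN'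
    have hlo := (hsub ⟨le_rfl, by linarith⟩).2.1
    have hhi := (hsub ⟨by linarith, le_rfl⟩).2.2
    have hsmall : Ioo (t - δ / 2) (t + δ / 2) ⊆ Ioo α β := fun s hs ↦
      (hsub ⟨by linarith [hs.1], by linarith [hs.2]⟩).1.2
    obtain ⟨hC2, hEL⟩ := h.eulerLagrange hm arc hlo hhi (t₁ := t - δ / 2) (t₂ := t + δ / 2)
      (by linarith) (by linarith) (by linarith) hT
      (fun y hy ↦ (huU (hball hy).2).symm) (fun y hy ↦ ⟨(hball hy).1, hWV (hball hy).2⟩)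
      (fun s hs ↦ (hsub ⟨by linarith [hs.1], by linarith [hs.2]⟩).1.1)
      (fun σ hσ hσγ ↦ by
        refine hadm σ (fun s hs ↦ ?_) fun s hs ↦ hσγ s fun hs' ↦ hs (hsmall hs')
        by_cases hs' : s ∈ Ioo (t - δ / 2) (t + δ / 2)
        · obtain ⟨y, hy, hys⟩ := hσ s hs'
          rw [← hys]
          exact (hball hy).2
        · rw [hσγ s hs']
          exact hγ hs)
    have htmem : t ∈ Ioo (t - δ / 2) (t + δ / 2) := ⟨by linarith, by linarith⟩
    constructor
    · have h1 : ContMDiffAt 𝓘(ℝ, ℝ) 𝓘(ℝ, F) 2 (fun s ↦ Ψ (γ s)) t :=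
        (hC2.contDiffAt (isOpen_Ioo.mem_nhds htmem)).contMDiffAt
      have h2 : ContMDiffAt 𝓘(ℝ, F) I 2 Ψ.symm (Ψ (γ t)) :=
        hΨ.contMDiffOn_symm.contMDiffAt (Ψ.open_target.mem_nhds (Ψ.map_source hsrc))
      refine (h2.comp t h1).congr_of_eventuallyEq ?_
      filter_upwards [hγt (Ψ.open_source.mem_nhds hsrc)] with s hs using (Ψ.left_inv hs).symm
    · have h1 := hT.smul_accelerationForm_eq hC2 htmem (Metric.mem_ball_self hρ) (hEL t htmem)
      have h2 := mfderiv_eq_fderiv_comp_symm (hup.mdifferentiableAt (by simp))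
      have h3 := h1.trans (congrArg Neg.neg h2.symm)
      exact (smul_riesz (x := p) m _).trans
        ((congrArg (riesz I (x := p)) h3).trans (neg_riesz (x := p) _).symm)
  exact ⟨fun t ht ↦ (key t ht).1.contMDiffWithinAt, fun t ht ↦ (key t ht).2⟩

end Newton

/-! ### Charts that flatten the hypersurface -/

section FlatChart

variable {F : Type*} [NormedAddCommGroup F] [NormedSpace ℝ F] [FiniteDimensional ℝ F]

/-- A scalar function `f` with nonzero differential `λ` at `y₀` becomes equal to `λ` after a local
change of coordinates, which sends `y₀` to `0` if `f y₀ = 0`. -/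
theorem exists_openPartialHomeomorph_straighten {f : F → ℝ} {y₀ : F} (hf : ContDiffAt ℝ 2 f y₀)
    (hf0 : f y₀ = 0) (hf' : fderiv ℝ f y₀ ≠ 0) :
    ∃ Θ : OpenPartialHomeomorph F F, y₀ ∈ Θ.source ∧ Θ y₀ = 0 ∧ ContDiffAt ℝ 2 Θ y₀ ∧
      ContDiffAt ℝ 2 Θ.symm 0 ∧ ∀ y, fderiv ℝ f y₀ (Θ y) = f y := by
  set l := fderiv ℝ f y₀ with hl
  obtain ⟨b, hb⟩ : ∃ b, l b = 1 := by
    obtain ⟨b, hb⟩ : ∃ b, l b ≠ 0 := by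
      by_contra! h
      exact hf' (ContinuousLinearMap.ext h)
    exact ⟨(l b)⁻¹ • b, by simp [hb]⟩
  set θ : F → F := fun y ↦ (y - y₀) + (f y - l (y - y₀)) • b with hθ
  have hθc : ContDiffAt ℝ 2 θ y₀ := by
    have h1 : ContDiffAt ℝ 2 (fun y : F ↦ y - y₀) y₀ := contDiffAt_id.sub contDiffAt_const
    exact h1.add ((hf.sub (l.contDiff.contDiffAt.comp _ h1)).smul contDiffAt_const)
  have hθ' : HasFDerivAt θ ((ContinuousLinearEquiv.refl ℝ F : F ≃L[ℝ] F) : F →L[ℝ] F) y₀ := by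
    have h1 : HasFDerivAt (fun y : F ↦ y - y₀) (ContinuousLinearMap.id ℝ F) y₀ :=
      (hasFDerivAt_id y₀).sub_const y₀
    have h2 : HasFDerivAt f l y₀ := (hf.differentiableAt (by simp)).hasFDerivAt
    have h3 := h1.add ((h2.sub (l.hasFDerivAt.comp y₀ h1)).smul_const b)
    convert! h3 using 1
    ext v
    simp
  have hθ0 : θ y₀ = 0 := by simp [hθ, hf0]
  refine ⟨hθc.toOpenPartialHomeomorph θ hθ' (by simp),
    hθc.mem_toOpenPartialHomeomorph_source hθ' (by simp), hθ0, hθc, ?_, fun y ↦ ?_⟩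
  · have h := hθc.to_localInverse hθ' (by simp)
    rw [hθ0] at h
    exact h
  · simp [hθ, hb]

variable {H : Type*} [TopologicalSpace H] {I : ModelWithCorners ℝ F H}
  {M : Type*} [TopologicalSpace M] [ChartedSpace H M] [IsManifold I 2 M]

/-- A smooth hypersurface is a hyperplane in a suitable chart, obtained by straightening a defining
function. -/
theorem IsSmoothHypersurface.exists_isSmoothChart [I.Boundaryless] {S : Set M}
    (hS : IsSmoothHypersurface I S) {p : M} (hp : p ∈ S) :
    ∃ (Ψ : OpenPartialHomeomorph M F) (l : F →L[ℝ] ℝ), IsSmoothChart I Ψ ∧ p ∈ Ψ.source ∧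
      Ψ p = 0 ∧ l ≠ 0 ∧ ∀ x ∈ Ψ.source, x ∈ S ↔ l (Ψ x) = 0 := by
  obtain ⟨W, f, hW, hpW, hf, hf', hSW⟩ := hS p hp
  have hfp : ContMDiffAt I 𝓘(ℝ, ℝ) 2 f p :=
    (hf.contMDiffAt (hW.mem_nhds hpW)).of_le ENat.LEInfty.out
  set Φ := vectorChart I p with hΦdef
  have hΦ : IsSmoothChart I Φ := isSmoothChart_vectorChart p
  have hsrc : p ∈ Φ.source := mem_vectorChart_source p
  have hΦs : ContMDiffAt 𝓘(ℝ, F) I 2 Φ.symm (Φ p) :=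
    hΦ.contMDiffOn_symm.contMDiffAt (Φ.open_target.mem_nhds (Φ.map_source hsrc))
  set f' : F → ℝ := fun y ↦ f (Φ.symm y) with hf'def
  have hfc : ContDiffAt ℝ 2 f' (Φ p) := by
    have h2 : ContMDiffAt I 𝓘(ℝ, ℝ) 2 f (Φ.symm (Φ p)) := by rwa [Φ.left_inv hsrc]
    exact (h2.comp _ hΦs).contDiffAt
  have hf'0 : f' (Φ p) = 0 := by
    have : p ∈ {q ∈ W | f q = 0} := hSW ▸ ⟨hp, hpW⟩
    simpa [hf'def, Φ.left_inv hsrc] using this.2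
  have hfd : fderiv ℝ f' (Φ p) ≠ 0 := by
    intro h0
    exact hf' ((mfderiv_eq_fderiv_comp_symm (hfp.mdifferentiableAt (by simp))).trans h0)
  obtain ⟨Θ, hΘ, hΘ0, hΘc, hΘs, hΘf⟩ := exists_openPartialHomeomorph_straighten hfc hf'0 hfd
  set Ψ₀ := Φ.trans Θ with hΨ₀
  have hp₀ : p ∈ Ψ₀.source := by
    rw [hΨ₀, OpenPartialHomeomorph.trans_source]
    exact ⟨hsrc, hΘ⟩
  have hΨp : Ψ₀ p = 0 := hΘ0
  have h1 : ContMDiffAt I 𝓘(ℝ, F) 2 Ψ₀ p :=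
    hΘc.contMDiffAt.comp p (hΦ.contMDiffOn.contMDiffAt (Φ.open_source.mem_nhds hsrc))
  have h2 : ContMDiffAt 𝓘(ℝ, F) I 2 Ψ₀.symm (Ψ₀ p) := by
    rw [hΨp]
    have h3 : ContMDiffAt 𝓘(ℝ, F) I 2 Φ.symm (Θ.symm 0) := by
      rwa [← hΘ0, Θ.left_inv hΘ]
    exact h3.comp 0 hΘs.contMDiffAt
  set T : Set M := {x | x ∈ W ∧ ContMDiffAt I 𝓘(ℝ, F) 2 Ψ₀ x ∧
    ContMDiffAt 𝓘(ℝ, F) I 2 Ψ₀.symm (Ψ₀ x)} with hT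
  have hTp : T ∈ 𝓝 p := by
    have e1 := (contMDiffAt_iff_contMDiffAt_nhds (by simp)).1 h1
    have e2 := (Ψ₀.continuousAt hp₀).eventually ((contMDiffAt_iff_contMDiffAt_nhds (by simp)).1 h2)
    filter_upwards [hW.mem_nhds hpW, e1, e2] with x hx1 hx2 hx3 using ⟨hx1, hx2, hx3⟩
  have hTi : ∀ x ∈ (Ψ₀.restr T).source, x ∈ Ψ₀.source ∧ x ∈ T := fun x hx ↦
    ⟨hx.1, interior_subset hx.2⟩
  refine ⟨Ψ₀.restr T, fderiv ℝ f' (Φ p), ⟨fun x hx ↦ ?_, fun y hy ↦ ?_⟩,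
    ⟨hp₀, mem_interior_iff_mem_nhds.2 hTp⟩, hΨp, hfd, fun x hx ↦ ?_⟩
  · exact ((hTi x hx).2).2.1.contMDiffWithinAt
  · have h3 := hTi _ ((Ψ₀.restr T).map_target hy)
    have h4 : Ψ₀ ((Ψ₀.restr T).symm y) = y := (Ψ₀.restr T).right_inv hy
    have h5 := h3.2.2.2
    rw [h4] at h5
    exact h5.contMDiffWithinAt
  · obtain ⟨hx1, hxW, -⟩ := hTi x hx
    have hΦx : x ∈ Φ.source := by
      rw [hΨ₀, OpenPartialHomeomorph.trans_source] at hx1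
      exact hx1.1
    have h3 : fderiv ℝ f' (Φ p) (Ψ₀ x) = f x := by
      refine (hΘf (Φ x)).trans ?_
      simp only [hf'def, Φ.left_inv hΦx]
    change _ ↔ fderiv ℝ f' (Φ p) (Ψ₀ x) = 0
    rw [h3]
    constructor
    · intro hxS
      have : x ∈ {q ∈ W | f q = 0} := hSW ▸ ⟨hxS, hxW⟩
      exact this.2
    · intro h0
      have : x ∈ S ∩ W := hSW ▸ ⟨hxW, h0⟩
      exact this.1

variable (I) in
/-- Near the point with coordinates `0`, the chart `Ψ` maps `S` to the hyperplane `l = 0`, and the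
regions `V₁`, `V₂` on its two sides to the half-spaces `l < 0` and `0 < l`. -/
structure IsFlatChart (V V₁ V₂ S : Set M) (Ψ : OpenPartialHomeomorph M F) (l : F →L[ℝ] ℝ) (ρ : ℝ) :
    Prop where
  chart : IsSmoothChart I Ψ
  pos : 0 < ρ
  ball_subset : Metric.ball 0 ρ ⊆ Ψ.target
  mem : ∀ y ∈ Metric.ball (0 : F) ρ, Ψ.symm y ∈ V
  mem_hypersurface : ∀ y ∈ Metric.ball (0 : F) ρ, Ψ.symm y ∈ S ↔ l y = 0
  mem_left : ∀ y ∈ Metric.ball (0 : F) ρ, Ψ.symm y ∈ V₁ ↔ l y < 0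
  mem_right : ∀ y ∈ Metric.ball (0 : F) ρ, Ψ.symm y ∈ V₂ ↔ 0 < l y

/-- A point of the hypersurface adherent to both sides has a flat chart. Each of the two halves of a
small ball, being connected, lies on one side. -/
theorem IsSmoothHypersurface.exists_isFlatChart [I.Boundaryless] {V V₁ V₂ S : Set M} (hV : IsOpen V)
    (hV₁ : IsOpen V₁) (hV₂ : IsOpen V₂) (hdisj : Disjoint V₁ V₂)
    (hS : IsSmoothHypersurface I S) (hVS : V \ S = V₁ ∪ V₂) {p : M} (hp : p ∈ S) (hpV : p ∈ V)
    (hp₁ : p ∈ closure V₁) (hp₂ : p ∈ closure V₂) :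
    ∃ (Ψ : OpenPartialHomeomorph M F) (l : F →L[ℝ] ℝ) (ρ : ℝ),
      p ∈ Ψ.source ∧ Ψ p = 0 ∧ IsFlatChart I V V₁ V₂ S Ψ l ρ := by
  obtain ⟨Ψ, l, hΨ, hsrc, hΨp, -, hSl⟩ := hS.exists_isSmoothChart hp
  have h0 : (0 : F) ∈ Ψ.target := hΨp ▸ Ψ.map_source hsrc
  have hsymm0 : Ψ.symm 0 = p := by rw [← hΨp, Ψ.left_inv hsrc]
  have hN : Ψ.target ∩ Ψ.symm ⁻¹' V ∈ 𝓝 (0 : F) :=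
    inter_mem (Ψ.open_target.mem_nhds h0) ((Ψ.continuousAt_symm h0).preimage_mem_nhds
      (by rw [hsymm0]; exact hV.mem_nhds hpV))
  obtain ⟨ρ, hρ, hball⟩ := Metric.mem_nhds_iff.1 hN
  have hside : ∀ l' : F →L[ℝ] ℝ, (∀ y ∈ Metric.ball (0 : F) ρ, 0 < l' y → Ψ.symm y ∉ S) →
      Ψ.symm '' (Metric.ball 0 ρ ∩ {y | 0 < l' y}) ⊆ V₁ ∨
      Ψ.symm '' (Metric.ball 0 ρ ∩ {y | 0 < l' y}) ⊆ V₂ := by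
    intro l' hl'
    refine IsPreconnected.subset_or_subset hV₁ hV₂ hdisj ?_ ?_
    · rintro _ ⟨y, hy, rfl⟩
      rw [← hVS]
      exact ⟨(hball hy.1).2, hl' y hy.1 hy.2⟩
    · refine IsPreconnected.image ?_ _ ((Ψ.continuousOn_symm).mono fun y hy ↦ (hball hy.1).1)
      exact ((convex_ball _ _).inter (convex_halfSpace_gt l'.isLinear 0)).isPreconnected
  have hlS : ∀ y ∈ Metric.ball (0 : F) ρ, Ψ.symm y ∈ S ↔ l y = 0 := fun y hy ↦ by
    rw [hSl _ (Ψ.map_target (hball hy).1), Ψ.right_inv (hball hy).1]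
  have hpos := hside l fun y hy h1 h2 ↦ h1.ne' ((hlS y hy).1 h2)
  have hneg := hside (-l) fun y hy h1 h2 ↦ by
    rw [neg_apply, (hlS y hy).1 h2] at h1
    simp at h1
  have hmeet : ∀ W : Set M, p ∈ closure W → ∃ y ∈ Metric.ball (0 : F) ρ, Ψ.symm y ∈ W := by
    intro W hW
    have hN' : Ψ.source ∩ Ψ ⁻¹' Metric.ball 0 ρ ∈ 𝓝 p :=
      inter_mem (Ψ.open_source.mem_nhds hsrc) ((Ψ.continuousAt hsrc).preimage_mem_nhds
        (by rw [hΨp]; exact Metric.ball_mem_nhds _ hρ))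
    obtain ⟨x, hx, hxW⟩ := mem_closure_iff_nhds.1 hW _ hN'
    exact ⟨Ψ x, hx.2, by rwa [Ψ.left_inv hx.1]⟩
  have hV₁S : ∀ x ∈ V₁, x ∉ S := fun x hx ↦ (hVS.symm.subset (Or.inl hx)).2
  have hV₂S : ∀ x ∈ V₂, x ∉ S := fun x hx ↦ (hVS.symm.subset (Or.inr hx)).2
  have hnot : ∀ x, x ∈ V₁ → x ∉ V₂ := fun x h1 h2 ↦ hdisj.ne_of_mem h1 h2 rfl
  obtain ⟨y₁, hy₁, hy₁V⟩ := hmeet V₁ hp₁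
  obtain ⟨y₂, hy₂, hy₂V⟩ := hmeet V₂ hp₂
  have hn₁ : l y₁ ≠ 0 := fun h ↦ hV₁S _ hy₁V ((hlS _ hy₁).2 h)
  have hn₂ : l y₂ ≠ 0 := fun h ↦ hV₂S _ hy₂V ((hlS _ hy₂).2 h)
  -- the linear form, up to its sign, separates the two sides
  have main : ∃ l' : F →L[ℝ] ℝ, (∀ y, l' y = 0 ↔ l y = 0) ∧
      (∀ y ∈ Metric.ball (0 : F) ρ, l' y < 0 → Ψ.symm y ∈ V₁) ∧
      (∀ y ∈ Metric.ball (0 : F) ρ, 0 < l' y → Ψ.symm y ∈ V₂) := by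
    have himg : ∀ (l' : F →L[ℝ] ℝ) (W : Set M),
        Ψ.symm '' (Metric.ball 0 ρ ∩ {y | 0 < l' y}) ⊆ W →
        ∀ y ∈ Metric.ball (0 : F) ρ, 0 < l' y → Ψ.symm y ∈ W :=
      fun l' W h y hy hly ↦ h ⟨y, ⟨hy, hly⟩, rfl⟩
    rcases hpos with hpos | hpos <;> rcases hneg with hneg | hneg
    · exfalso
      rcases lt_or_gt_of_ne hn₂ with h | h
      · exact hnot _ (himg _ _ hneg _ hy₂ (by simpa using h)) hy₂V
      · exact hnot _ (himg _ _ hpos _ hy₂ h) hy₂V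
    · exact ⟨-l, by simp, fun y hy h ↦ himg _ _ hpos y hy (by simpa using h),
        fun y hy h ↦ himg _ _ hneg y hy h⟩
    · exact ⟨l, by simp, fun y hy h ↦ himg _ _ hneg y hy (by simpa using h),
        fun y hy h ↦ himg _ _ hpos y hy h⟩
    · exfalso
      rcases lt_or_gt_of_ne hn₁ with h | h
      · exact hnot _ hy₁V (himg _ _ hneg _ hy₁ (by simpa using h))
      · exact hnot _ hy₁V (himg _ _ hpos _ hy₁ h)
  obtain ⟨l', hll, hleft, hright⟩ := main
  refine ⟨Ψ, l', ρ, hsrc, hΨp, hΨ, hρ, fun y hy ↦ (hball hy).1, fun y hy ↦ (hball hy).2,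
    fun y hy ↦ by rw [hlS y hy, hll], fun y hy ↦ ⟨fun h ↦ ?_, hleft y hy⟩,
    fun y hy ↦ ⟨fun h ↦ ?_, hright y hy⟩⟩
  · rcases lt_trichotomy (l' y) 0 with h1 | h1 | h1
    · exact h1
    · exact absurd ((hlS y hy).2 ((hll y).1 h1)) (hV₁S _ h)
    · exact absurd (hright y hy h1) (hnot _ h)
  · rcases lt_trichotomy (l' y) 0 with h1 | h1 | h1
    · exact absurd h (hnot _ (hleft y hy h1))
    · exact absurd ((hlS y hy).2 ((hll y).1 h1)) (hV₂S _ h)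
    · exact h1

variable [RiemannianBundle (fun x : M ↦ TangentSpace I x)]

/-- A potential on a convex open set `D` which is of class `C¹` up to the origin, possibly a
boundary point of `D`, is tame on `D` near the origin. Its derivative is bounded there because it is
Lipschitz near the origin. -/
theorem IsSmoothChart.exists_isTame_inter
    [IsContMDiffRiemannianBundle I 1 F (fun x : M ↦ TangentSpace I x)]
    {Ψ : OpenPartialHomeomorph M F} (hΨ : IsSmoothChart I Ψ) (h0 : (0 : F) ∈ Ψ.target)
    {D : Set F} (hD : IsOpen D) (hDc : Convex ℝ D) (hDΨ : D ⊆ Ψ.target) {f : M → ℝ} {Z : Set M}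
    (hf : ContMDiffOn I 𝓘(ℝ, ℝ) 1 f Z) (hpZ : Ψ.symm 0 ∈ Z) (hDZ : MapsTo Ψ.symm D Z) :
    ∃ ρ > 0, ∃ K, IsTame (pullMetric I Ψ.symm) (fun y ↦ f (Ψ.symm y)) (D ∩ Metric.ball 0 ρ) K ∧
      Tendsto (fun y ↦ f (Ψ.symm y)) (𝓝[D] 0) (𝓝 (f (Ψ.symm 0))) := by
  obtain ⟨ρ₁, hρ₁, K₁, hsub, hK₁⟩ := hΨ.exists_ball_metric_bounds h0
  set u : F → ℝ := fun y ↦ f (Ψ.symm y) with hu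
  have hfin : ∀ y, y ∈ Ψ.target → Ψ.symm y ∈ Z → ContDiffWithinAt ℝ 1 u D y := by
    intro y hy hyZ
    have h1 : ContMDiffAt 𝓘(ℝ, F) I 1 Ψ.symm y :=
      (hΨ.contMDiffOn_symm.contMDiffAt (Ψ.open_target.mem_nhds hy)).of_le (by norm_num)
    exact ((hf _ hyZ).comp y h1.contMDiffWithinAt hDZ).contDiffWithinAt
  have hu0 := hfin 0 h0 hpZ
  have hlim : Tendsto u (𝓝[D] 0) (𝓝 (u 0)) := hu0.continuousWithinAt
  obtain ⟨L, t, ht, hL⟩ := hu0.exists_lipschitzOnWith hDc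
  have hbd : ∀ᶠ y in 𝓝[D] 0, |u y| < |u 0| + 1 :=
    hlim.abs.eventually_lt_const (lt_add_one _)
  obtain ⟨ρ₂, hρ₂, hball⟩ := Metric.mem_nhdsWithin_iff.1 (inter_mem ht hbd)
  set K := max K₁ (max L (|u 0| + 1)) with hK
  have hin₁ : ∀ y ∈ D ∩ Metric.ball 0 (min ρ₁ ρ₂), y ∈ Metric.ball 0 ρ₁ := fun y hy ↦
    Metric.ball_subset_ball (min_le_left _ _) hy.2
  have hin₂ : D ∩ Metric.ball 0 (min ρ₁ ρ₂) ⊆ t ∩ {y | |u y| < |u 0| + 1} := fun y hy ↦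
    hball ⟨Metric.ball_subset_ball (min_le_right _ _) hy.2, hy.1⟩
  have hopen : IsOpen (D ∩ Metric.ball (0 : F) (min ρ₁ ρ₂)) := hD.inter Metric.isOpen_ball
  refine ⟨min ρ₁ ρ₂, lt_min hρ₁ hρ₂, K, ⟨hopen, fun y hy ↦ ?_, fun y hy ↦ ?_,
    fun y _ v w ↦ pullMetric_symm _ _ _ _, fun y hy ↦ ?_, fun y hy ↦ ?_, fun y hy ↦ ?_,
    fun y hy ↦ ?_, fun y hy v ↦ ?_⟩, hlim⟩
  · exact hΨ.contDiffOn_pullMetric.contDiffAt (Ψ.open_target.mem_nhds (hDΨ hy.1))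
  · exact (hfin y (hDΨ hy.1) (hDZ hy.1)).contDiffAt (hD.mem_nhds hy.1)
  · exact (hK₁ y (hin₁ y hy)).1.trans (le_max_left _ _)
  · exact (hK₁ y (hin₁ y hy)).2.1.trans (le_max_left _ _)
  · exact (norm_fderiv_le_of_lipschitzOn ℝ (mem_of_superset (hopen.mem_nhds hy)
      fun z hz ↦ (hin₂ hz).1) hL).trans ((le_max_left _ _).trans (le_max_right _ _))
  · have := (hin₂ hy).2
    exact (le_of_lt this).trans ((le_max_right _ _).trans (le_max_right _ _))
  · refine ((hK₁ y (hin₁ y hy)).2.2 v).trans ?_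
    refine mul_le_mul_of_nonneg_right (le_max_left _ _) ?_
    rw [pullMetric_self _ _ rfl]
    positivity

end FlatChart

/-! ### One-sided behaviour at a contact -/

theorem tendsto_clm_apply {X E E' : Type*} [NormedAddCommGroup E] [NormedSpace ℝ E]
    [NormedAddCommGroup E'] [NormedSpace ℝ E'] {L : X → E →L[ℝ] E'} {L₀ : E →L[ℝ] E'} {w : X → E}
    {w₀ : E} {l : Filter X} (hL : Tendsto L l (𝓝 L₀)) (hw : Tendsto w l (𝓝 w₀)) :
    Tendsto (fun t ↦ L t (w t)) l (𝓝 (L₀ w₀)) :=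
  (isBoundedBilinearMap_apply.continuous.tendsto (L₀, w₀)).comp (hL.prodMk_nhds hw)

section Contact

variable {F : Type*} [NormedAddCommGroup F] [NormedSpace ℝ F] [FiniteDimensional ℝ F]
  {H : Type*} [TopologicalSpace H] {I : ModelWithCorners ℝ F H}
  {M : Type*} [TopologicalSpace M] [ChartedSpace H M] [IsManifold I 2 M]
  [RiemannianBundle (fun x : M ↦ TangentSpace I x)]
  {adm : (ℝ → M) → Prop} {V : Set M} {U : M → ℝ} {e m : ℝ} {γ : ℝ → M} {a b : ℝ}
  {Ψ : OpenPartialHomeomorph M F} {r₁ r₂ t₁ t₂ : ℝ} {u : F → ℝ} {D : Set F} {K : ℝ}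

namespace IsTimedMinimizer

/-- A minimizer has no small loop at the origin of a chart inside a cone `D`: contracting the loop
towards the origin decreases the action. -/
theorem false_of_loop (h : IsTimedMinimizer I adm V U e m γ a b) (hm : 0 < m)
    (arc : IsChartArc I Ψ γ r₁ r₂) (har : a < r₁) (hrb : r₂ < b) (ht₁ : r₁ < t₁) (ht : t₁ < t₂)
    (ht₂ : t₂ < r₂) (hT : IsTame (pullMetric I Ψ.symm) u D K)
    (hu : ∀ y ∈ D, U (Ψ.symm y) = u y) (hD : ∀ y ∈ D, y ∈ Ψ.target ∧ Ψ.symm y ∈ V)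
    (hadm : ∀ σ : ℝ → M, (∀ t ∈ Ioo t₁ t₂, σ t ∈ Ψ.symm '' D) → (∀ t ∉ Ioo t₁ t₂, σ t = γ t) →
      adm σ)
    (hcone : ∀ y ∈ D, ∀ s ∈ Ioc (0 : ℝ) 1, s • y ∈ D) {ρ κ : ℝ} (hκ : 0 < κ)
    (hDρ : ∀ y ∈ D, ‖y‖ ≤ ρ) (hKρ : K ^ 2 * ρ ≤ 1) (hgap : ∀ y ∈ D, K * ρ + κ ≤ e - u y)
    (hc : ∀ t ∈ Ioo t₁ t₂, Ψ (γ t) ∈ D) (hc₁ : Ψ (γ t₁) = 0) (hc₂ : Ψ (γ t₂) = 0) : False := by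
  set c : ℝ → F := fun s ↦ Ψ (γ s) with hcdef
  set g := pullMetric I Ψ.symm with hg
  have hsub' : Ioo t₁ t₂ ⊆ Ioo r₁ r₂ := Ioo_subset_Ioo ht₁.le ht₂.le
  obtain ⟨A, hA⟩ := h.exists_norm_deriv_le hm arc har hrb hT hu hsub' hc
  have hcac : AbsolutelyContinuousOnInterval c t₁ t₂ :=
    arc.ac.mono (by
      rw [uIcc_of_le ht.le, uIcc_of_le arc.lt.le]
      exact Icc_subset_Icc ht₁.le ht₂.le)
  -- the variation `-c` contracts the loop to `(1 - s) c`
  have hφ : IsTestField c t₁ t₂ := ⟨hcac, hc₁, hc₂, A, hA⟩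
  obtain ⟨hi, hnn⟩ := h.integral_firstVariation_nonneg hm arc har hrb ht₁ ht ht₂ hT hu hD hadm
    hφ.neg (s₀ := 1 / 2) (by norm_num) (fun s hs t ht ↦ by
      have := hcone _ (hc t ht) (1 - s) ⟨by linarith [hs.2], by linarith [hs.1]⟩
      rwa [sub_smul, one_smul, sub_eq_add_neg, ← smul_neg] at this)
  -- the kinetic term is `-m g(c', c') = -2 (e - u)`; as `K ^ 2 * ρ ≤ 1`, the derivative of the
  -- metric contributes at most `e - u`, and that of the potential at most `K * ρ`
  have hle : ∀ᵐ t ∂volume.restrict (Ioo t₁ t₂),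
      firstVariation m g u (c t) (deriv c t) (-c t) (deriv (fun t ↦ -c t) t) ≤ -κ := by
    filter_upwards [ae_restrict_of_ae (h.ae_energy hm arc har hrb),
      ae_restrict_mem measurableSet_Ioo] with t hE hmem
    have hmD := hc t hmem
    have hE' : m * g (c t) (deriv c t) (deriv c t) = 2 * (e - u (c t)) := by
      rw [← hu _ hmD, arc.symm_apply (Ioo_subset_Icc_self (hsub' hmem))]
      exact hE (hsub' hmem)
    have hK : 0 ≤ K := (norm_nonneg _).trans (hT.norm_metric_le _ hmD)
    have hρ : 0 ≤ ρ := (norm_nonneg _).trans (hDρ _ hmD)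
    have h1 : |fderiv ℝ g (c t) (c t) (deriv c t) (deriv c t)| ≤
        K * ρ * (K * g (c t) (deriv c t) (deriv c t)) := by
      calc _ ≤ ‖fderiv ℝ g (c t) (c t)‖ * ‖deriv c t‖ * ‖deriv c t‖ :=
            (fderiv ℝ g (c t) (c t)).le_opNorm₂ _ _
        _ ≤ (‖fderiv ℝ g (c t)‖ * ‖c t‖) * ‖deriv c t‖ * ‖deriv c t‖ := by
            gcongr
            exact (fderiv ℝ g (c t)).le_opNorm _
        _ = (‖fderiv ℝ g (c t)‖ * ‖c t‖) * ‖deriv c t‖ ^ 2 := by ring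
        _ ≤ K * ρ * (K * g (c t) (deriv c t) (deriv c t)) := by
            gcongr
            · exact hT.norm_fderiv_metric_le _ hmD
            · exact hDρ _ hmD
            · exact hT.sq_norm_le _ hmD _
    have h2 : |fderiv ℝ u (c t) (c t)| ≤ K * ρ := by
      refine ((fderiv ℝ u (c t)).le_opNorm _).trans ?_
      gcongr
      · exact hT.norm_fderiv_potential_le _ hmD
      · exact hDρ _ hmD
    have h3 := hgap _ hmD
    have h4 : m / 2 * (K * ρ * (K * g (c t) (deriv c t) (deriv c t))) =
        K ^ 2 * ρ * (e - u (c t)) := by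
      linear_combination (K ^ 2 * ρ / 2) * hE'
    have h5 : K ^ 2 * ρ * (e - u (c t)) ≤ 1 * (e - u (c t)) := by
      gcongr
      have : 0 ≤ K * ρ := by positivity
      linarith
    have h6 : -(m / 2 * fderiv ℝ g (c t) (c t) (deriv c t) (deriv c t)) ≤
        m / 2 * (K * ρ * (K * g (c t) (deriv c t) (deriv c t))) := by
      rw [← mul_neg]
      gcongr
      exact (neg_le_abs _).trans h1
    simp only [firstVariation, deriv.fun_neg, map_neg, neg_apply]
    linarith [le_abs_self (fderiv ℝ u (c t) (c t))]
  have h1 := integral_mono_ae hi (integrable_const (-κ)) hle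
  rw [integral_const, Measure.real, Measure.restrict_apply_univ, Real.volume_Ioo,
    ENNReal.toReal_ofReal (by linarith), smul_eq_mul] at h1
  have : 0 < (t₂ - t₁) * κ := by
    apply mul_pos _ hκ
    linarith
  linarith

/-- On a piece that can be varied freely, the velocity has limits at the ends of the piece, and the
limits satisfy the conservation of energy. -/
theorem exists_tendsto_deriv [IsContMDiffRiemannianBundle I 1 F (fun x : M ↦ TangentSpace I x)]
    (h : IsTimedMinimizer I adm V U e m γ a b) (hm : 0 < m)
    (arc : IsChartArc I Ψ γ r₁ r₂) (har : a < r₁) (hrb : r₂ < b) (ht₁ : r₁ ≤ t₁)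
    (ht₂ : t₂ ≤ r₂) (hT : IsTame (pullMetric I Ψ.symm) u D K)
    (hu : ∀ y ∈ D, U (Ψ.symm y) = u y) (hD : ∀ y ∈ D, y ∈ Ψ.target ∧ Ψ.symm y ∈ V)
    (hcD : ∀ t ∈ Ioo t₁ t₂, Ψ (γ t) ∈ D)
    (hadm : ∀ σ : ℝ → M, (∀ t ∈ Ioo t₁ t₂, σ t ∈ Ψ.symm '' D) → (∀ t ∉ Ioo t₁ t₂, σ t = γ t) →
      adm σ) {t₀ C : ℝ} (ht₀ : t₀ ∈ Ioo r₁ r₂) (ht₀' : (𝓝[Ioo t₁ t₂] t₀).NeBot)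
    (hC : Tendsto u (𝓝[D] (Ψ (γ t₀))) (𝓝 C)) :
    ContDiffOn ℝ 2 (fun s ↦ Ψ (γ s)) (Ioo t₁ t₂) ∧ (∀ t ∈ Ioo t₁ t₂,
      HasDerivAt (fun s ↦ m • pullMetric I Ψ.symm (Ψ (γ s)) (deriv (fun s ↦ Ψ (γ s)) s))
        (force m (pullMetric I Ψ.symm) u (Ψ (γ t)) (deriv (fun s ↦ Ψ (γ s)) t)) t) ∧
    ∃ v : F, Tendsto (deriv (fun s ↦ Ψ (γ s))) (𝓝[Ioo t₁ t₂] t₀) (𝓝 v) ∧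
      m * pullMetric I Ψ.symm (Ψ (γ t₀)) v v = 2 * (e - C) := by
  set c : ℝ → F := fun s ↦ Ψ (γ s) with hcdef
  set g := pullMetric I Ψ.symm with hg
  have hsub' : Ioo t₁ t₂ ⊆ Ioo r₁ r₂ := Ioo_subset_Ioo ht₁ ht₂
  have hEL : ∀ t ∈ Ioo t₁ t₂, ContDiffAt ℝ 2 c t ∧
      HasDerivAt (fun s ↦ m • g (c s) (deriv c s)) (force m g u (c t) (deriv c t)) t := by
    intro t ht
    obtain ⟨p, hp₁, hp₂⟩ := exists_between ht.1
    obtain ⟨q, hq₁, hq₂⟩ := exists_between ht.2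
    have hsm : Ioo p q ⊆ Ioo t₁ t₂ := Ioo_subset_Ioo hp₁.le hq₂.le
    have := h.eulerLagrange hm arc har hrb (ht₁.trans_lt hp₁) (hp₂.trans hq₁) (hq₂.trans_le ht₂)
      hT hu hD (fun s hs ↦ hcD s ⟨hp₁.trans_le hs.1, hs.2.trans_lt hq₂⟩)
      (fun σ hσ hσγ ↦ by
        refine hadm σ (fun s hs ↦ ?_) fun s hs ↦ hσγ s fun hs' ↦ hs (hsm hs')
        by_cases hs' : s ∈ Ioo p q
        · exact hσ s hs'
        · rw [hσγ s hs']
          exact ⟨c s, hcD s hs, arc.symm_apply (Ioo_subset_Icc_self (hsub' hs))⟩)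
    exact ⟨this.1.contDiffAt (isOpen_Ioo.mem_nhds ⟨hp₂, hq₁⟩), this.2 t ⟨hp₂, hq₁⟩⟩
  have hcC2 : ContDiffOn ℝ 2 c (Ioo t₁ t₂) := fun t ht ↦ (hEL t ht).1.contDiffWithinAt
  refine ⟨hcC2, fun t ht ↦ (hEL t ht).2, ?_⟩
  have hc' : ContinuousOn (deriv c) (Ioo t₁ t₂) :=
    hcC2.continuousOn_deriv_of_isOpen isOpen_Ioo (by norm_num)
  have hcc : ContinuousOn c (Ioo t₁ t₂) := hcC2.continuousOn
  have hgc : ContinuousOn (fun t ↦ g (c t)) (Ioo t₁ t₂) := fun t ht ↦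
    (hT.contDiffAt_metric _ (hcD t ht)).continuousAt.comp_continuousWithinAt (f := c) (hcc t ht)
  have huc : ContinuousOn (fun t ↦ u (c t)) (Ioo t₁ t₂) := fun t ht ↦
    (hT.contDiffAt_potential _ (hcD t ht)).continuousAt.comp_continuousWithinAt (f := c)
      (hcc t ht)
  have henergy : EqOn (fun t ↦ m * g (c t) (deriv c t) (deriv c t)) (fun t ↦ 2 * (e - u (c t)))
      (Ioo t₁ t₂) := by
    refine Measure.eqOn_open_of_ae_eq (μ := volume) ?_ isOpen_Ioo ?_ ?_
    · filter_upwards [ae_restrict_of_ae (h.ae_energy hm arc har hrb),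
        ae_restrict_mem measurableSet_Ioo] with t hE hmem
      rw [← hu _ (hcD t hmem), arc.symm_apply (Ioo_subset_Icc_self (hsub' hmem))]
      exact hE (hsub' hmem)
    · exact continuousOn_const.mul ((hgc.clm_apply hc').clm_apply hc')
    · exact continuousOn_const.mul (continuousOn_const.sub huc)
  set A := √(K * (2 * (|e| + K) / m)) with hA
  have hcA : ∀ t ∈ Ioo t₁ t₂, ‖deriv c t‖ ≤ A := by
    intro t ht
    have h1 : m * g (c t) (deriv c t) (deriv c t) = 2 * (e - u (c t)) := henergy ht
    have h2 := hT.sq_norm_le _ (hcD t ht) (deriv c t)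
    have h3 := hT.abs_potential_le _ (hcD t ht)
    have hK : 0 ≤ K := (abs_nonneg _).trans h3
    refine Real.le_sqrt_of_sq_le (h2.trans ?_)
    gcongr
    rw [le_div_iff₀ hm, mul_comm, h1]
    linarith [neg_abs_le (u (c t)), le_abs_self e]
  -- the momentum is Lipschitz, because the force is bounded
  obtain ⟨P, hP⟩ : ∃ P, Tendsto (fun s ↦ m • g (c s) (deriv c s)) (𝓝[Ioo t₁ t₂] t₀) (𝓝 P) := by
    have hL : LipschitzOnWith (Real.toNNReal (m / 2 * (K * A * A) + K))
        (fun s ↦ m • g (c s) (deriv c s)) (Ioo t₁ t₂) := by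
      refine (convex_Ioo t₁ t₂).lipschitzOnWith_of_nnnorm_hasDerivWithin_le
        (fun t ht ↦ (hEL t ht).2.hasDerivWithinAt) fun t ht ↦ ?_
      rw [← NNReal.coe_le_coe, coe_nnnorm]
      exact (hT.norm_force_le hm.le (hcD t ht) (hcA t ht)).trans (Real.le_coe_toNNReal _)
    obtain ⟨p, hp, hpe⟩ := hL.extend_finite_dimension
    refine ⟨p t₀, ?_⟩
    refine (hp.continuous.continuousAt.tendsto.mono_left nhdsWithin_le_nhds).congr' ?_
    filter_upwards [self_mem_nhdsWithin] with t ht using (hpe ht).symm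
  have hct₀ : Tendsto c (𝓝[Ioo t₁ t₂] t₀) (𝓝 (c t₀)) :=
    ((arc.continuousOn t₀ (Ioo_subset_Icc_self ht₀)).mono_left
      (nhdsWithin_mono _ (hsub'.trans Ioo_subset_Icc_self)))
  have htgt : c t₀ ∈ Ψ.target := arc.mem_target (Ioo_subset_Icc_self ht₀)
  have hgt₀ : Tendsto (fun t ↦ g (c t)) (𝓝[Ioo t₁ t₂] t₀) (𝓝 (g (c t₀))) :=
    ((arc.chart.contDiffOn_pullMetric.continuousOn.continuousAt
      (Ψ.open_target.mem_nhds htgt)).tendsto).comp hct₀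
  -- the velocity is recovered from the momentum by the metric at the fixed point `c t₀`, which may
  -- lie on the boundary of `D`
  obtain ⟨ρ, hρ, K', -, hT'⟩ := arc.chart.exists_isTame_ball htgt
    (contDiffAt_const (c := (0 : ℝ))) univ_mem
  obtain ⟨G, hG⟩ := hT'.exists_equiv_metric (Metric.mem_ball_self hρ)
  have hGv : Tendsto (fun t ↦ g (c t₀) (deriv c t)) (𝓝[Ioo t₁ t₂] t₀) (𝓝 (m⁻¹ • P)) := by
    have h1 : Tendsto (fun t ↦ (g (c t₀) - g (c t)) (deriv c t)) (𝓝[Ioo t₁ t₂] t₀) (𝓝 0) := by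
      refine squeeze_zero_norm' (a := fun t ↦ ‖g (c t₀) - g (c t)‖ * A) ?_ ?_
      · filter_upwards [self_mem_nhdsWithin] with t ht
        refine ((g (c t₀) - g (c t)).le_opNorm _).trans ?_
        gcongr
        exact hcA t ht
      · have := ((tendsto_const_nhds (x := g (c t₀))).sub hgt₀).norm.mul_const A
        simpa using this
    have h2 := (hP.const_smul m⁻¹).add h1
    rw [add_zero] at h2
    refine h2.congr fun t ↦ ?_
    rw [smul_smul, inv_mul_cancel₀ hm.ne', one_smul, sub_apply]
    abel
  have hv : Tendsto (deriv c) (𝓝[Ioo t₁ t₂] t₀) (𝓝 (G.symm (m⁻¹ • P))) := by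
    refine ((G.symm.continuous.tendsto _).comp hGv).congr fun t ↦ ?_
    have : G (deriv c t) = g (c t₀) (deriv c t) := congrArg (fun L ↦ L (deriv c t)) hG
    simp [← this]
  refine ⟨_, hv, ?_⟩
  have hl1 : Tendsto (fun t ↦ m * g (c t) (deriv c t) (deriv c t)) (𝓝[Ioo t₁ t₂] t₀)
      (𝓝 (m * g (c t₀) (G.symm (m⁻¹ • P)) (G.symm (m⁻¹ • P)))) :=
    (tendsto_clm_apply (tendsto_clm_apply hgt₀ hv) hv).const_mul m
  have hcD₀ : Tendsto c (𝓝[Ioo t₁ t₂] t₀) (𝓝[D] (c t₀)) := by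
    refine tendsto_nhdsWithin_iff.2 ⟨hct₀, ?_⟩
    filter_upwards [self_mem_nhdsWithin] with t ht using hcD t ht
  have hl2 : Tendsto (fun t ↦ 2 * (e - u (c t))) (𝓝[Ioo t₁ t₂] t₀) (𝓝 (2 * (e - C))) :=
    ((hC.comp hcD₀).const_sub e).const_mul 2
  refine tendsto_nhds_unique (hl1.congr' ?_) hl2
  filter_upwards [self_mem_nhdsWithin] with t ht using henergy ht

end IsTimedMinimizer

end Contact

/-! ### Variation of the contact point -/

section Corner

variable {F : Type*} [NormedAddCommGroup F] [NormedSpace ℝ F]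

/-- Integration of the first variation along a solution of the Euler-Lagrange equation. -/
theorem integral_firstVariation_eq {m : ℝ} {g : F → F →L[ℝ] F →L[ℝ] ℝ} {u : F → ℝ} {c φ : ℝ → F}
    {x y : ℝ} (hxy : x < y)
    (hp : ∀ t ∈ Ioo x y, HasDerivAt (fun s ↦ m • g (c s) (deriv c s))
      (force m g u (c t) (deriv c t)) t)
    (hφ : ∀ t ∈ Ioo x y, DifferentiableAt ℝ φ t)
    (hint : IntegrableOn (fun t ↦ firstVariation m g u (c t) (deriv c t) (φ t) (deriv φ t))
      (Ioo x y)) {P Q : F →L[ℝ] ℝ} {ξ ζ : F}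
    (hP : Tendsto (fun s ↦ m • g (c s) (deriv c s)) (𝓝[>] x) (𝓝 P))
    (hQ : Tendsto (fun s ↦ m • g (c s) (deriv c s)) (𝓝[<] y) (𝓝 Q))
    (hξ : Tendsto φ (𝓝[>] x) (𝓝 ξ)) (hζ : Tendsto φ (𝓝[<] y) (𝓝 ζ)) :
    ∫ t in Ioo x y, firstVariation m g u (c t) (deriv c t) (φ t) (deriv φ t) = Q ζ - P ξ := by
  rw [← integral_Ioc_eq_integral_Ioo, ← intervalIntegral.integral_of_le hxy.le]
  refine intervalIntegral.integral_eq_sub_of_hasDerivAt_of_tendsto hxy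
    (f := fun t ↦ (m • g (c t) (deriv c t)) (φ t)) (fun t ht ↦ ?_)
    ((intervalIntegrable_iff_integrableOn_Ioo_of_le hxy.le).2 hint)
    (tendsto_clm_apply hP hξ) (tendsto_clm_apply hQ hζ)
  have h1 := (hp t ht).clm_apply (hφ t ht).hasDerivAt
  convert h1 using 1
  rw [firstVariation_eq_add_force, smul_apply, smul_eq_mul]
  ring

/-- The piecewise linear field with value `z` at the instant `t₀` and zeros at `t₀ ± δ`, used as a
variation on `[t₀ - δ, t₀ + δ]`. No truncation is made outside this interval. -/
def hat (t₀ δ : ℝ) (z : F) (t : ℝ) : F := (1 - |t - t₀| / δ) • z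

theorem hat_mem_Icc {t₀ δ t : ℝ} (ht : t ∈ Ioo (t₀ - δ) (t₀ + δ)) : 1 - |t - t₀| / δ ∈ Icc 0 1 := by
  have hδ : 0 < δ := by linarith [ht.1, ht.2]
  have h1 : |t - t₀| ≤ δ := abs_le.2 ⟨by linarith [ht.1], by linarith [ht.2]⟩
  have h2 : |t - t₀| / δ ≤ 1 := (div_le_one hδ).2 h1
  have h3 : 0 ≤ |t - t₀| / δ := by positivity
  exact ⟨by linarith, by linarith⟩

theorem lipschitzWith_hat {t₀ δ : ℝ} (hδ : 0 < δ) (z : F) :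
    LipschitzWith (Real.toNNReal (‖z‖ / δ)) (hat t₀ δ z) := by
  refine LipschitzWith.of_dist_le_mul fun s t ↦ ?_
  have h1 : hat t₀ δ z s - hat t₀ δ z t = ((|t - t₀| - |s - t₀|) / δ) • z := by
    rw [hat, hat, ← sub_smul]
    congr 1
    ring
  have h2 : |(|t - t₀| - |s - t₀|)| ≤ |s - t| := by
    refine (abs_abs_sub_abs_le_abs_sub _ _).trans_eq ?_
    rw [sub_sub_sub_cancel_right, abs_sub_comm]
  rw [dist_eq_norm, h1, norm_smul, Real.coe_toNNReal _ (by positivity), Real.dist_eq,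
    Real.norm_eq_abs, abs_div, abs_of_pos hδ]
  calc |(|t - t₀| - |s - t₀|)| / δ * ‖z‖ ≤ |s - t| / δ * ‖z‖ := by gcongr
    _ = ‖z‖ / δ * |s - t| := by ring

theorem isTestField_hat {t₀ δ : ℝ} (hδ : 0 < δ) (z : F) :
    IsTestField (hat t₀ δ z) (t₀ - δ) (t₀ + δ) where
  ac := ((lipschitzWith_hat hδ z).lipschitzOnWith (s := _)).absolutelyContinuousOnInterval
  left := by simp [hat, abs_of_pos hδ, hδ.ne']
  right := by simp [hat, abs_of_pos hδ, hδ.ne']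
  bounded := ⟨_, Eventually.of_forall fun t ↦
    norm_deriv_le_of_lipschitz (lipschitzWith_hat hδ z)⟩

theorem hat_self (t₀ δ : ℝ) (z : F) : hat t₀ δ z t₀ = z := by simp [hat]

theorem differentiableAt_hat {t₀ δ t : ℝ} (z : F) (ht : t ≠ t₀) :
    DifferentiableAt ℝ (hat t₀ δ z) t := by
  have h1 : DifferentiableAt ℝ (fun s ↦ |s - t₀|) t :=
    (differentiableAt_id.sub_const t₀).abs (sub_ne_zero.2 ht)
  exact ((h1.div_const δ).const_sub 1).smul_const z

variable [FiniteDimensional ℝ F]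
  {H : Type*} [TopologicalSpace H] {I : ModelWithCorners ℝ F H}
  {M : Type*} [TopologicalSpace M] [ChartedSpace H M] [IsManifold I 2 M]
  [RiemannianBundle (fun x : M ↦ TangentSpace I x)]
  {adm : (ℝ → M) → Prop} {V : Set M} {U : M → ℝ} {e m : ℝ} {γ : ℝ → M} {a b : ℝ}
  {Ψ : OpenPartialHomeomorph M F} {r₁ r₂ t₀ δ δ' s₀ : ℝ} {u₁ u₂ : F → ℝ} {D₁ D₂ : Set F}
  {K₁ K₂ : ℝ}

/-- If the contact point `γ t₀` can be displaced in the direction `z`, then the jump of the momentum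
at the contact is nonpositive on `z`. The first variation of the action in the direction
`hat t₀ δ z` is minus this jump, since the path satisfies the Euler-Lagrange equation before
and after `t₀`. -/
theorem IsTimedMinimizer.metric_le_of_displacement
    [IsContMDiffRiemannianBundle I 1 F (fun x : M ↦ TangentSpace I x)]
    (h : IsTimedMinimizer I adm V U e m γ a b) (hm : 0 < m)
    (arc : IsChartArc I Ψ γ r₁ r₂) (har : a < r₁) (hrb : r₂ < b) (hδ : 0 < δ) (hδ' : δ < δ')
    (ht₁ : r₁ < t₀ - δ') (ht₂ : t₀ + δ' < r₂)
    (h₁ : IsTame (pullMetric I Ψ.symm) u₁ D₁ K₁) (hu₁ : ∀ y ∈ D₁, U (Ψ.symm y) = u₁ y)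
    (h₂ : IsTame (pullMetric I Ψ.symm) u₂ D₂ K₂) (hu₂ : ∀ y ∈ D₂, U (Ψ.symm y) = u₂ y)
    (hp₁ : ∀ t ∈ Ioo (t₀ - δ') t₀,
      HasDerivAt (fun s ↦ m • pullMetric I Ψ.symm (Ψ (γ s)) (deriv (fun s ↦ Ψ (γ s)) s))
        (force m (pullMetric I Ψ.symm) u₁ (Ψ (γ t)) (deriv (fun s ↦ Ψ (γ s)) t)) t)
    (hp₂ : ∀ t ∈ Ioo t₀ (t₀ + δ'),
      HasDerivAt (fun s ↦ m • pullMetric I Ψ.symm (Ψ (γ s)) (deriv (fun s ↦ Ψ (γ s)) s))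
        (force m (pullMetric I Ψ.symm) u₂ (Ψ (γ t)) (deriv (fun s ↦ Ψ (γ s)) t)) t)
    {v w : F} (hv : Tendsto (deriv (fun s ↦ Ψ (γ s))) (𝓝[<] t₀) (𝓝 v))
    (hw : Tendsto (deriv (fun s ↦ Ψ (γ s))) (𝓝[>] t₀) (𝓝 w)) {z : F} (hs₀ : 0 < s₀)
    (hV : ∀ s ∈ Icc 0 s₀, ∀ t ∈ Ioo (t₀ - δ) (t₀ + δ),
      Ψ (γ t) + s • z ∈ Ψ.target ∧ Ψ.symm (Ψ (γ t) + s • z) ∈ V)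
    (hD₁ : ∀ s ∈ Icc 0 s₀, ∀ t ∈ Ioo (t₀ - δ) t₀, Ψ (γ t) + s • z ∈ D₁)
    (hD₂ : ∀ s ∈ Icc 0 s₀, ∀ t ∈ Ioo t₀ (t₀ + δ), Ψ (γ t) + s • z ∈ D₂)
    (hadm : ∀ σ : ℝ → M, (∀ t ∈ Ioo (t₀ - δ) (t₀ + δ), ∃ s ∈ Icc 0 s₀,
      σ t = Ψ.symm (Ψ (γ t) + s • z)) → (∀ t ∉ Ioo (t₀ - δ) (t₀ + δ), σ t = γ t) → adm σ) :
    pullMetric I Ψ.symm (Ψ (γ t₀)) w z ≤ pullMetric I Ψ.symm (Ψ (γ t₀)) v z := by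
  set c : ℝ → F := fun s ↦ Ψ (γ s) with hcdef
  set g := pullMetric I Ψ.symm with hg
  have hsh : ∀ s ∈ Icc 0 s₀, ∀ t ∈ Ioo (t₀ - δ) (t₀ + δ), s * (1 - |t - t₀| / δ) ∈ Icc 0 s₀ := by
    intro s hs t ht
    have := hat_mem_Icc ht
    exact ⟨mul_nonneg hs.1 this.1, (mul_le_of_le_one_right hs.1 this.2).trans hs.2⟩
  have hmul : ∀ s t, s • hat t₀ δ z t = (s * (1 - |t - t₀| / δ)) • z := fun s t ↦ by
    rw [hat, smul_smul]
  have hnn := h.firstVariation_nonneg hm arc har hrb (t₁ := t₀ - δ) (t₂ := t₀ + δ) (t₀ := t₀)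
    (by linarith) (by linarith) (by linarith) (by linarith) h₁ hu₁ h₂ hu₂
    (isTestField_hat hδ z) hs₀
    (fun s hs t ht ↦ by rw [hmul]; exact hV _ (hsh s hs t ht) t ht)
    (fun s hs t ht ↦ by rw [hmul]; exact hD₁ _ (hsh s hs t ⟨ht.1, by linarith [ht.2]⟩) t ht)
    (fun s hs t ht ↦ by rw [hmul]; exact hD₂ _ (hsh s hs t ⟨by linarith [ht.1], ht.2⟩) t ht)
    (fun s hs σ hσ hσγ ↦ hadm σ (fun t ht ↦
      ⟨_, hsh s (Ioc_subset_Icc_self hs) t ht, by rw [hσ t ht, hmul]⟩) hσγ)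
  have hcD₁ : ∀ t ∈ Ioo (t₀ - δ) t₀, c t ∈ D₁ := fun t ht ↦ by
    simpa using hD₁ 0 ⟨le_rfl, hs₀.le⟩ t ht
  have hcD₂ : ∀ t ∈ Ioo t₀ (t₀ + δ), c t ∈ D₂ := fun t ht ↦ by
    simpa using hD₂ 0 ⟨le_rfl, hs₀.le⟩ t ht
  have hsub₁ : Ioo (t₀ - δ) t₀ ⊆ Ioo r₁ r₂ := Ioo_subset_Ioo (by linarith) (by linarith)
  have hsub₂ : Ioo t₀ (t₀ + δ) ⊆ Ioo r₁ r₂ := Ioo_subset_Ioo (by linarith) (by linarith)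
  obtain ⟨A₁, hA₁⟩ := h.exists_norm_deriv_le hm arc har hrb h₁ hu₁ hsub₁ hcD₁
  obtain ⟨A₂, hA₂⟩ := h.exists_norm_deriv_le hm arc har hrb h₂ hu₂ hsub₂ hcD₂
  have hlip := lipschitzWith_hat (t₀ := t₀) hδ z
  have hbd : ∀ t ∈ Ioo (t₀ - δ) (t₀ + δ), ‖hat t₀ δ z t‖ ≤ ‖z‖ := fun t ht ↦ by
    have := hat_mem_Icc ht
    rw [hat, norm_smul, Real.norm_eq_abs, abs_of_nonneg this.1]
    exact mul_le_of_le_one_left (norm_nonneg _) this.2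
  have hbd' : ∀ J : Set ℝ, ∀ᵐ t ∂volume.restrict J, ‖deriv (hat t₀ δ z) t‖ ≤ _ := fun J ↦
    Eventually.of_forall fun t ↦ norm_deriv_le_of_lipschitz hlip
  have i₁ := h₁.integrableOn_firstVariation hm.le
    (arc.continuousOn.mono (hsub₁.trans Ioo_subset_Icc_self)) hlip.continuous.continuousOn hcD₁
    (aestronglyMeasurable_deriv c _) (aestronglyMeasurable_deriv _ _) hA₁
    (fun t ht ↦ hbd t ⟨ht.1, by linarith [ht.2]⟩) (hbd' _)
  have i₂ := h₂.integrableOn_firstVariation hm.le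
    (arc.continuousOn.mono (hsub₂.trans Ioo_subset_Icc_self)) hlip.continuous.continuousOn hcD₂
    (aestronglyMeasurable_deriv c _) (aestronglyMeasurable_deriv _ _) hA₂
    (fun t ht ↦ hbd t ⟨by linarith [ht.1], ht.2⟩) (hbd' _)
  have ht₀ : t₀ ∈ Ioo r₁ r₂ := ⟨by linarith, by linarith⟩
  have hct : ContinuousAt c t₀ := arc.continuousOn.continuousAt (Icc_mem_nhds ht₀.1 ht₀.2)
  have hgt : Tendsto (fun t ↦ g (c t)) (𝓝 t₀) (𝓝 (g (c t₀))) :=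
    ((arc.chart.contDiffOn_pullMetric.continuousOn.continuousAt (Ψ.open_target.mem_nhds
      (arc.mem_target (Ioo_subset_Icc_self ht₀)))).tendsto).comp hct
  have q₁ : Tendsto (fun s ↦ m • g (c s) (deriv c s)) (𝓝[<] t₀) (𝓝 (m • g (c t₀) v)) :=
    (tendsto_clm_apply (hgt.mono_left nhdsWithin_le_nhds) hv).const_smul m
  have q₂ : Tendsto (fun s ↦ m • g (c s) (deriv c s)) (𝓝[>] t₀) (𝓝 (m • g (c t₀) w)) :=
    (tendsto_clm_apply (hgt.mono_left nhdsWithin_le_nhds) hw).const_smul m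
  have hhat : ∀ t, Tendsto (hat t₀ δ z) (𝓝 t) (𝓝 (hat t₀ δ z t)) := fun t ↦
    hlip.continuous.tendsto t
  rw [integral_firstVariation_eq (by linarith) (fun t ht ↦ hp₁ t ⟨by linarith [ht.1], ht.2⟩)
      (fun t ht ↦ differentiableAt_hat z ht.2.ne) i₁
      ((hp₁ (t₀ - δ) ⟨by linarith, by linarith⟩).continuousAt.tendsto.mono_left nhdsWithin_le_nhds)
      q₁ ((hhat _).mono_left nhdsWithin_le_nhds) ((hhat _).mono_left nhdsWithin_le_nhds),
    integral_firstVariation_eq (by linarith) (fun t ht ↦ hp₂ t ⟨ht.1, by linarith [ht.2]⟩)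
      (fun t ht ↦ differentiableAt_hat z ht.1.ne') i₂ q₂
      ((hp₂ (t₀ + δ) ⟨by linarith, by linarith⟩).continuousAt.tendsto.mono_left nhdsWithin_le_nhds)
      ((hhat _).mono_left nhdsWithin_le_nhds) ((hhat _).mono_left nhdsWithin_le_nhds),
    (isTestField_hat hδ z).left, (isTestField_hat hδ z).right, hat_self] at hnn
  simp only [map_zero, sub_zero, zero_sub, smul_apply, smul_eq_mul] at hnn
  have : m * g (c t₀) w z ≤ m * g (c t₀) v z := by linarith
  exact le_of_mul_le_mul_left this hm

end Corner

/-! ### A contact in a flat chart -/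

section Sides

variable {F : Type*} [NormedAddCommGroup F] [NormedSpace ℝ F]

theorem forall_lt_or_forall_gt {f : ℝ → ℝ} {x y : ℝ} (hf : ContinuousOn f (Ioo x y))
    (h0 : ∀ t ∈ Ioo x y, f t ≠ 0) : (∀ t ∈ Ioo x y, f t < 0) ∨ ∀ t ∈ Ioo x y, 0 < f t := by
  have := (isPreconnected_Ioo.image f hf).subset_or_subset (isOpen_Iio (a := 0))
    (isOpen_Ioi (a := 0)) (Set.disjoint_left.2 fun t h1 h2 ↦ lt_asymm h1 h2)
    (by rintro _ ⟨t, ht, rfl⟩; exact lt_or_gt_of_ne (h0 t ht))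
  exact this.imp (fun h t ht ↦ h ⟨t, ht, rfl⟩) fun h t ht ↦ h ⟨t, ht, rfl⟩

/-- A curve that leaves the hyperplane `l = 0` to the side `0 < l` has initial velocity on that
side. -/
theorem nonneg_of_tendsto_deriv_right {c : ℝ → F} {t₀ t₂ : ℝ} (ht : t₀ < t₂) {w : F}
    (l : F →L[ℝ] ℝ) (hc : ContinuousAt c t₀) (hd : DifferentiableOn ℝ c (Ioo t₀ t₂))
    (hw : Tendsto (deriv c) (𝓝[>] t₀) (𝓝 w)) (h0 : l (c t₀) = 0)
    (hpos : ∀ t ∈ Ioo t₀ t₂, 0 < l (c t)) : 0 ≤ l w := by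
  have h1 : HasDerivWithinAt c w (Ici t₀) t₀ :=
    hasDerivWithinAt_Ici_of_tendsto_deriv hd hc.continuousWithinAt (Ioo_mem_nhdsGT ht) hw
  have h2 : HasDerivWithinAt (fun t ↦ l (c t)) (l w) (Ioi t₀) t₀ :=
    (l.hasFDerivAt.comp_hasDerivWithinAt t₀ h1).mono Ioi_subset_Ici_self
  rw [hasDerivWithinAt_iff_tendsto_slope' self_notMem_Ioi] at h2
  refine ge_of_tendsto h2 ?_
  filter_upwards [Ioo_mem_nhdsGT ht] with t ht
  rw [slope_def_field, h0, sub_zero]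
  exact div_nonneg (hpos t ht).le (by linarith [ht.1])

theorem nonneg_of_tendsto_deriv_left {c : ℝ → F} {t₀ t₁ : ℝ} (ht : t₁ < t₀) {v : F}
    (l : F →L[ℝ] ℝ) (hc : ContinuousAt c t₀) (hd : DifferentiableOn ℝ c (Ioo t₁ t₀))
    (hv : Tendsto (deriv c) (𝓝[<] t₀) (𝓝 v)) (h0 : l (c t₀) = 0)
    (hneg : ∀ t ∈ Ioo t₁ t₀, l (c t) < 0) : 0 ≤ l v := by
  have h1 : HasDerivWithinAt c v (Iic t₀) t₀ :=
    hasDerivWithinAt_Iic_of_tendsto_deriv hd hc.continuousWithinAt (Ioo_mem_nhdsLT ht) hv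
  have h2 : HasDerivWithinAt (fun t ↦ l (c t)) (l v) (Iio t₀) t₀ :=
    (l.hasFDerivAt.comp_hasDerivWithinAt t₀ h1).mono Iio_subset_Iic_self
  rw [hasDerivWithinAt_iff_tendsto_slope' self_notMem_Iio] at h2
  refine ge_of_tendsto h2 ?_
  filter_upwards [Ioo_mem_nhdsLT ht] with t ht
  rw [slope_def_field, h0, sub_zero]
  exact div_nonneg_of_nonpos (hneg t ht).le (by linarith [ht.2])

/-- The half of the ball of radius `r` about the origin where `l` is positive. -/
def halfBall (l : F →L[ℝ] ℝ) (r : ℝ) : Set F := {y | 0 < l y} ∩ Metric.ball 0 r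

theorem isOpen_halfBall (l : F →L[ℝ] ℝ) (r : ℝ) : IsOpen (halfBall l r) :=
  (isOpen_lt continuous_const l.continuous).inter Metric.isOpen_ball

theorem convex_halfBall (l : F →L[ℝ] ℝ) (r : ℝ) : Convex ℝ (halfBall l r) :=
  (convex_halfSpace_gt l.isLinear 0).inter (convex_ball _ _)

theorem smul_mem_halfBall {l : F →L[ℝ] ℝ} {r : ℝ} {y : F} (hy : y ∈ halfBall l r) {s : ℝ}
    (hs : s ∈ Ioc (0 : ℝ) 1) : s • y ∈ halfBall l r := by
  refine ⟨?_, ?_⟩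
  · change 0 < l (s • y)
    rw [map_smul]
    exact mul_pos hs.1 hy.1
  · have := hy.2
    rw [mem_ball_zero_iff] at this ⊢
    rw [norm_smul, Real.norm_eq_abs, abs_of_pos hs.1]
    exact (mul_le_of_le_one_left (norm_nonneg _) hs.2).trans_lt this

theorem halfBall_mono {l : F →L[ℝ] ℝ} {r r' : ℝ} (h : r ≤ r') : halfBall l r ⊆ halfBall l r' :=
  inter_subset_inter_right _ (Metric.ball_subset_ball h)

variable {H : Type*} [TopologicalSpace H] (I : ModelWithCorners ℝ F H)
  {M : Type*} [TopologicalSpace M] [ChartedSpace H M]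
  [RiemannianBundle (fun x : M ↦ TangentSpace I x)]

/-- The half ball of radius `r` on the side `0 < l` of the hypersurface corresponds to a part of
`V` where the potential `U` is tame, tends to `C` at the origin, and where `r` is so small that
loops at the origin are not minimizing. -/
structure IsTameSide (V : Set M) (U : M → ℝ) (e : ℝ) (Ψ : OpenPartialHomeomorph M F)
    (l : F →L[ℝ] ℝ) (r : ℝ) (u : F → ℝ) (K κ C : ℝ) : Prop where
  tame : IsTame (pullMetric I Ψ.symm) u (halfBall l r) K
  mem : ∀ y ∈ halfBall l r, y ∈ Ψ.target ∧ Ψ.symm y ∈ V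
  eq : ∀ y ∈ halfBall l r, U (Ψ.symm y) = u y
  gap_pos : 0 < κ
  sq_mul_le : K ^ 2 * r ≤ 1
  gap : ∀ y ∈ halfBall l r, K * r + κ ≤ e - u y
  tendsto : Tendsto u (𝓝[halfBall l r] 0) (𝓝 C)

variable {I}

/-- A potential `f` which is smooth up to the hypersurface, with `f < e` there, is tame on small
half balls, uniformly in the radius. -/
theorem IsSmoothChart.exists_isTameSide [FiniteDimensional ℝ F] [IsManifold I 2 M]
    [IsContMDiffRiemannianBundle I 1 F (fun x : M ↦ TangentSpace I x)]
    {Ψ : OpenPartialHomeomorph M F} (hΨ : IsSmoothChart I Ψ) {ρ : ℝ} (hρ : 0 < ρ)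
    (hball : Metric.ball 0 ρ ⊆ Ψ.target) {l : F →L[ℝ] ℝ} {V W Z : Set M} {U f : M → ℝ} {e : ℝ}
    (hW : ∀ y ∈ halfBall l ρ, Ψ.symm y ∈ W) (hWV : W ⊆ V) (hWZ : W ⊆ Z) (hfU : EqOn f U W)
    (hf : ContMDiffOn I 𝓘(ℝ, ℝ) 1 f Z) (h0 : Ψ.symm 0 ∈ Z) (he : f (Ψ.symm 0) < e) :
    ∃ r₀ > 0, r₀ ≤ ρ ∧ ∃ K κ, ∀ r ∈ Ioc 0 r₀,
      IsTameSide I V U e Ψ l r (fun y ↦ f (Ψ.symm y)) K κ (f (Ψ.symm 0)) := by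
  obtain ⟨ρ₁, hρ₁, K, hT, hlim⟩ := hΨ.exists_isTame_inter (hball (Metric.mem_ball_self hρ))
    (isOpen_halfBall l ρ) (convex_halfBall l ρ) (fun y hy ↦ hball hy.2) hf h0
    fun y hy ↦ hWZ (hW y hy)
  set C := f (Ψ.symm 0) with hC
  set κ := (e - C) / 3 with hκ
  have hκ0 : 0 < κ := by
    rw [hκ]
    linarith
  have hev : ∀ᶠ y in 𝓝[halfBall l ρ] 0, f (Ψ.symm y) < C + κ :=
    hlim.eventually_lt_const (by linarith)
  obtain ⟨ρ₂, hρ₂, hρ₂b⟩ := Metric.mem_nhdsWithin_iff.1 hev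
  -- the last two bounds give `K ^ 2 * r ≤ 1` and `K * r ≤ κ`; with `u < C + κ` and `e - C = 3 κ`,
  -- the second one leaves the gap `κ`
  set r₀ := min (min ρ ρ₁) (min ρ₂ (min (1 / (K ^ 2 + 1)) (κ / (|K| + 1)))) with hr₀
  have hr₀pos : 0 < r₀ := by
    refine lt_min (lt_min hρ hρ₁) (lt_min hρ₂ (lt_min ?_ ?_)) <;> positivity
  have hle1 : r₀ ≤ ρ := (min_le_left _ _).trans (min_le_left _ _)
  have hle2 : r₀ ≤ ρ₁ := (min_le_left _ _).trans (min_le_right _ _)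
  have hle3 : r₀ ≤ ρ₂ := (min_le_right _ _).trans (min_le_left _ _)
  have hle4 : r₀ ≤ 1 / (K ^ 2 + 1) :=
    (min_le_right _ _).trans ((min_le_right _ _).trans (min_le_left _ _))
  have hle5 : r₀ ≤ κ / (|K| + 1) :=
    (min_le_right _ _).trans ((min_le_right _ _).trans (min_le_right _ _))
  refine ⟨r₀, hr₀pos, hle1, K, κ, fun r hr ↦ ?_⟩
  have hsub : halfBall l r ⊆ halfBall l ρ := halfBall_mono (hr.2.trans hle1)
  refine ⟨hT.mono (isOpen_halfBall l r) fun y hy ↦ ⟨hsub hy,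
    Metric.ball_subset_ball (hr.2.trans hle2) hy.2⟩, fun y hy ↦ ⟨hball (hsub hy).2,
    hWV (hW y (hsub hy))⟩, fun y hy ↦ (hfU (hW y (hsub hy))).symm, hκ0, ?_, fun y hy ↦ ?_,
    hlim.mono_left (nhdsWithin_mono _ hsub)⟩
  · have h1 := hr.2.trans hle4
    rw [le_div_iff₀ (by positivity)] at h1
    nlinarith [hr.1]
  · have h1 := hr.2.trans hle5
    rw [le_div_iff₀ (by positivity)] at h1
    have h2 : f (Ψ.symm y) < C + κ :=
      hρ₂b ⟨Metric.ball_subset_ball (hr.2.trans hle3) hy.2, hsub hy⟩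
    have h3 : K * r ≤ |K| * r := by
      gcongr
      · exact hr.1.le
      · exact le_abs_self K
    have h4 : e - C = 3 * κ := by
      rw [hκ]
      ring
    nlinarith [hr.1]

end Sides

section FlatContact

variable {F : Type*} [NormedAddCommGroup F] [NormedSpace ℝ F] [FiniteDimensional ℝ F]
  {H : Type*} [TopologicalSpace H] {I : ModelWithCorners ℝ F H}
  {M : Type*} [TopologicalSpace M] [ChartedSpace H M] [IsManifold I 2 M]
  [RiemannianBundle (fun x : M ↦ TangentSpace I x)]
  {V V₁ V₂ S : Set M} {U : M → ℝ} {e m : ℝ} {γ : ℝ → M} {a b : ℝ}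
  {Ψ : OpenPartialHomeomorph M F} {l : F →L[ℝ] ℝ} {ρ r r₁ r₂ t₀ t₁ t₂ : ℝ} {u₁ u₂ : F → ℝ}
  {K₁ K₂ κ₁ κ₂ C₁ C₂ : ℝ}

/-- `σ` has the itinerary of `γ`: at each instant it is in `V₁`, resp. in `V₂`, exactly when `γ`
is. -/
def SameItinerary (V₁ V₂ : Set M) (γ : ℝ → M) (a b : ℝ) (σ : ℝ → M) : Prop :=
  ∀ t ∈ Icc a b, (σ t ∈ V₁ ↔ γ t ∈ V₁) ∧ (σ t ∈ V₂ ↔ γ t ∈ V₂)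

omit [FiniteDimensional ℝ F] [IsManifold I 2 M] [RiemannianBundle (fun x : M ↦ TangentSpace I x)] in
/-- Moving the points of a path in a flat chart without changing the sign of `l` keeps the
itinerary. -/
theorem IsFlatChart.sameItinerary (flat : IsFlatChart I V V₁ V₂ S Ψ l ρ) {J : Set ℝ} {σ : ℝ → M}
    (hγ : ∀ t ∈ J, γ t ∈ Ψ.source)
    (hσ : ∀ t ∈ J, ∃ y ∈ Metric.ball (0 : F) ρ, ∃ y' ∈ Metric.ball (0 : F) ρ, σ t = Ψ.symm y ∧
      Ψ (γ t) = y' ∧ (l y < 0 ↔ l y' < 0) ∧ (0 < l y ↔ 0 < l y'))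
    (hσγ : ∀ t ∉ J, σ t = γ t) : SameItinerary V₁ V₂ γ a b σ := by
  intro t _
  by_cases ht : t ∈ J
  · obtain ⟨y, hy, y', hy', h1, h2, h3, h4⟩ := hσ t ht
    have h5 : γ t = Ψ.symm y' := by rw [← h2, Ψ.left_inv (hγ t ht)]
    rw [h1, h5, flat.mem_left y hy, flat.mem_left y' hy', flat.mem_right y hy,
      flat.mem_right y' hy']
    exact ⟨h3, h4⟩
  · rw [hσγ t ht]
    exact ⟨Iff.rfl, Iff.rfl⟩

omit [FiniteDimensional ℝ F] [IsManifold I 2 M] [RiemannianBundle (fun x : M ↦ TangentSpace I x)] in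
/-- Replacing arcs in one half ball by arcs in the same half ball keeps the itinerary. -/
theorem IsFlatChart.sameItinerary_of_halfBall (flat : IsFlatChart I V V₁ V₂ S Ψ l ρ)
    (hr : r ≤ ρ) {l' : F →L[ℝ] ℝ} (hl' : l' = l ∨ l' = -l) {J : Set ℝ} {σ : ℝ → M}
    (hγ : ∀ t ∈ J, γ t ∈ Ψ.source) (hc : ∀ t ∈ J, Ψ (γ t) ∈ halfBall l' r)
    (hσ : ∀ t ∈ J, σ t ∈ Ψ.symm '' halfBall l' r)
    (hσγ : ∀ t ∉ J, σ t = γ t) : SameItinerary V₁ V₂ γ a b σ := by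
  refine flat.sameItinerary hγ (fun t ht ↦ ?_) hσγ
  obtain ⟨y, hy, hys⟩ := hσ t ht
  refine ⟨y, Metric.ball_subset_ball hr hy.2, _, Metric.ball_subset_ball hr (hc t ht).2, hys.symm,
    rfl, ?_⟩
  have h1 : 0 < l' y := hy.1
  have h2 : 0 < l' (Ψ (γ t)) := (hc t ht).1
  rcases hl' with rfl | rfl
  · exact ⟨iff_of_false h1.not_gt h2.not_gt, iff_of_true h1 h2⟩
  · rw [neg_apply, neg_pos] at h1 h2
    exact ⟨iff_of_true h1 h2, iff_of_false h1.not_gt h2.not_gt⟩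

/-- After a contact, a path which is minimizing within its itinerary leaves the hypersurface. If it
came back to the contact point during the arc, then, as it cannot rest there, it would contain a
loop on one side. -/
theorem IsTimedMinimizer.exists_side_right
    (h : IsTimedMinimizer I (SameItinerary V₁ V₂ γ a b) V U e m γ a b) (hm : 0 < m)
    (flat : IsFlatChart I V V₁ V₂ S Ψ l ρ) (hr : r ≤ ρ)
    (s₁ : IsTameSide I V U e Ψ (-l) r u₁ K₁ κ₁ C₁) (s₂ : IsTameSide I V U e Ψ l r u₂ K₂ κ₂ C₂)
    (arc : IsChartArc I Ψ γ r₁ r₂) (har : a < r₁) (hrb : r₂ < b) (ht₀ : t₀ ∈ Ioo r₁ r₂)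
    (hball : ∀ t ∈ Icc r₁ r₂, Ψ (γ t) ∈ Metric.ball (0 : F) r)
    (hc₀ : Ψ (γ t₀) = 0) (hcontact : ∀ t ∈ Icc r₁ r₂, l (Ψ (γ t)) = 0 → Ψ (γ t) = 0) :
    ∃ r' ∈ Ioc t₀ r₂, (∀ t ∈ Ioo t₀ r', l (Ψ (γ t)) < 0) ∨ ∀ t ∈ Ioo t₀ r', 0 < l (Ψ (γ t)) := by
  set c : ℝ → F := fun s ↦ Ψ (γ s) with hcdef
  have hcc : ContinuousOn c (Icc r₁ r₂) := arc.continuousOn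
  have hsides : ∀ x y, r₁ < x → y < r₂ → (∀ t ∈ Ioo x y, c t ≠ 0) →
      (∀ t ∈ Ioo x y, l (c t) < 0) ∨ ∀ t ∈ Ioo x y, 0 < l (c t) := by
    intro x y hx hy hne
    have hsub : Ioo x y ⊆ Icc r₁ r₂ := fun t ht ↦ ⟨by linarith [ht.1], by linarith [ht.2]⟩
    exact forall_lt_or_forall_gt (l.continuous.comp_continuousOn (hcc.mono hsub))
      fun t ht h0 ↦ hne t ht (hcontact t (hsub ht) h0)
  -- there is no loop to the right of `t₀`
  have hloop : ∀ x y, t₀ ≤ x → x < y → y < r₂ → c x = 0 → c y = 0 →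
      (∀ t ∈ Ioo x y, c t ≠ 0) → False := by
    intro x y hx hxy hy hcx hcy hne
    have hx' : r₁ < x := ht₀.1.trans_le hx
    have hsub : Ioo x y ⊆ Icc r₁ r₂ := fun t ht ↦ ⟨by linarith [ht.1], by linarith [ht.2]⟩
    have hfin : ∀ (l' : F →L[ℝ] ℝ) (u : F → ℝ) (K κ C : ℝ), (l' = l ∨ l' = -l) →
        IsTameSide I V U e Ψ l' r u K κ C → (∀ t ∈ Ioo x y, 0 < l' (c t)) → False := by
      intro l' u K κ C hl' hs hpos
      have hcD : ∀ t ∈ Ioo x y, c t ∈ halfBall l' r := fun t ht ↦ ⟨hpos t ht, hball t (hsub ht)⟩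
      exact h.false_of_loop hm arc har hrb hx' hxy hy hs.tame hs.eq hs.mem
        (fun σ hσ hσγ ↦ flat.sameItinerary_of_halfBall hr hl' (fun t ht ↦ arc.mem t (hsub ht))
          hcD hσ hσγ) (fun z hz s hs ↦ smul_mem_halfBall hz hs) hs.gap_pos
        (fun z hz ↦ (mem_ball_zero_iff.1 hz.2).le) hs.sq_mul_le hs.gap hcD hcx hcy
    rcases hsides x y hx' hy hne with hneg | hpos
    · exact hfin _ _ _ _ _ (Or.inr rfl) s₁ fun t ht ↦ by simpa using hneg t ht
    · exact hfin _ _ _ _ _ (Or.inl rfl) s₂ hpos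
  by_cases hex : ∃ z ∈ Ioo t₀ r₂, c z = 0
  · exfalso
    obtain ⟨z, hz, hcz⟩ := hex
    -- the path does not stay at the contact point, because its speed is not zero
    obtain ⟨t, ht, hct⟩ : ∃ t ∈ Ioo t₀ z, c t ≠ 0 := by
      by_contra! hall
      have hFalse : ∀ᵐ t ∂volume.restrict (Ioo t₀ z), False := by
        filter_upwards [ae_restrict_of_ae (h.ae_energy hm arc har hrb),
          ae_restrict_mem measurableSet_Ioo] with t hE hmem
        have hmem' : t ∈ Ioo r₁ r₂ := ⟨ht₀.1.trans hmem.1, hmem.2.trans hz.2⟩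
        have hd : deriv c t = 0 := by
          have : c =ᶠ[𝓝 t] fun _ ↦ 0 := by
            filter_upwards [isOpen_Ioo.mem_nhds hmem] with s hs using hall s hs
          rw [this.deriv_eq, deriv_const]
        have h1 := hE hmem'
        rw [hd] at h1
        have h2 := h.energy _ (h.mapsTo (x := t) ⟨by linarith [hmem'.1], by linarith [hmem'.2]⟩)
        simp only [map_zero, mul_zero] at h1
        linarith
      rw [ae_iff] at hFalse
      simp only [not_false_eq_true, ofPred_true, Measure.restrict_apply_univ, Real.volume_Ioo,
        ENNReal.ofReal_eq_zero] at hFalse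
      linarith [hz.1]
    have hcomp : ∀ x y, r₁ ≤ x → y ≤ r₂ → IsCompact {s | s ∈ Icc x y ∧ c s = 0} := by
      intro x y hx hy
      have h1 : ContinuousOn c (Icc x y) := hcc.mono (Icc_subset_Icc hx hy)
      have h2 := h1.preimage_isClosed_of_isClosed isClosed_Icc (isClosed_singleton (x := (0 : F)))
      exact isCompact_Icc.of_isClosed_subset h2 inter_subset_left
    obtain ⟨x, hx⟩ := (hcomp t₀ t ht₀.1.le (ht.2.trans hz.2).le).exists_isGreatest
      ⟨t₀, ⟨le_rfl, ht.1.le⟩, hc₀⟩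
    obtain ⟨y, hy⟩ := (hcomp t z (ht₀.1.trans ht.1).le hz.2.le).exists_isLeast
      ⟨z, ⟨ht.2.le, le_rfl⟩, hcz⟩
    have hxt : x < t := lt_of_le_of_ne hx.1.1.2 fun h ↦ hct (h ▸ hx.1.2)
    have hty : t < y := lt_of_le_of_ne hy.1.1.1 fun h ↦ hct (h ▸ hy.1.2)
    refine hloop x y hx.1.1.1 (hxt.trans hty) (hy.1.1.2.trans_lt hz.2) hx.1.2 hy.1.2
      fun s hs h0 ↦ ?_
    rcases le_total s t with hst | hst
    · exact hs.1.not_ge (hx.2 ⟨⟨hx.1.1.1.trans hs.1.le, hst⟩, h0⟩)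
    · exact hs.2.not_ge (hy.2 ⟨⟨hst, hs.2.le.trans hy.1.1.2⟩, h0⟩)
  · push Not at hex
    refine ⟨(t₀ + r₂) / 2, ⟨by linarith [ht₀.2], by linarith [ht₀.2]⟩,
      hsides _ _ ht₀.1 (by linarith [ht₀.2]) fun t ht ↦ hex t ⟨ht.1, by linarith [ht.2, ht₀.2]⟩⟩

end FlatContact

section ContactVelocities

variable {F : Type*} [NormedAddCommGroup F] [NormedSpace ℝ F] [FiniteDimensional ℝ F]
  {H : Type*} [TopologicalSpace H] {I : ModelWithCorners ℝ F H}
  {M : Type*} [TopologicalSpace M] [ChartedSpace H M] [IsManifold I 2 M]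
  [RiemannianBundle (fun x : M ↦ TangentSpace I x)]
  [IsContMDiffRiemannianBundle I 1 F (fun x : M ↦ TangentSpace I x)]
  {V V₁ V₂ S : Set M} {U : M → ℝ} {e m : ℝ} {γ : ℝ → M} {a b : ℝ}
  {Ψ : OpenPartialHomeomorph M F} {l : F →L[ℝ] ℝ} {ρ r r₁ r₂ t₀ : ℝ} {u₁ u' : F → ℝ}
  {K₁ K' κ₁ κ' C₁ C' : ℝ}

/-- The velocities `v`, `w` in a flat chart before and after a contact, for a path that reaches the
contact point from the side `l < 0` and leaves it on the side `0 < l'`, with `l' = l` or `l' = -l`: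
conservation of energy on both sides, and conservation of the tangential momentum. For a path that
is minimizing without any condition on the itinerary, cutting the corner gives an inequality
between the normal momenta in the case of a reflection. -/
theorem IsTimedMinimizer.exists_contact_velocities
    (h : IsTimedMinimizer I (SameItinerary V₁ V₂ γ a b) V U e m γ a b) (hm : 0 < m)
    (flat : IsFlatChart I V V₁ V₂ S Ψ l ρ) (hr₀ : 0 < r) (hr : r ≤ ρ)
    (s₁ : IsTameSide I V U e Ψ (-l) r u₁ K₁ κ₁ C₁) {l' : F →L[ℝ] ℝ} (hl' : l' = l ∨ l' = -l)
    (s' : IsTameSide I V U e Ψ l' r u' K' κ' C')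
    (arc : IsChartArc I Ψ γ r₁ r₂) (har : a < r₁) (hrb : r₂ < b) (ht₀ : t₀ ∈ Ioo r₁ r₂)
    (hball : ∀ t ∈ Icc r₁ r₂, Ψ (γ t) ∈ Metric.ball (0 : F) (r / 2))
    (hc₀ : Ψ (γ t₀) = 0) (hleft : ∀ t ∈ Ioo r₁ t₀, l (Ψ (γ t)) < 0)
    (hright : ∀ t ∈ Ioo t₀ r₂, 0 < l' (Ψ (γ t))) :
    ∃ v w : F, Tendsto (deriv (fun s ↦ Ψ (γ s))) (𝓝[<] t₀) (𝓝 v) ∧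
      Tendsto (deriv (fun s ↦ Ψ (γ s))) (𝓝[>] t₀) (𝓝 w) ∧
      m * pullMetric I Ψ.symm 0 v v = 2 * (e - C₁) ∧
      m * pullMetric I Ψ.symm 0 w w = 2 * (e - C') ∧ 0 ≤ l v ∧ 0 ≤ l' w ∧
      (∀ z, l z = 0 → pullMetric I Ψ.symm 0 w z = pullMetric I Ψ.symm 0 v z) ∧
      (l' = -l → IsTimedMinimizer I (fun _ ↦ True) V U e m γ a b → ∀ z, l z ≤ 0 →
        pullMetric I Ψ.symm 0 w z ≤ pullMetric I Ψ.symm 0 v z) := by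
  set c : ℝ → F := fun s ↦ Ψ (γ s) with hcdef
  set g := pullMetric I Ψ.symm with hg
  have hball' : ∀ t ∈ Icc r₁ r₂, c t ∈ Metric.ball (0 : F) r := fun t ht ↦
    Metric.ball_subset_ball (by linarith) (hball t ht)
  have hsub₁ : Ioo r₁ t₀ ⊆ Icc r₁ r₂ := fun t ht ↦ ⟨ht.1.le, ht.2.le.trans ht₀.2.le⟩
  have hsub₂ : Ioo t₀ r₂ ⊆ Icc r₁ r₂ := fun t ht ↦ ⟨ht₀.1.le.trans ht.1.le, ht.2.le⟩
  have hcD₁ : ∀ t ∈ Ioo r₁ t₀, c t ∈ halfBall (-l) r := fun t ht ↦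
    ⟨by simpa using hleft t ht, hball' t (hsub₁ ht)⟩
  have hcD₂ : ∀ t ∈ Ioo t₀ r₂, c t ∈ halfBall l' r := fun t ht ↦
    ⟨hright t ht, hball' t (hsub₂ ht)⟩
  have hlt : Tendsto u₁ (𝓝[halfBall (-l) r] (c t₀)) (𝓝 C₁) := by
    rw [show c t₀ = 0 from hc₀]
    exact s₁.tendsto
  have hgt : Tendsto u' (𝓝[halfBall l' r] (c t₀)) (𝓝 C') := by
    rw [show c t₀ = 0 from hc₀]
    exact s'.tendsto
  have e₁ : 𝓝[Ioo r₁ t₀] t₀ = 𝓝[<] t₀ := nhdsWithin_Ioo_eq_nhdsLT ht₀.1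
  have e₂ : 𝓝[Ioo t₀ r₂] t₀ = 𝓝[>] t₀ := nhdsWithin_Ioo_eq_nhdsGT ht₀.2
  obtain ⟨hd₁, hp₁, v, hv, hvE⟩ := h.exists_tendsto_deriv hm arc har hrb le_rfl ht₀.2.le s₁.tame
    s₁.eq s₁.mem hcD₁ (fun σ hσ hσγ ↦ flat.sameItinerary_of_halfBall hr (Or.inr rfl)
      (fun t ht ↦ arc.mem t (hsub₁ ht)) hcD₁ hσ hσγ) ht₀ (by rw [e₁]; infer_instance) hlt
  obtain ⟨hd₂, hp₂, w, hw, hwE⟩ := h.exists_tendsto_deriv hm arc har hrb ht₀.1.le le_rfl s'.tame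
    s'.eq s'.mem hcD₂ (fun σ hσ hσγ ↦ flat.sameItinerary_of_halfBall hr hl'
      (fun t ht ↦ arc.mem t (hsub₂ ht)) hcD₂ hσ hσγ) ht₀ (by rw [e₂]; infer_instance) hgt
  rw [e₁] at hv
  rw [e₂] at hw
  change m * g (c t₀) v v = _ at hvE
  change m * g (c t₀) w w = _ at hwE
  rw [show c t₀ = 0 from hc₀] at hvE hwE
  have hcont : ContinuousAt c t₀ := arc.continuousOn.continuousAt (Icc_mem_nhds ht₀.1 ht₀.2)
  set δ' := min (t₀ - r₁) (r₂ - t₀) / 2 with hδ'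
  have hmin : 0 < min (t₀ - r₁) (r₂ - t₀) := lt_min (by linarith [ht₀.1]) (by linarith [ht₀.2])
  have hδ'0 : 0 < δ' := half_pos hmin
  have hδ₁ : r₁ < t₀ - δ' := by linarith [min_le_left (t₀ - r₁) (r₂ - t₀)]
  have hδ₂ : t₀ + δ' < r₂ := by linarith [min_le_right (t₀ - r₁) (r₂ - t₀)]
  have hnear : ∀ t ∈ Ioo (t₀ - δ' / 2) (t₀ + δ' / 2), t ∈ Icc r₁ r₂ := fun t ht ↦
    ⟨by linarith [ht.1], by linarith [ht.2]⟩
  -- small displacements of the path stay in the ball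
  have hdisp : ∀ z : F, ∀ s ∈ Icc 0 (r / (2 * (‖z‖ + 1))), ∀ t ∈ Icc r₁ r₂,
      c t + s • z ∈ Metric.ball (0 : F) r := by
    intro z s hs t ht
    have h1 := mem_ball_zero_iff.1 (hball t ht)
    have h2 : ‖s • z‖ ≤ r / 2 := by
      rw [norm_smul, Real.norm_eq_abs, abs_of_nonneg hs.1]
      calc s * ‖z‖ ≤ r / (2 * (‖z‖ + 1)) * (‖z‖ + 1) := by
            gcongr
            · exact hs.2
            · linarith
        _ = r / 2 := by field_simp
    rw [mem_ball_zero_iff]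
    exact (norm_add_le _ _).trans_lt (by linarith)
  -- displacements that keep both branches on their sides do not decrease the action
  have hpush : ∀ (adm : (ℝ → M) → Prop) (z : F), IsTimedMinimizer I adm V U e m γ a b →
      (∀ s ∈ Icc 0 (r / (2 * (‖z‖ + 1))), ∀ y, l y < 0 → l (y + s • z) < 0) →
      (∀ s ∈ Icc 0 (r / (2 * (‖z‖ + 1))), ∀ y, 0 < l' y → 0 < l' (y + s • z)) →
      (∀ σ : ℝ → M, (∀ t ∈ Ioo (t₀ - δ' / 2) (t₀ + δ' / 2), ∃ s ∈ Icc 0 (r / (2 * (‖z‖ + 1))),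
        σ t = Ψ.symm (c t + s • z)) → (∀ t ∉ Ioo (t₀ - δ' / 2) (t₀ + δ' / 2), σ t = γ t) →
        adm σ) → g 0 w z ≤ g 0 v z := by
    intro adm z hadm hz₁ hz₂ hσ
    have key := hadm.metric_le_of_displacement hm arc har hrb (half_pos hδ'0) (half_lt_self hδ'0)
      hδ₁ hδ₂ s₁.tame s₁.eq s'.tame s'.eq (fun t ht ↦ hp₁ t ⟨hδ₁.trans ht.1, ht.2⟩)
      (fun t ht ↦ hp₂ t ⟨ht.1, ht.2.trans hδ₂⟩) hv hw (z := z) (s₀ := r / (2 * (‖z‖ + 1)))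
      (by positivity)
      (fun s hs t ht ↦ by
        have := Metric.ball_subset_ball hr (hdisp z s hs t (hnear t ht))
        exact ⟨flat.ball_subset this, flat.mem _ this⟩)
      (fun s hs t ht ↦ by
        have ht' := hnear t ⟨ht.1, by linarith [ht.2]⟩
        refine ⟨?_, hdisp z s hs t ht'⟩
        have := hz₁ s hs _ (hleft t ⟨hδ₁.trans (by linarith [ht.1]), ht.2⟩)
        simpa using this)
      (fun s hs t ht ↦ by
        have ht' := hnear t ⟨by linarith [ht.1], ht.2⟩
        exact ⟨hz₂ s hs _ (hright t ⟨ht.1, by linarith [ht.2]⟩), hdisp z s hs t ht'⟩)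
      hσ
    change g (c t₀) w z ≤ g (c t₀) v z at key
    rwa [show c t₀ = 0 from hc₀] at key
  -- displacements along the hypersurface keep the itinerary
  have htan : ∀ z, l z = 0 → g 0 w z ≤ g 0 v z := by
    intro z hz
    have hlz : ∀ (s : ℝ) y, l (y + s • z) = l y := fun s y ↦ by simp [hz]
    have hlz' : ∀ (s : ℝ) y, l' (y + s • z) = l' y := fun s y ↦ by
      rcases hl' with rfl | rfl <;> simp [hz]
    refine hpush _ z h (fun s _ y hy ↦ by rwa [hlz]) (fun s _ y hy ↦ by rwa [hlz'])
      fun σ hσ hσγ ↦ flat.sameItinerary (fun t ht ↦ arc.mem t (hnear t ht)) (fun t ht ↦ ?_) hσγ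
    obtain ⟨s, hs, hst⟩ := hσ t ht
    exact ⟨_, Metric.ball_subset_ball hr (hdisp z s hs t (hnear t ht)), _,
      Metric.ball_subset_ball hr (hball' t (hnear t ht)), hst, rfl, by rw [hlz], by rw [hlz]⟩
  refine ⟨v, w, hv, hw, hvE, hwE, ?_, ?_, fun z hz ↦ le_antisymm (htan z hz) ?_, ?_⟩
  · exact nonneg_of_tendsto_deriv_left ht₀.1 l hcont (hd₁.differentiableOn (by norm_num)) hv
      (by rw [show c t₀ = 0 from hc₀, map_zero]) hleft
  · exact nonneg_of_tendsto_deriv_right ht₀.2 l' hcont (hd₂.differentiableOn (by norm_num)) hw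
      (by rw [show c t₀ = 0 from hc₀, map_zero]) hright
  · have := htan (-z) (by simp [hz])
    simpa using this
  · rintro rfl hmin z hz
    refine hpush _ z hmin (fun s hs y hy ↦ ?_) (fun s hs y hy ↦ ?_) fun _ _ _ ↦ trivial
    · rw [map_add, map_smul, smul_eq_mul]
      nlinarith [mul_nonneg hs.1 (neg_nonneg.2 hz)]
    · rw [neg_apply, neg_pos] at hy ⊢
      rw [map_add, map_smul, smul_eq_mul]
      nlinarith [mul_nonneg hs.1 (neg_nonneg.2 hz)]

end ContactVelocities

/-! ### Velocities before and after a contact -/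

section NormalTangential

variable {E : Type*} [NormedAddCommGroup E] [InnerProductSpace ℝ E] {n v w : E}

theorem inner_sub_smul_self (hn : ‖n‖ = 1) (v : E) :
    inner ℝ (v - inner ℝ v n • n) n = 0 := by
  rw [inner_sub_left, real_inner_smul_left, real_inner_self_eq_norm_sq, hn]
  ring

theorem norm_sq_eq_of_unit (hn : ‖n‖ = 1) (v : E) :
    ‖v‖ ^ 2 = inner ℝ v n ^ 2 + ‖v - inner ℝ v n • n‖ ^ 2 := by
  have h1 := inner_sub_smul_self hn v
  have h2 : v = (v - inner ℝ v n • n) + inner ℝ v n • n := by abel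
  have h3 : inner ℝ (v - inner ℝ v n • n) (inner ℝ v n • n) = 0 := by
    rw [real_inner_smul_right, h1, mul_zero]
  conv_lhs => rw [h2]
  rw [sq, norm_add_sq_eq_norm_sq_add_norm_sq_of_inner_eq_zero _ _ h3, norm_smul, hn, mul_one,
    Real.norm_eq_abs, abs_mul_abs_self]
  ring

/-- Vectors with the same inner products with all vectors orthogonal to `n` have the same component
orthogonal to `n`. -/
theorem sub_smul_eq_of_inner_eq (hn : ‖n‖ = 1)
    (h : ∀ z, inner ℝ z n = 0 → inner ℝ w z = inner ℝ v z) :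
    w - inner ℝ w n • n = v - inner ℝ v n • n := by
  set d := (w - inner ℝ w n • n) - (v - inner ℝ v n • n) with hd
  have hdn : inner ℝ d n = 0 := by
    rw [hd, inner_sub_left, inner_sub_smul_self hn, inner_sub_smul_self hn, sub_zero]
  have hnd : inner ℝ n d = 0 := by rwa [real_inner_comm]
  have h1 : inner ℝ d d = 0 := by
    have h2 := h d hdn
    have h3 : inner ℝ d d = inner ℝ ((w - inner ℝ w n • n) - (v - inner ℝ v n • n)) d := by
      rw [← hd]
    rw [h3, inner_sub_left, inner_sub_left, inner_sub_left, real_inner_smul_left,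
      real_inner_smul_left, hnd, h2]
    ring
  exact sub_eq_zero.1 (inner_self_eq_zero.1 h1)

/-- The sine of the angle with the unit vector `n`, from the normal component. -/
theorem sin_angle_eq_sqrt (hn : ‖n‖ = 1) {q : ℝ} (hv : v ≠ 0)
    (h : inner ℝ v n ^ 2 = (1 - q) * ‖v‖ ^ 2) :
    Real.sin (InnerProductGeometry.angle v n) = √q := by
  have hcos : Real.cos (InnerProductGeometry.angle v n) = inner ℝ v n / ‖v‖ := by
    rw [InnerProductGeometry.cos_angle, hn, mul_one]
  have hv' : ‖v‖ ≠ 0 := norm_ne_zero_iff.2 hv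
  have h1 : Real.sin (InnerProductGeometry.angle v n) ^ 2 = q := by
    rw [Real.sin_sq, hcos, div_pow, h]
    field_simp
    ring
  rw [← h1, Real.sqrt_sq (InnerProductGeometry.sin_angle_nonneg _ _)]

end NormalTangential

section NormalVector

variable {F : Type*} [NormedAddCommGroup F] [NormedSpace ℝ F] [FiniteDimensional ℝ F]
  {H : Type*} [TopologicalSpace H] {I : ModelWithCorners ℝ F H}
  {M : Type*} [TopologicalSpace M] [ChartedSpace H M] [IsManifold I 2 M]
  {V V₁ V₂ S : Set M} {Ψ : OpenPartialHomeomorph M F} {l : F →L[ℝ] ℝ} {ρ : ℝ} {x : M}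

omit [FiniteDimensional ℝ F] [IsManifold I 2 M] in
theorem HasInitialVelocity.continuousAt {c : ℝ → M} {x : M} {w : TangentSpace I x}
    (h : HasInitialVelocity I c x w) : ContinuousAt c 0 :=
  h.2.continuousAt

omit [FiniteDimensional ℝ F] [IsManifold I 2 M] in
theorem PointsInto.mem_closure {A : Set M} {w : TangentSpace I x} (h : PointsInto I A x w) :
    x ∈ closure A := by
  obtain ⟨c, hc, hA⟩ := h
  have h1 : Tendsto c (𝓝[>] 0) (𝓝 x) := by
    have := hc.continuousAt.tendsto
    rw [hc.1] at this
    exact this.mono_left nhdsWithin_le_nhds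
  exact mem_closure_of_tendsto h1 hA

omit [FiniteDimensional ℝ F] [IsManifold I 2 M] in
/-- In a flat chart, the vectors in the hyperplane `l = 0` represent vectors tangent to the
hypersurface. -/
theorem IsFlatChart.pushforward_mem_tangentTo (flat : IsFlatChart I V V₁ V₂ S Ψ l ρ)
    (hx : Ψ.symm 0 = x) {z : F} (hz : l z = 0) :
    pushforward I Ψ.symm 0 hx z ∈ tangentTo I S x := by
  have hd : HasDerivAt (fun s : ℝ ↦ s • z) z 0 := by
    simpa using (hasDerivAt_id (0 : ℝ)).smul_const z
  refine ⟨fun s ↦ Ψ.symm (s • z), flat.chart.hasInitialVelocity_symm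
    (flat.ball_subset (Metric.mem_ball_self flat.pos)) hx (by simp) hd, ?_⟩
  have h1 : ∀ᶠ s in 𝓝 (0 : ℝ), s • z ∈ Metric.ball (0 : F) ρ := by
    refine hd.continuousAt.eventually_mem ?_
    rw [zero_smul]
    exact Metric.ball_mem_nhds _ flat.pos
  filter_upwards [h1] with s hs
  rw [flat.mem_hypersurface _ hs, map_smul, hz, smul_zero]

omit [FiniteDimensional ℝ F] [IsManifold I 2 M] in
/-- A vector pointing into `V₂` has a representative on the side `0 ≤ l`. -/
theorem IsFlatChart.nonneg_of_pointsInto (flat : IsFlatChart I V V₁ V₂ S Ψ l ρ)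
    (hx : Ψ.symm 0 = x) {z : F} (h : PointsInto I V₂ x (pushforward I Ψ.symm 0 hx z)) :
    0 ≤ l z := by
  obtain ⟨c, hc, hV₂⟩ := h
  have h0 := flat.ball_subset (Metric.mem_ball_self flat.pos)
  have hsrc : x ∈ Ψ.source := hx ▸ Ψ.map_target h0
  have hΨx : Ψ x = 0 := by rw [← hx, Ψ.right_inv h0]
  have hd := flat.chart.hasDerivAt_of_hasInitialVelocity h0 hx hc
  have h1 : HasDerivWithinAt (fun s ↦ l (Ψ (c s))) (l z) (Ioi 0) 0 :=
    (l.hasFDerivAt.comp_hasDerivAt 0 hd).hasDerivWithinAt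
  rw [hasDerivWithinAt_iff_tendsto_slope' self_notMem_Ioi] at h1
  refine ge_of_tendsto h1 ?_
  have h2 : ∀ᶠ s in 𝓝[>] (0 : ℝ), Ψ (c s) ∈ Metric.ball (0 : F) ρ := by
    refine (hd.continuousAt.eventually_mem ?_).filter_mono nhdsWithin_le_nhds
    rw [hc.1, hΨx]
    exact Metric.ball_mem_nhds _ flat.pos
  have h3 : ∀ᶠ s in 𝓝[>] (0 : ℝ), c s ∈ Ψ.source := by
    refine (hc.continuousAt.eventually_mem ?_).filter_mono nhdsWithin_le_nhds
    rw [hc.1]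
    exact Ψ.open_source.mem_nhds hsrc
  filter_upwards [hV₂, h2, h3, self_mem_nhdsWithin] with s hs hb hsr hpos
  rw [← Ψ.left_inv hsr, flat.mem_right _ hb] at hs
  rw [slope_def_field, hc.1, hΨx, map_zero, sub_zero, sub_zero]
  exact div_nonneg hs.le (le_of_lt hpos)

variable [RiemannianBundle (fun x : M ↦ TangentSpace I x)]

omit [FiniteDimensional ℝ F] [IsManifold I 2 M] in
/-- The normal component of a tangent vector is, up to a positive factor, the value of `l` on its
representative in the flat chart. -/
theorem IsFlatChart.exists_inner_normal_eq (flat : IsFlatChart I V V₁ V₂ S Ψ l ρ)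
    (hx : Ψ.symm 0 = x) {ν : F} (hn : IsUnitNormalInto I S V₂ x (pushforward I Ψ.symm 0 hx ν)) :
    0 < l ν ∧ ∀ z, inner ℝ (pushforward I Ψ.symm 0 hx z) (pushforward I Ψ.symm 0 hx ν) =
      l z / l ν := by
  obtain ⟨hn1, hn2, hn3⟩ := hn
  have htan : ∀ z, l z = 0 →
      inner ℝ (pushforward I Ψ.symm 0 hx z) (pushforward I Ψ.symm 0 hx ν) = 0 := fun z hz ↦
    hn2 _ (flat.pushforward_mem_tangentTo hx hz)
  have hpos : 0 < l ν := by
    refine lt_of_le_of_ne (flat.nonneg_of_pointsInto hx hn3) fun h0 ↦ ?_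
    have := htan ν h0.symm
    rw [real_inner_self_eq_norm_sq, hn1] at this
    norm_num at this
  refine ⟨hpos, fun z ↦ ?_⟩
  have h1 := htan (z - (l z / l ν) • ν) (by
    rw [map_sub, map_smul, smul_eq_mul, div_mul_cancel₀ _ hpos.ne', sub_self])
  rw [map_sub, map_smul, inner_sub_left, real_inner_smul_left, real_inner_self_eq_norm_sq,
    hn1] at h1
  linarith

end NormalVector

section ContactTheorem

variable {F : Type*} [NormedAddCommGroup F] [NormedSpace ℝ F]
  {H : Type*} [TopologicalSpace H] {I : ModelWithCorners ℝ F H}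
  {M : Type*} [TopologicalSpace M] [ChartedSpace H M]

theorem IsChartArc.mono {Ψ : OpenPartialHomeomorph M F} {γ : ℝ → M} {r₁ r₂ s₁ s₂ : ℝ}
    (h : IsChartArc I Ψ γ r₁ r₂) (hs : s₁ < s₂) (h₁ : r₁ ≤ s₁) (h₂ : s₂ ≤ r₂) :
    IsChartArc I Ψ γ s₁ s₂ where
  chart := h.chart
  lt := hs
  mem t ht := h.mem t ⟨h₁.trans ht.1, ht.2.trans h₂⟩
  ac := h.ac.mono (by
    rw [uIcc_of_le hs.le, uIcc_of_le h.lt.le]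
    exact Icc_subset_Icc h₁ h₂)

variable [IsManifold I 2 M]

/-- Convergence of the velocity in a chart is convergence of the velocity in the tangent
bundle. -/
theorem IsSmoothChart.tendsto_mk_velocity {Ψ : OpenPartialHomeomorph M F}
    (hΨ : IsSmoothChart I Ψ) {γ : ℝ → M} {t₀ : ℝ} (hγ : ContinuousAt γ t₀) {y : F}
    (hy : y ∈ Ψ.target) (hx : Ψ.symm y = γ t₀) {v : F} {L : Filter ℝ} (hL : L ≤ 𝓝 t₀)
    (hv : Tendsto (deriv (fun s ↦ Ψ (γ s))) L (𝓝 v)) :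
    Tendsto (fun s ↦ (⟨γ s, velocity I γ s⟩ : TangentBundle I M)) L
      (𝓝 (⟨γ t₀, pushforward I Ψ.symm y hx v⟩ : TangentBundle I M)) := by
  have hsrc : γ t₀ ∈ Ψ.source := hx ▸ Ψ.map_target hy
  have hyt : Ψ (γ t₀) = y := by rw [← hx, Ψ.right_inv hy]
  have hc : Tendsto (fun s ↦ Ψ (γ s)) L (𝓝 y) := by
    rw [← hyt]
    exact ((Ψ.continuousAt hsrc).tendsto.comp hγ.tendsto).mono_left hL
  refine (hΨ.tendsto_mk_pushforward hy hx v hc hv).congr' ?_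
  have hev : ∀ᶠ s in 𝓝 t₀, ∀ᶠ s' in 𝓝 s, γ s' ∈ Ψ.source :=
    (hγ.eventually_mem (Ψ.open_source.mem_nhds hsrc)).eventually_nhds
  filter_upwards [hL hev] with s hs
  rw [hΨ.velocity_eq_pushforward hs, mk_pushforward, mk_pushforward]

/-- A path in `W ∪ W'` which is in `W` immediately after `t₀` ends in `W`, because the image of the
interval is connected. -/
theorem mem_of_eventually_mem_right {X : Type*} [TopologicalSpace X] {W W' : Set X} (hW : IsOpen W)
    (hW' : IsOpen W') (hdisj : Disjoint W W') {γ : ℝ → X} {t₀ b : ℝ} (ht : t₀ < b)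
    (hγ : ContinuousOn γ (Ioc t₀ b)) (hmem : MapsTo γ (Ioc t₀ b) (W ∪ W'))
    (hev : ∀ᶠ t in 𝓝[>] t₀, γ t ∈ W) : γ b ∈ W := by
  obtain ⟨t, h1, h2⟩ := (hev.and (Ioc_mem_nhdsGT ht)).exists
  rcases (isPreconnected_Ioc.image γ hγ).subset_or_subset hW hW' hdisj hmem.image_subset with h | h
  · exact h ⟨b, ⟨ht, le_rfl⟩, rfl⟩
  · exact absurd rfl (hdisj.ne_of_mem h1 (h ⟨t, h2, rfl⟩))

variable [FiniteDimensional ℝ F] [I.Boundaryless]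
  [RiemannianBundle (fun x : M ↦ TangentSpace I x)]
  [IsContMDiffRiemannianBundle I 1 F (fun x : M ↦ TangentSpace I x)]

/-- The velocities before and after a contact that is reached from `V₁`: conservation of energy and
of the tangential momentum. The path continues either in `V₁` or in `V₂`; if it continues in `V₁`
and is minimizing among all paths, the normal velocity does not decrease. -/
theorem IsTimedMinimizer.exists_velocities {V V₁ V₂ S : Set M} (hV : IsOpen V) (hV₁ : IsOpen V₁)
    (hV₂ : IsOpen V₂) (hdisj : Disjoint V₁ V₂) (hS : IsSmoothHypersurface I S)
    (hVS : V \ S = V₁ ∪ V₂) {U U₁ U₂ : M → ℝ} (hU₁ : EqOn U₁ U V₁) (hU₂ : EqOn U₂ U V₂)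
    (hsmooth₁ : ContMDiffOn I 𝓘(ℝ, ℝ) 1 U₁ (closure V₁ ∩ V))
    (hsmooth₂ : ContMDiffOn I 𝓘(ℝ, ℝ) 1 U₂ (closure V₂ ∩ V)) {e : ℝ}
    (he₁ : ∀ y ∈ closure V₁ ∩ V, U₁ y < e) (he₂ : ∀ y ∈ closure V₂ ∩ V, U₂ y < e)
    {m a b : ℝ} (hm : 0 < m) {γ : ℝ → M}
    (h : IsTimedMinimizer I (SameItinerary V₁ V₂ γ a b) V U e m γ a b)
    {t₀ : ℝ} (ht₀ : t₀ ∈ Ioo a b) (hcon : IsContactInstant γ S t₀)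
    (hleft : ∀ᶠ t in 𝓝[<] t₀, γ t ∈ V₁) {n : TangentSpace I (γ t₀)}
    (hn : IsUnitNormalInto I S V₂ (γ t₀) n) :
    ∃ v w : TangentSpace I (γ t₀), IsVelocityBefore I γ t₀ v ∧ IsVelocityAfter I γ t₀ w ∧
      m * ‖v‖ ^ 2 = 2 * (e - U₁ (γ t₀)) ∧ 0 ≤ inner ℝ v n ∧
      (∀ z : TangentSpace I (γ t₀), inner ℝ z n = 0 →
        inner ℝ w z = inner ℝ v z ∧ z ∈ tangentTo I S (γ t₀)) ∧
      (((∀ᶠ t in 𝓝[>] t₀, γ t ∈ V₁) ∧ m * ‖w‖ ^ 2 = 2 * (e - U₁ (γ t₀)) ∧ inner ℝ w n ≤ 0 ∧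
          (IsTimedMinimizer I (fun _ ↦ True) V U e m γ a b → inner ℝ v n ≤ inner ℝ w n)) ∨
        ((∀ᶠ t in 𝓝[>] t₀, γ t ∈ V₂) ∧ m * ‖w‖ ^ 2 = 2 * (e - U₂ (γ t₀)) ∧ 0 ≤ inner ℝ w n)) := by
  obtain ⟨ε, hε, hcon⟩ := hcon
  have hγc : ContinuousAt γ t₀ := h.ac.1.continuousAt (Icc_mem_nhds ht₀.1 ht₀.2)
  have hpS : γ t₀ ∈ S := (hcon.symm.subset (mem_singleton (γ t₀))).2
  have hpV : γ t₀ ∈ V := h.mapsTo (Ioo_subset_Icc_self ht₀)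
  have hp₁ : γ t₀ ∈ closure V₁ :=
    mem_closure_of_tendsto (hγc.tendsto.mono_left nhdsWithin_le_nhds) hleft
  have hp₂ : γ t₀ ∈ closure V₂ := hn.2.2.mem_closure
  have hV₁V : V₁ ⊆ V := fun x hx ↦ (hVS.symm.subset (Or.inl hx)).1
  have hV₂V : V₂ ⊆ V := fun x hx ↦ (hVS.symm.subset (Or.inr hx)).1
  obtain ⟨Ψ, l, ρ, hsrc, hΨ0, flat⟩ :=
    hS.exists_isFlatChart hV hV₁ hV₂ hdisj hVS hpS hpV hp₁ hp₂
  have h0 := flat.ball_subset (Metric.mem_ball_self flat.pos)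
  have hx : Ψ.symm 0 = γ t₀ := by rw [← hΨ0, Ψ.left_inv hsrc]
  obtain ⟨R₁, hR₁, hR₁ρ, K₁, κ₁, side₁⟩ := flat.chart.exists_isTameSide (l := -l) (V := V) (W := V₁)
    (e := e) (f := U₁) (Z := closure V₁ ∩ V) flat.pos flat.ball_subset
    (fun y hy ↦ (flat.mem_left y hy.2).2 (by simpa using hy.1)) hV₁V
    (fun y hy ↦ ⟨subset_closure hy, hV₁V hy⟩) hU₁ hsmooth₁ (by rw [hx]; exact ⟨hp₁, hpV⟩)
    (by rw [hx]; exact he₁ _ ⟨hp₁, hpV⟩)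
  obtain ⟨R₂, hR₂, hR₂ρ, K₂, κ₂, side₂⟩ := flat.chart.exists_isTameSide (l := l) (V := V) (W := V₂)
    (e := e) (f := U₂) (Z := closure V₂ ∩ V) flat.pos flat.ball_subset
    (fun y hy ↦ (flat.mem_right y hy.2).2 hy.1) hV₂V
    (fun y hy ↦ ⟨subset_closure hy, hV₂V hy⟩) hU₂ hsmooth₂ (by rw [hx]; exact ⟨hp₂, hpV⟩)
    (by rw [hx]; exact he₂ _ ⟨hp₂, hpV⟩)
  set r := min R₁ R₂ with hr
  have hr0 : 0 < r := lt_min hR₁ hR₂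
  have hrρ : r ≤ ρ := (min_le_left _ _).trans hR₁ρ
  have s₁ := side₁ r ⟨hr0, min_le_left _ _⟩
  have s₂ := side₂ r ⟨hr0, min_le_right _ _⟩
  rw [hx] at s₁ s₂
  have hN : ((fun t ↦ Ψ (γ t)) ⁻¹' Metric.ball 0 (r / 2) ∩ Ioo (t₀ - ε) (t₀ + ε)) ∩
      {t | t < t₀ → γ t ∈ V₁} ∈ 𝓝 t₀ := by
    refine inter_mem (inter_mem ?_ (Ioo_mem_nhds (by linarith) (by linarith)))
      (eventually_nhdsWithin_iff.1 hleft)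
    refine ((Ψ.continuousAt hsrc).comp (f := γ) hγc).preimage_mem_nhds ?_
    rw [Function.comp_apply, hΨ0]
    exact Metric.ball_mem_nhds _ (half_pos hr0)
  obtain ⟨δ, hδ, hsub, arc⟩ := h.ac.exists_isChartArc ht₀ flat.chart hsrc hN
  have har : a < t₀ - δ := (hsub ⟨le_rfl, by linarith⟩).2.1
  have hrb : t₀ + δ < b := (hsub ⟨by linarith, le_rfl⟩).2.2
  have hball : ∀ t ∈ Icc (t₀ - δ) (t₀ + δ), Ψ (γ t) ∈ Metric.ball (0 : F) (r / 2) := fun t ht ↦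
    (hsub ht).1.1.1
  have hball' : ∀ t ∈ Icc (t₀ - δ) (t₀ + δ), Ψ (γ t) ∈ Metric.ball (0 : F) r := fun t ht ↦
    Metric.ball_subset_ball (by linarith) (hball t ht)
  have hballρ : ∀ t ∈ Icc (t₀ - δ) (t₀ + δ), Ψ (γ t) ∈ Metric.ball (0 : F) ρ := fun t ht ↦
    Metric.ball_subset_ball hrρ (hball' t ht)
  have hl₁ : ∀ t ∈ Ioo (t₀ - δ) t₀, l (Ψ (γ t)) < 0 := fun t ht ↦ by
    have ht' : t ∈ Icc (t₀ - δ) (t₀ + δ) := ⟨ht.1.le, by linarith [ht.2]⟩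
    have h1 := (hsub ht').1.2 ht.2
    rwa [← arc.symm_apply ht', flat.mem_left _ (hballρ t ht')] at h1
  have hcontact : ∀ t ∈ Icc (t₀ - δ) (t₀ + δ), l (Ψ (γ t)) = 0 → Ψ (γ t) = 0 := fun t ht hlt ↦ by
    rw [← flat.mem_hypersurface _ (hballρ t ht), arc.symm_apply ht] at hlt
    have h1 : γ t ∈ ({γ t₀} : Set M) :=
      hcon.subset ⟨⟨t, Ioo_subset_Icc_self (hsub ht).1.1.2, rfl⟩, hlt⟩
    rw [mem_singleton_iff.1 h1, hΨ0]
  have ht₀' : t₀ ∈ Ioo (t₀ - δ) (t₀ + δ) := ⟨by linarith, by linarith⟩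
  obtain ⟨r', hr', hcases⟩ := h.exists_side_right hm flat hrρ s₁ s₂ arc har hrb ht₀' hball' hΨ0
    hcontact
  have arc' := arc.mono (s₂ := r') (by linarith [hr'.1]) le_rfl hr'.2
  have ht₀r : t₀ ∈ Ioo (t₀ - δ) r' := ⟨by linarith, hr'.1⟩
  have hball'' : ∀ t ∈ Icc (t₀ - δ) r', Ψ (γ t) ∈ Metric.ball (0 : F) (r / 2) := fun t ht ↦
    hball t ⟨ht.1, ht.2.trans hr'.2⟩
  have hevr : ∀ W : Set M, (∀ t ∈ Ioo t₀ r', γ t ∈ W) → ∀ᶠ t in 𝓝[>] t₀, γ t ∈ W := fun W hW ↦ by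
    filter_upwards [Ioo_mem_nhdsGT hr'.1] with t ht using hW t ht
  have hin : ∀ t ∈ Ioo t₀ r', t ∈ Icc (t₀ - δ) (t₀ + δ) := fun t ht ↦
    ⟨by linarith [ht.1], ht.2.le.trans hr'.2⟩
  set T := pushforward I Ψ.symm 0 hx with hT
  have hsurj : Function.Surjective T := flat.chart.pushforward_surjective h0 hx
  obtain ⟨ν, rfl⟩ := hsurj n
  obtain ⟨hν, hinner⟩ := flat.exists_inner_normal_eq hx hn
  have hmetric : ∀ y z : F, pullMetric I Ψ.symm 0 y z = inner ℝ (T y) (T z) :=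
    pullMetric_apply Ψ.symm 0 hx
  have hmetric' : ∀ y : F, pullMetric I Ψ.symm 0 y y = ‖T y‖ ^ 2 := pullMetric_self Ψ.symm 0 hx
  have htan : ∀ v w : F, (∀ z, l z = 0 → pullMetric I Ψ.symm 0 w z = pullMetric I Ψ.symm 0 v z) →
      ∀ z : TangentSpace I (γ t₀), inner ℝ z (T ν) = 0 →
        inner ℝ (T w) z = inner ℝ (T v) z ∧ z ∈ tangentTo I S (γ t₀) := by
    intro v w hvw z hz
    obtain ⟨z, rfl⟩ := hsurj z
    rw [hinner, div_eq_zero_iff] at hz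
    have hz' := hz.resolve_right hν.ne'
    exact ⟨by rw [← hmetric, ← hmetric, hvw z hz'], flat.pushforward_mem_tangentTo hx hz'⟩
  have hbefore : ∀ v : F, Tendsto (deriv (fun s ↦ Ψ (γ s))) (𝓝[<] t₀) (𝓝 v) →
      IsVelocityBefore I γ t₀ (T v) := fun v hv ↦
    flat.chart.tendsto_mk_velocity hγc h0 hx nhdsWithin_le_nhds hv
  have hafter : ∀ w : F, Tendsto (deriv (fun s ↦ Ψ (γ s))) (𝓝[>] t₀) (𝓝 w) →
      IsVelocityAfter I γ t₀ (T w) := fun w hw ↦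
    flat.chart.tendsto_mk_velocity hγc h0 hx nhdsWithin_le_nhds hw
  rcases hcases with hneg | hpos
  · obtain ⟨v, w, hv, hw, hvE, hwE, hlv, hlw, hvw, hmin⟩ := h.exists_contact_velocities hm flat hr0
      hrρ s₁ (Or.inr rfl) s₁ arc' har (hr'.2.trans_lt hrb) ht₀r hball'' hΨ0 hl₁
      (fun t ht ↦ by simpa using hneg t ht)
    refine ⟨T v, T w, hbefore v hv, hafter w hw, ?_, ?_, htan v w hvw, Or.inl ⟨?_, ?_, ?_, ?_⟩⟩
    · rw [← hmetric', hvE]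
    · rw [hinner]
      exact div_nonneg hlv hν.le
    · refine hevr _ fun t ht ↦ ?_
      rw [← arc.symm_apply (hin t ht), flat.mem_left _ (hballρ t (hin t ht))]
      exact hneg t ht
    · rw [← hmetric', hwE]
    · rw [hinner]
      refine div_nonpos_of_nonpos_of_nonneg ?_ hν.le
      simpa using hlw
    · intro hglobal
      have h1 := hmin rfl hglobal (-ν) (by simpa using hν.le)
      rw [map_neg, map_neg, neg_le_neg_iff, hmetric, hmetric] at h1
      exact h1
  · obtain ⟨v, w, hv, hw, hvE, hwE, hlv, hlw, hvw, -⟩ := h.exists_contact_velocities hm flat hr0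
      hrρ s₁ (Or.inl rfl) s₂ arc' har (hr'.2.trans_lt hrb) ht₀r hball'' hΨ0 hl₁ hpos
    refine ⟨T v, T w, hbefore v hv, hafter w hw, ?_, ?_, htan v w hvw, Or.inr ⟨?_, ?_, ?_⟩⟩
    · rw [← hmetric', hvE]
    · rw [hinner]
      exact div_nonneg hlv hν.le
    · refine hevr _ fun t ht ↦ ?_
      rw [← arc.symm_apply (hin t ht), flat.mem_right _ (hballρ t (hin t ht))]
      exact hpos t ht
    · rw [← hmetric', hwE]
    · rw [hinner]
      exact div_nonneg hlw hν.le

end ContactTheorem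

end OpticalPath

end

theorem proposition2p3
    {F : Type*} [NormedAddCommGroup F] [NormedSpace ℝ F] [FiniteDimensional ℝ F]
    {H : Type*} [TopologicalSpace H] (I : ModelWithCorners ℝ F H) [I.Boundaryless]
    {M : Type*} [TopologicalSpace M] [T2Space M] [ChartedSpace H M] [IsManifold I ∞ M]
    [RiemannianBundle (fun x : M ↦ TangentSpace I x)]
    [IsContMDiffRiemannianBundle I ∞ F (fun x : M ↦ TangentSpace I x)]
    -- the open set `V`, cut by the hypersurface `S` into the open sets `V₁` and `V₂`
    (V V₁ V₂ S : Set M) (hV : IsOpen V) (hV₁ : IsOpen V₁) (hV₂ : IsOpen V₂)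
    (hdisj : Disjoint V₁ V₂) (hS : OpticalPath.IsSmoothHypersurface I S)
    (hVS : V \ S = V₁ ∪ V₂)
    -- the potential `U`, and the smooth extension `Uᵢ` of its restriction to `Vᵢ`
    (U U₁ U₂ : M → ℝ) (hU₁ : EqOn U₁ U V₁) (hU₂ : EqOn U₂ U V₂)
    (hsmooth₁ : ContMDiffOn I 𝓘(ℝ, ℝ) ∞ U₁ (closure V₁ ∩ V))
    (hsmooth₂ : ContMDiffOn I 𝓘(ℝ, ℝ) ∞ U₂ (closure V₂ ∩ V))
    -- the total energy `e` exceeds the potentials, so that the optical metric is a metric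
    (e : ℝ) (he : ∀ y ∈ V, U y < e) (he₁ : ∀ y ∈ closure V₁ ∩ V, U₁ y < e)
    (he₂ : ∀ y ∈ closure V₂ ∩ V, U₂ y < e)
    (m a : ℝ) (hm : 0 < m) (ha : 0 < a) (γ : ℝ → M)
    (hγ : OpticalPath.IsLengthMinimizingInItinerary I V V₁ V₂ U e γ (-a) a)
    (htime : OpticalPath.IsTimeParametrized I m U e γ (-a) a) :
    -- Newton's equation off the hypersurface
    (∀ α β : ℝ, Ioo α β ⊆ Ioo (-a) a →
      (MapsTo γ (Ioo α β) V₁ → OpticalPath.SolvesNewton I m U₁ γ α β) ∧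
      (MapsTo γ (Ioo α β) V₂ → OpticalPath.SolvesNewton I m U₂ γ α β)) ∧
    -- behaviour at a contact instant that is reached from `V₁`
    (∀ t₀ ∈ Ioo (-a) a, OpticalPath.IsContactInstant γ S t₀ →
      (∀ᶠ t in 𝓝[<] t₀, γ t ∈ V₁) →
      ∀ n : TangentSpace I (γ t₀), OpticalPath.IsUnitNormalInto I S V₂ (γ t₀) n →
      ∃ v w : TangentSpace I (γ t₀),
        OpticalPath.IsVelocityBefore I γ t₀ v ∧ OpticalPath.IsVelocityAfter I γ t₀ w ∧
        -- reflection
        ((OpticalPath.normalPart n v) ^ 2 - 2 / m * (U₂ (γ t₀) - U₁ (γ t₀)) < 0 →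
          (∀ᶠ t in 𝓝[>] t₀, γ t ∈ V₁) ∧
          ((∀ t ∈ Ioc t₀ a, γ t ∉ S) → γ a ∈ V₁) ∧
          OpticalPath.normalPart n w = -OpticalPath.normalPart n v ∧
          OpticalPath.tangentialPart n w = OpticalPath.tangentialPart n v) ∧
        -- refraction
        (OpticalPath.IsLengthMinimizing I V U e γ (-a) a →
          0 < (OpticalPath.normalPart n v) ^ 2 - 2 / m * (U₂ (γ t₀) - U₁ (γ t₀)) →
          OpticalPath.normalPart n v ≠ 0 →
          (∀ᶠ t in 𝓝[>] t₀, γ t ∈ V₂) ∧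
          ((∀ t ∈ Ioc t₀ a, γ t ∉ S) → γ a ∈ V₂) ∧
          OpticalPath.normalPart n w =
            √((OpticalPath.normalPart n v) ^ 2 - 2 * (U₂ (γ t₀) - U₁ (γ t₀)) / m) ∧
          OpticalPath.tangentialPart n w = OpticalPath.tangentialPart n v) ∧
        -- critical incoming angle
        (OpticalPath.IsLengthMinimizing I V U e γ (-a) a →
          (OpticalPath.normalPart n v) ^ 2 - 2 / m * (U₂ (γ t₀) - U₁ (γ t₀)) = 0 →
          w = v - (inner ℝ v n : ℝ) • n ∧
          w ∈ OpticalPath.tangentTo I S (γ t₀) ∧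
          (γ a ∈ V₁ ∨ γ a ∈ V₂ ∨ γ a ∈ S) ∧
          Real.sin (InnerProductGeometry.angle v n) =
            OpticalPath.refractiveIndex U₂ e (γ t₀) / OpticalPath.refractiveIndex U₁ e (γ t₀) ∧
          Real.sin (InnerProductGeometry.angle v n) =
            √((e - U₂ (γ t₀)) / (e - U₁ (γ t₀))))) := by
  have hV₁V : V₁ ⊆ V := fun x hx ↦ (hVS.symm.subset (Or.inl hx)).1
  have hV₂V : V₂ ⊆ V := fun x hx ↦ (hVS.symm.subset (Or.inr hx)).1
  have hmin : OpticalPath.IsTimedMinimizer I (OpticalPath.SameItinerary V₁ V₂ γ (-a) a) V U e m γ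
      (-a) a := ⟨hγ.1, hγ.2.1, hγ.2.2.1, hγ.2.2.2, he, htime⟩
  have hglobal : OpticalPath.IsLengthMinimizing I V U e γ (-a) a →
      OpticalPath.IsTimedMinimizer I (fun _ ↦ True) V U e m γ (-a) a := fun h ↦
    ⟨h.1, h.2.1, h.2.2.1, fun σ h₁ h₂ h₃ h₄ _ ↦ h.2.2.2 σ h₁ h₂ h₃ h₄, he, htime⟩
  have hsmooth₁' : ContMDiffOn I 𝓘(ℝ, ℝ) 1 U₁ (closure V₁ ∩ V) := hsmooth₁.of_le (by simp)
  have hsmooth₂' : ContMDiffOn I 𝓘(ℝ, ℝ) 1 U₂ (closure V₂ ∩ V) := hsmooth₂.of_le (by simp)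
  constructor
  · intro α β hαβ
    constructor
    · intro hmaps
      refine hmin.solvesNewton hm hV₁ hV₁V
        (hsmooth₁'.mono fun x hx ↦ ⟨subset_closure hx, hV₁V hx⟩) hU₁ hαβ hmaps
        fun σ hσ hσγ t _ ↦ ?_
      by_cases ht : t ∈ Ioo α β
      · have hnot : ∀ x, x ∈ V₁ → x ∉ V₂ := fun x h1 h2 ↦ hdisj.ne_of_mem h1 h2 rfl
        exact ⟨iff_of_true (hσ t ht) (hmaps ht),
          iff_of_false (hnot _ (hσ t ht)) (hnot _ (hmaps ht))⟩
      · rw [hσγ t ht]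
        exact ⟨Iff.rfl, Iff.rfl⟩
    · intro hmaps
      refine hmin.solvesNewton hm hV₂ hV₂V
        (hsmooth₂'.mono fun x hx ↦ ⟨subset_closure hx, hV₂V hx⟩) hU₂ hαβ hmaps
        fun σ hσ hσγ t _ ↦ ?_
      by_cases ht : t ∈ Ioo α β
      · have hnot : ∀ x, x ∈ V₂ → x ∉ V₁ := fun x h1 h2 ↦ hdisj.ne_of_mem h2 h1 rfl
        exact ⟨iff_of_false (hnot _ (hσ t ht)) (hnot _ (hmaps ht)),
          iff_of_true (hσ t ht) (hmaps ht)⟩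
      · rw [hσγ t ht]
        exact ⟨Iff.rfl, Iff.rfl⟩
  · intro t₀ ht₀ hcon hleft n hn
    obtain ⟨v, w, hv, hw, hvE, hvn, htan, hcases⟩ := hmin.exists_velocities hV hV₁ hV₂ hdisj hS hVS
      hU₁ hU₂ hsmooth₁' hsmooth₂' he₁ he₂ hm ht₀ hcon hleft hn
    have hn1 : ‖n‖ = 1 := hn.1
    set C₁ := U₁ (γ t₀) with hC₁
    set C₂ := U₂ (γ t₀) with hC₂
    have hpV : γ t₀ ∈ V := hγ.2.1 (Ioo_subset_Icc_self ht₀)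
    have hγc : ContinuousAt γ t₀ := hγ.1.1.continuousAt (Icc_mem_nhds ht₀.1 ht₀.2)
    have hp₁ : γ t₀ ∈ closure V₁ :=
      mem_closure_of_tendsto (hγc.tendsto.mono_left nhdsWithin_le_nhds) hleft
    have hC₁e : C₁ < e := he₁ _ ⟨hp₁, hpV⟩
    have htang : OpticalPath.tangentialPart n w = OpticalPath.tangentialPart n v :=
      OpticalPath.sub_smul_eq_of_inner_eq hn1 fun z hz ↦ (htan z hz).1
    -- comparison of the normal components, from the conservation of energy
    have hpyth : OpticalPath.normalPart n w ^ 2 - OpticalPath.normalPart n v ^ 2 =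
        ‖w‖ ^ 2 - ‖v‖ ^ 2 := by
      have h1 := OpticalPath.norm_sq_eq_of_unit hn1 v
      have h2 := OpticalPath.norm_sq_eq_of_unit hn1 w
      have h3 : ‖w - inner ℝ w n • n‖ = ‖v - inner ℝ v n • n‖ := congrArg norm htang
      rw [h3] at h2
      simp only [OpticalPath.normalPart]
      linarith
    have hin : 0 ≤ OpticalPath.normalPart n v := hvn
    have hcont : ContinuousOn γ (Ioc t₀ a) := hγ.1.1.mono fun t ht ↦
      ⟨ht₀.1.le.trans ht.1.le, ht.2⟩
    have hside : (∀ t ∈ Ioc t₀ a, γ t ∉ S) → MapsTo γ (Ioc t₀ a) (V₁ ∪ V₂) := fun hS t ht ↦ by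
      rw [← hVS]
      exact ⟨hγ.2.1 ⟨ht₀.1.le.trans ht.1.le, ht.2⟩, hS t ht⟩
    have hend₁ : (∀ᶠ t in 𝓝[>] t₀, γ t ∈ V₁) → (∀ t ∈ Ioc t₀ a, γ t ∉ S) → γ a ∈ V₁ := fun h1 h2 ↦
      OpticalPath.mem_of_eventually_mem_right hV₁ hV₂ hdisj ht₀.2 hcont (hside h2) h1
    have hend₂ : (∀ᶠ t in 𝓝[>] t₀, γ t ∈ V₂) → (∀ t ∈ Ioc t₀ a, γ t ∉ S) → γ a ∈ V₂ := fun h1 h2 ↦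
      OpticalPath.mem_of_eventually_mem_right hV₂ hV₁ hdisj.symm ht₀.2 hcont
        (by rw [union_comm]; exact hside h2) h1
    have hcancel : ∀ x : ℝ, m * x = 0 → x = 0 := fun x hx ↦
      (mul_eq_zero.1 hx).resolve_left hm.ne'
    -- a reflected path keeps its speed, a refracted one changes its kinetic energy by `C₂ - C₁`
    have hrefl : m * ‖w‖ ^ 2 = 2 * (e - C₁) →
        OpticalPath.normalPart n w ^ 2 = OpticalPath.normalPart n v ^ 2 := fun hwE ↦ by
      have h1 := hcancel (‖w‖ ^ 2 - ‖v‖ ^ 2) (by linarith)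
      linarith
    have hrefr : m * ‖w‖ ^ 2 = 2 * (e - C₂) → OpticalPath.normalPart n w ^ 2 =
        OpticalPath.normalPart n v ^ 2 - 2 / m * (C₂ - C₁) := fun hwE ↦ by
      have h1 := hcancel (‖w‖ ^ 2 - ‖v‖ ^ 2 + 2 / m * (C₂ - C₁)) (by
        field_simp
        linarith)
      linarith
    refine ⟨v, w, hv, hw, fun hlt ↦ ?_, fun hL hgt hne ↦ ?_, fun hL heq ↦ ?_⟩
    · rcases hcases with ⟨hV, hwE, hwn, -⟩ | ⟨-, hwE, -⟩
      · have hwn' : OpticalPath.normalPart n w ≤ 0 := hwn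
        refine ⟨hV, hend₁ hV, ?_, htang⟩
        rcases sq_eq_sq_iff_eq_or_eq_neg.1 (hrefl hwE) with h | h
        · linarith
        · exact h
      · have := hrefr hwE
        nlinarith [sq_nonneg (OpticalPath.normalPart n w)]
    · rcases hcases with ⟨-, -, hwn, hle⟩ | ⟨hV, hwE, hwn⟩
      -- a reflection would force `v_n ≤ w_n ≤ 0 ≤ v_n`
      · exact absurd (le_antisymm ((hle (hglobal hL)).trans hwn) hin) hne
      · refine ⟨hV, hend₂ hV, ?_, htang⟩
        have h1 := hrefr hwE
        have h2 : 2 * (C₂ - C₁) / m = 2 / m * (C₂ - C₁) := by ring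
        rw [h2, ← h1]
        exact (Real.sqrt_sq hwn).symm
    · have hwn : OpticalPath.normalPart n w = 0 := by
        rcases hcases with ⟨-, -, hwn, hle⟩ | ⟨-, hwE, -⟩
        · exact le_antisymm hwn (hin.trans (hle (hglobal hL)))
        · have := hrefr hwE
          rw [heq] at this
          exact pow_eq_zero_iff (two_ne_zero) |>.1 this
      have hwv : w = v - (inner ℝ v n : ℝ) • n := by
        have h1 : w - OpticalPath.normalPart n w • n = v - (inner ℝ v n : ℝ) • n := htang
        rwa [hwn, zero_smul, sub_zero] at h1
      have hsin : Real.sin (InnerProductGeometry.angle v n) = √((e - C₂) / (e - C₁)) := by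
        have hv0 : v ≠ 0 := by
          rintro rfl
          rw [norm_zero] at hvE
          linarith
        refine OpticalPath.sin_angle_eq_sqrt hn1 hv0 ?_
        have h1 : OpticalPath.normalPart n v ^ 2 = 2 / m * (C₂ - C₁) := by linarith
        have h2 : ‖v‖ ^ 2 = 2 * (e - C₁) / m := by
          rw [eq_div_iff hm.ne']
          linarith
        have h3 : e - C₁ ≠ 0 := by linarith
        rw [h2]
        refine h1.trans ?_
        field_simp
        ring
      refine ⟨hwv, (htan w hwn).2, ?_, ?_, hsin⟩
      · have haV : γ a ∈ V := hγ.2.1 ⟨by linarith, le_rfl⟩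
        by_cases haS : γ a ∈ S
        · exact Or.inr (Or.inr haS)
        · rcases hVS.subset ⟨haV, haS⟩ with h | h
          · exact Or.inl h
          · exact Or.inr (Or.inl h)
      · rw [hsin, OpticalPath.refractiveIndex, OpticalPath.refractiveIndex, ← Real.sqrt_div',
          mul_div_mul_left _ _ two_ne_zero]
        linarith
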